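/- All rings are commutative. For a monoid $\mathcal S$, an $\mathcal S$-ring is a ring $R$ with a monoid morphism $s\mapsto\varphi_s$ from $\mathcal S$ to the ring endomorphisms of $R$. An $\mathcal S$-module over $R$ is an $R$-module $D$ with a monoid morphism $s\mapsto\varphi_{s,D}$ from $\mathcal S$ to $\mathrm{End}_{\mathrm{Ab}}(D)$ such that $\varphi_{s,D}(ad)=\varphi_s(a)\varphi_{s,D}(d)$; morphisms are the $R$-linear maps commuting with all $\varphi_s$. With the tensor product over $R$, with $\varphi_s(d\otimes e)=\varphi_s(d)\otimes\varphi_s(e)$, these form a symmetric monoidal category. $D$ is étale if it is finitely presented over $R$ and every linearisation $\varphi_{s,D}^*\colon R\otimes_{\varphi_s,R}D\to D$, $a\otimes d\mapsto a\varphi_{s,D}(d)$, is an isomorphism; it is étale projective if moreover $D$ is finite projective of constant rank over $R$. If $D_1$ is étale, $\underline{\mathrm{Hom}}_R(D_1,D_2)$ denotes $\mathrm{Hom}_R(D_1,D_2)$ with the action characterised by $\varphi_s(f)(\varphi_{s,D_1}(d))=\varphi_{s,D_2}(f(d))$. Let $R$ be an $\mathcal S$-ring and $r\in R$ such that $R$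 is $r$-torsion-free, $r$-adically complete and separated, and $\varphi_s(r)R=rR$ for all $s\in\mathcal S$; then $R/r$ is an $\mathcal S$-ring. Let $\mathrm{Mod}^{\mathrm{ét,dv}}_{\mathcal S}(R,r)$ be the full subcategory of the étale $\mathcal S$-modules $D$ over $R$ with bounded $r^\infty$-torsion such that each $r^nD/r^{n+1}D$ ($n\ge 0$) is a finite projective $R/r$-module of constant rank. Let $\mathcal S'$ be a normal submonoid of $\mathcal S$ (i.e. $s\mathcal S'=\mathcal S's$ for all $s\in\mathcal S$), and let $\mathcal S/\mathcal S'$ be the quotient of $\mathcal S$ by the smallest congruence identifying every element of $\mathcal S'$ with $1$. Write $D^{\mathcal S'}$ for the elements fixed by all $\varphi_{s,D}$, $s\in\mathcal S'$, and $\mathrm{Inv}(D)=D^{\mathcal S'}$, an $\mathcal S/\mathcal S'$-module over the $\mathcal S/\mathcal S'$-ring $R^{\mathcal S'}$. Assume $r\in R^{\mathcal S'}$. The comparison morphism of an $\mathcal S$-module $D$ over $R$ is $R\otimes_{R^{\mathcal S'}}\mathrm{Inv}(D)\to D$, $a\otimes d\mapsto ad$; an $\mathcal S$-module over $R/r$ is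 viewed as an $\mathcal S$-module over $R$ via $R\to R/r$. **Theorem.** Suppose that 1. the map $R^{\mathcal S'}/r\to R/r$ is faithfully flat; 2. $\mathrm H^1(\mathcal S',R/r)=0$ (monoid cohomology: $1$-cocycles are the maps $f\colon\mathcal S'\to R/r$ with $f(st)=f(s)+\varphi_s(f(t))$, and $1$-coboundaries are the maps $s\mapsto\varphi_s(a)-a$); 3. for every étale projective $\mathcal S$-module $D$ over $R/r$, the comparison morphism $R\otimes_{R^{\mathcal S'}}\mathrm{Inv}(D)\to D$ is an isomorphism. Then the comparison morphism is an isomorphism for every object $D$ of $\mathrm{Mod}^{\mathrm{ét,dv}}_{\mathcal S}(R,r)$. Moreover $\mathrm{Inv}$ maps $\mathrm{Mod}^{\mathrm{ét,dv}}_{\mathcal S}(R,r)$ to $\mathrm{Mod}^{\mathrm{ét,dv}}_{\mathcal S/\mathcal S'}(R^{\mathcal S'},r)$; these full subcategories contain the unit and are stable under tensor products, and the restricted functor is * strong symmetric monoidal, with structure maps $R^{\mathcal S'}\xrightarrow{=}\mathrm{Inv}(R)$ and $\mathrm{Inv}(D_1)\otimes_{R^{\mathcal S'}}\mathrm{Inv}(D_2)\to\mathrm{Inv}(D_1\otimes_RD_2)$,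 $d_1\otimes d_2\mapsto d_1\otimes d_2$; * closed, i.e. for all objects $D_1,D_2$ of $\mathrm{Mod}^{\mathrm{ét,dv}}_{\mathcal S}(R,r)$ the canonical morphism $\mathrm{Inv}(\underline{\mathrm{Hom}}_R(D_1,D_2))\to\underline{\mathrm{Hom}}_{R^{\mathcal S'}}(\mathrm{Inv}(D_1),\mathrm{Inv}(D_2))$, $f\mapsto f|_{\mathrm{Inv}(D_1)}$, is an isomorphism of $\mathcal S/\mathcal S'$-modules over $R^{\mathcal S'}$. -/

import Mathlib

open CategoryTheory MonoidalCategory TensorProduct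

universe w u

/-! ### `S`-rings and `S`-modules over `R`

An `S`-ring is a commutative ring `R` with `[MulSemiringAction S R]`; the endomorphism `φ_s` of `R`
is `a ↦ s • a`, i.e. `MulSemiringAction.toRingHom S R s`. -/

/-- The linearisation `T ⊗_{σ, R} D → E`, `t ⊗ d ↦ t • f d`, of a `σ`-semilinear map
`f : D → E`, where `σ : R → T` is a ring morphism. -/
noncomputable def linearisation {R T : Type u} [CommRing R] [CommRing T] {σ : R →+* T}
    {D E : Type u} [AddCommGroup D] [Module R D] [AddCommGroup E] [Module T E]
    (f : D →ₛₗ[σ] E) :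
    letI := σ.toAlgebra
    T ⊗[R] D →ₗ[T] E :=
  letI := σ.toAlgebra
  letI := Module.compHom E σ
  haveI : IsScalarTower R T E := ⟨fun a t e => mul_smul (σ a) t e⟩
  LinearMap.liftBaseChange T
    { toFun := f, map_add' := f.map_add, map_smul' := f.map_smulₛₗ : D →ₗ[R] E }

lemma linearisation_tmul {R T : Type u} [CommRing R] [CommRing T] {σ : R →+* T}
    {D E : Type u} [AddCommGroup D] [Module R D] [AddCommGroup E] [Module T E]
    (f : D →ₛₗ[σ] E) (t : T) (d : D) :
    letI := σ.toAlgebra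
    linearisation f (t ⊗ₜ[R] d) = t • f d := rfl

/-- Two `T`-linear maps that agree on the image of `f` are equal, as soon as the linearisation of
`f` is surjective. -/
lemma linearisation_hom_ext {R T : Type u} [CommRing R] [CommRing T] {σ : R →+* T}
    {D E : Type u} [AddCommGroup D] [Module R D] [AddCommGroup E] [Module T E]
    {f : D →ₛₗ[σ] E} (hf : Function.Surjective (linearisation f))
    {F : Type u} [AddCommGroup F] [Module T F] {g h : E →ₗ[T] F}
    (H : ∀ d, g (f d) = h (f d)) : g = h := by
  let := σ.toAlgebra
  ext e
  obtain ⟨x, rfl⟩ := hf e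
  induction x using TensorProduct.induction_on with
  | zero => simp
  | tmul t d => rw [linearisation_tmul, map_smul, map_smul, H]
  | add x y hx hy => rw [map_add, map_add, map_add, hx, hy]

/-- For `f : D → E` with bijective linearisation `f^*` and `g : D → F`, both `σ`-semilinear, the
`T`-linear map `g^* ∘ (f^*)⁻¹ : E → F`. -/
noncomputable def linearisationExtend {R T : Type u} [CommRing R] [CommRing T] {σ : R →+* T}
    {D E F : Type u} [AddCommGroup D] [Module R D] [AddCommGroup E] [Module T E]
    [AddCommGroup F] [Module T F]
    (f : D →ₛₗ[σ] E) (hf : Function.Bijective (linearisation f)) (g : D →ₛₗ[σ] F) : E →ₗ[T] F :=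
  letI := σ.toAlgebra
  linearisation g ∘ₗ (LinearEquiv.ofBijective (linearisation f) hf).symm.toLinearMap

lemma linearisationExtend_apply {R T : Type u} [CommRing R] [CommRing T] {σ : R →+* T}
    {D E F : Type u} [AddCommGroup D] [Module R D] [AddCommGroup E] [Module T E]
    [AddCommGroup F] [Module T F]
    (f : D →ₛₗ[σ] E) (hf : Function.Bijective (linearisation f)) (g : D →ₛₗ[σ] F) (d : D) :
    linearisationExtend f hf g (f d) = g d := by
  let := σ.toAlgebra
  have h : (LinearEquiv.ofBijective (linearisation f) hf).symm (f d) = (1 : T) ⊗ₜ[R] d := by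
    rw [LinearEquiv.symm_apply_eq]
    change _ = linearisation f _
    rw [linearisation_tmul, one_smul]
  change linearisation g ((LinearEquiv.ofBijective (linearisation f) hf).symm (f d)) = _
  rw [h, linearisation_tmul, one_smul]

/-- An `S`-module over the `S`-ring `R`: an `R`-module with a monoid morphism
`φ : S → End_Ab(D)` such that each `φ s` is `φ_s`-semilinear. -/
structure SModule (S : Type w) [Monoid S] (R : Type u) [CommRing R] [MulSemiringAction S R] where
  carrier : Type u
  [isAddCommGroup : AddCommGroup carrier]
  [isModule : Module R carrier]
  φ : S →* AddMonoid.End carrier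
  φ_smul : ∀ (s : S) (a : R) (d : carrier), φ s (a • d) = (s • a) • φ s d

attribute [instance] SModule.isAddCommGroup SModule.isModule

namespace SModule

variable {S : Type w} [Monoid S] {R : Type u} [CommRing R] [MulSemiringAction S R]

instance : CoeSort (SModule.{w, u} S R) (Type u) := ⟨SModule.carrier⟩

/-- `φ s` as a semilinear map. -/
def act (D : SModule.{w, u} S R) (s : S) : D →ₛₗ[MulSemiringAction.toRingHom S R s] D where
  toFun := D.φ s
  map_add' := map_add (D.φ s)
  map_smul' := D.φ_smul s

@[simp] lemma act_apply (D : SModule.{w, u} S R) (s : S) (d : D) : D.act s d = D.φ s d := rfl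

@[simp] lemma φ_one_apply (D : SModule.{w, u} S R) (d : D) : D.φ 1 d = d := by
  rw [map_one]; rfl

lemma φ_mul_apply (D : SModule.{w, u} S R) (s t : S) (d : D) :
    D.φ (s * t) d = D.φ s (D.φ t d) := by
  rw [map_mul]; rfl

/-- Morphisms of `S`-modules over `R`: the `R`-linear maps that commute with every `φ s`. -/
@[ext]
structure Hom (D E : SModule.{w, u} S R) where
  lin : D →ₗ[R] E
  comm : ∀ (s : S) (d : D), lin (D.φ s d) = E.φ s (lin d)

instance : Category (SModule.{w, u} S R) where
  Hom := Hom
  id D := ⟨LinearMap.id, fun _ _ => rfl⟩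
  comp f g := ⟨g.lin ∘ₗ f.lin, fun s d => by simp [f.comm, g.comm]⟩

@[ext]
lemma hom_ext {D E : SModule.{w, u} S R} {f g : D ⟶ E} (h : ∀ d, f.lin d = g.lin d) : f = g :=
  Hom.ext (LinearMap.ext h)

@[simp] lemma id_lin (D : SModule.{w, u} S R) : Hom.lin (𝟙 D) = LinearMap.id := rfl

@[simp] lemma comp_lin {D E F : SModule.{w, u} S R} (f : D ⟶ E) (g : E ⟶ F) :
    (f ≫ g).lin = g.lin ∘ₗ f.lin := rfl

/-- An isomorphism from an equivariant linear equivalence. -/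
def mkIso {D E : SModule.{w, u} S R} (e : D ≃ₗ[R] E)
    (h : ∀ (s : S) (d : D), e (D.φ s d) = E.φ s (e d)) : D ≅ E where
  hom := ⟨e.toLinearMap, h⟩
  inv := ⟨e.symm.toLinearMap, fun s d => by
    apply e.injective
    simp [h]⟩
  hom_inv_id := by ext d; exact e.symm_apply_apply d
  inv_hom_id := by ext d; exact e.apply_symm_apply d

/-! ### The symmetric monoidal structure -/

/-- The unit: `R` with `φ s = (s • ·)`. -/
abbrev unit (S : Type w) [Monoid S] (R : Type u) [CommRing R] [MulSemiringAction S R] :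
    SModule.{w, u} S R where
  carrier := R
  φ := DistribMulAction.toAddMonoidEnd S R
  φ_smul s a d := smul_mul' s a d

/-- The tensor product `D ⊗ E` over `R`, with `φ s (d ⊗ e) = φ s d ⊗ φ s e`. -/
noncomputable abbrev tensor (D E : SModule.{w, u} S R) : SModule.{w, u} S R where
  carrier := D ⊗[R] E
  φ :=
    { toFun := fun s => (TensorProduct.map (D.act s) (E.act s)).toAddMonoidHom
      map_one' := by
        ext x
        change TensorProduct.map (D.act 1) (E.act 1) x = x
        induction x using TensorProduct.induction_on with
        | zero => simp
        | tmul d e => simp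
        | add x y hx hy => rw [map_add, hx, hy]
      map_mul' := fun s t => by
        ext x
        change TensorProduct.map (D.act (s * t)) (E.act (s * t)) x =
          TensorProduct.map (D.act s) (E.act s) (TensorProduct.map (D.act t) (E.act t) x)
        induction x using TensorProduct.induction_on with
        | zero => simp
        | tmul d e => simp
        | add x y hx hy => simp only [map_add, hx, hy] }
  φ_smul s a x := (TensorProduct.map (D.act s) (E.act s)).map_smulₛₗ a x

/-- Additive maps out of a tensor product are equivariant as soon as they are on pure tensors. -/
lemma comm_of_tmul {D E F : SModule.{w, u} S R} (g : D ⊗[R] E →ₗ[R] F)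
    (h : ∀ s d e, g (D.φ s d ⊗ₜ E.φ s e) = F.φ s (g (d ⊗ₜ e))) (s : S) (x : D ⊗[R] E) :
    g (TensorProduct.map (D.act s) (E.act s) x) = F.φ s (g x) := by
  induction x using TensorProduct.induction_on with
  | zero => simp
  | tmul d e => exact h s d e
  | add x y hx hy => simp only [map_add, hx, hy]

/-- The tensor product of two morphisms. -/
noncomputable def tensorMap {D D' E E' : SModule.{w, u} S R} (f : D ⟶ D') (g : E ⟶ E') :
    D.tensor E ⟶ D'.tensor E' where
  lin := TensorProduct.map f.lin g.lin
  comm := comm_of_tmul (F := D'.tensor E') (TensorProduct.map f.lin g.lin) fun s d e => by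
    change f.lin (D.φ s d) ⊗ₜ[R] g.lin (E.φ s e) = D'.φ s (f.lin d) ⊗ₜ[R] E'.φ s (g.lin e)
    rw [f.comm, g.comm]

noncomputable instance : MonoidalCategoryStruct (SModule.{w, u} S R) where
  tensorObj := tensor
  tensorUnit := unit S R
  tensorHom := tensorMap
  whiskerLeft D _ _ g := tensorMap (𝟙 D) g
  whiskerRight f E := tensorMap f (𝟙 E)
  associator D E F := mkIso (D := (D.tensor E).tensor F) (E := D.tensor (E.tensor F))
    (TensorProduct.assoc R D E F) fun s x => by
      refine comm_of_tmul (D := D.tensor E) (F := D.tensor (E.tensor F))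
        (TensorProduct.assoc R D E F).toLinearMap (fun s y f => ?_) s x
      induction y using TensorProduct.induction_on with
      | zero => simp
      | tmul d e => rfl
      | add y z hy hz => simp only [map_add, TensorProduct.add_tmul, hy, hz]
  leftUnitor D := mkIso (D := (unit S R).tensor D) (TensorProduct.lid R D) <|
    comm_of_tmul (D := unit S R) (TensorProduct.lid R D).toLinearMap fun s a d =>
      (D.φ_smul s a d).symm
  rightUnitor D := mkIso (D := D.tensor (unit S R)) (TensorProduct.rid R D) <|
    comm_of_tmul (E := unit S R) (TensorProduct.rid R D).toLinearMap fun s d a =>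
      (D.φ_smul s a d).symm

noncomputable instance : MonoidalCategory (SModule.{w, u} S R) where
  tensorHom_def _ _ := Hom.ext (TensorProduct.ext' fun _ _ => rfl)
  id_tensorHom_id _ _ := Hom.ext (TensorProduct.ext' fun _ _ => rfl)
  tensorHom_comp_tensorHom _ _ _ _ := Hom.ext (TensorProduct.ext' fun _ _ => rfl)
  whiskerLeft_id _ _ := Hom.ext (TensorProduct.ext' fun _ _ => rfl)
  id_whiskerRight _ _ := Hom.ext (TensorProduct.ext' fun _ _ => rfl)
  associator_naturality _ _ _ := Hom.ext (TensorProduct.ext_threefold fun _ _ _ => rfl)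
  leftUnitor_naturality f := Hom.ext (TensorProduct.ext' fun a d => (f.lin.map_smul a d).symm)
  rightUnitor_naturality f := Hom.ext (TensorProduct.ext' fun d a => (f.lin.map_smul a d).symm)
  pentagon _ _ _ _ := Hom.ext (TensorProduct.ext_fourfold fun _ _ _ _ => rfl)
  triangle _ _ := Hom.ext (TensorProduct.ext_threefold fun d a e =>
    (TensorProduct.smul_tmul a d e).symm)

noncomputable instance : BraidedCategory (SModule.{w, u} S R) where
  braiding D E := mkIso (D := D.tensor E) (E := E.tensor D) (TensorProduct.comm R D E) <|
    comm_of_tmul (F := E.tensor D) (TensorProduct.comm R D E).toLinearMap fun _ _ _ => rfl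
  braiding_naturality_right _ _ _ _ := Hom.ext (TensorProduct.ext' fun _ _ => rfl)
  braiding_naturality_left _ _ := Hom.ext (TensorProduct.ext' fun _ _ => rfl)
  hexagon_forward _ _ _ := Hom.ext (TensorProduct.ext_threefold fun _ _ _ => rfl)
  hexagon_reverse _ _ _ := Hom.ext (TensorProduct.ext_threefold' fun _ _ _ => rfl)

noncomputable instance : SymmetricCategory (SModule.{w, u} S R) where
  symmetry _ _ := Hom.ext (TensorProduct.ext' fun _ _ => rfl)

/-! ### Étale modules and internal Homs -/

end SModule

/-- `M` is a finite projective `A`-module of constant rank over `Spec A`. -/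
def IsFiniteProjectiveOfConstantRank (A M : Type u) [CommRing A] [AddCommGroup M] [Module A M] :
    Prop :=
  Module.Finite A M ∧ Module.Projective A M ∧
    ∃ n : ℕ, ∀ p : PrimeSpectrum A, Module.rankAtStalk (R := A) M p = n

namespace SModule

variable {S : Type w} [Monoid S] {R : Type u} [CommRing R] [MulSemiringAction S R]

/-- Étale `S`-modules over `R`: finitely presented, and every linearisation
`φ_s^* D = R ⊗_{φ_s, R} D → D`, `a ⊗ d ↦ a • φ s d`, is an isomorphism. -/
def IsEtale : ObjectProperty (SModule.{w, u} S R) := fun D =>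
  Module.FinitePresentation R D ∧ ∀ s, Function.Bijective (linearisation (D.act s))

/-- Étale projective `S`-modules over `R`. -/
def IsEtaleProj : ObjectProperty (SModule.{w, u} S R) := fun D =>
  D.IsEtale ∧ IsFiniteProjectiveOfConstantRank R D

/-- The action of `s` on `Hom_R(D, E)` for `D` étale: it sends `f` to the composite
`D ≅ φ_s^* D → φ_s^* E → E` of the inverse of the linearisation of `φ_{s,D}`, of `φ_s^* f`, and of
the linearisation of `φ_{s,E}`. -/
noncomputable def ihomAct {D : SModule.{w, u} S R} (hD : D.IsEtale) (E : SModule.{w, u} S R)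
    (s : S) (f : D →ₗ[R] E) : D →ₗ[R] E :=
  linearisationExtend (D.act s) (hD.2 s) ((E.act s).comp f)

lemma ihomAct_apply {D : SModule.{w, u} S R} (hD : D.IsEtale) (E : SModule.{w, u} S R)
    (s : S) (f : D →ₗ[R] E) (d : D) : ihomAct hD E s f (D.φ s d) = E.φ s (f d) :=
  linearisationExtend_apply (D.act s) (hD.2 s) ((E.act s).comp f) d

lemma ihomAct_unique {D : SModule.{w, u} S R} (hD : D.IsEtale) {E : SModule.{w, u} S R}
    {s : S} {f g : D →ₗ[R] E} (h : ∀ d, g (D.φ s d) = E.φ s (f d)) : ihomAct hD E s f = g :=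
  linearisation_hom_ext (hD.2 s).2 fun d => (ihomAct_apply hD E s f d).trans (h d).symm

/-- The internal Hom from an étale `S`-module `D` to an `S`-module `E`: the `R`-module
`Hom_R(D, E)` with the action `ihomAct`. -/
noncomputable abbrev ihom {D : SModule.{w, u} S R} (hD : D.IsEtale) (E : SModule.{w, u} S R) :
    SModule.{w, u} S R where
  carrier := D →ₗ[R] E
  φ :=
    { toFun := fun s =>
        { toFun := ihomAct hD E s
          map_zero' := ihomAct_unique hD fun d => by simp
          map_add' := fun f g => ihomAct_unique hD fun d => by simp [ihomAct_apply] }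
      map_one' := by
        ext1 f
        exact ihomAct_unique hD fun d => by simp
      map_mul' := fun s t => by
        ext1 f
        refine ihomAct_unique hD fun d => ?_
        change ihomAct hD E s (ihomAct hD E t f) _ = _
        rw [φ_mul_apply, φ_mul_apply, ihomAct_apply, ihomAct_apply] }
  φ_smul s a f := ihomAct_unique hD fun d => by
    change (s • a) • ihomAct hD E s f (D.φ s d) = E.φ s (a • f d)
    rw [ihomAct_apply, E.φ_smul]

/-- Restriction of scalars along a morphism of `S`-rings. -/
def restrictScalars {T : Type u} [CommRing T] [MulSemiringAction S T] (a : R →+*[S] T)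
    (D : SModule.{w, u} S T) : SModule.{w, u} S R where
  carrier := D
  isModule := Module.compHom D (a : R →+* T)
  φ := D.φ
  φ_smul s x d := (D.φ_smul s (a x) d).trans (congrArg (· • D.φ s d) (map_smul a s x).symm)

end SModule

/-! ### Invariants by a normal submonoid -/

/-- A submonoid `S'` is normal if `s S' = S' s` for all `s`. -/
class IsNormalSubmonoid {S : Type w} [Monoid S] (S' : Submonoid S) : Prop where
  coset_eq : ∀ s : S, (fun t => s * t) '' (S' : Set S) = (fun t => t * s) '' (S' : Set S)

/-- The quotient monoid `S / S'`: the quotient of `S` by the smallest congruence that identifies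
every element of `S'` with `1`. -/
abbrev QuotMonoid {S : Type w} [Monoid S] (S' : Submonoid S) : Type w :=
  (conGen fun a b : S => a ∈ S' ∧ b = 1).Quotient

/-- The subring `R^{S'}`. -/
abbrev InvRing {S : Type w} [Monoid S] (S' : Submonoid S) (R : Type u) [CommRing R]
    [MulSemiringAction S R] : Subring R :=
  FixedPoints.subring R S'

section Invariants

variable {S : Type w} [Monoid S] (S' : Submonoid S) {R : Type u} [CommRing R]
  [MulSemiringAction S R]

lemma mem_invRing {a : R} : a ∈ InvRing S' R ↔ ∀ s ∈ S', s • a = a :=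
  ⟨fun h s hs => h ⟨s, hs⟩, fun h s => h s s.2⟩

/-- A monoid morphism `S → P` that is trivial on `S'` factors through `S / S'`. -/
def QuotMonoid.lift {P : Type*} [Monoid P] (f : S →* P) (hf : ∀ s ∈ S', f s = 1) :
    QuotMonoid S' →* P :=
  Con.lift _ f <| Con.conGen_le.2 fun a b h => by
    rw [Con.ker_rel, h.2, map_one, hf a h.1]

lemma smul_mem_invRing [IsNormalSubmonoid S'] (s : S) {a : R} (ha : a ∈ InvRing S' R) :
    s • a ∈ InvRing S' R := by
  rw [mem_invRing] at ha ⊢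
  intro t ht
  obtain ⟨t', ht', h⟩ : t * s ∈ (fun t => s * t) '' (S' : Set S) := by
    rw [IsNormalSubmonoid.coset_eq s]
    exact ⟨t, ht, rfl⟩
  rw [← mul_smul, ← h]
  change (s * t') • a = _
  rw [mul_smul, ha t' ht']

/-- The endomorphism of `R^{S'}` induced by `φ_s`. -/
def invRingAct [IsNormalSubmonoid S'] (s : S) : InvRing S' R →+* InvRing S' R :=
  (MulSemiringAction.toRingHom S R s).restrict _ _ fun _ => smul_mem_invRing S' s

/-- The `S / S'`-ring structure of `R^{S'}`: the class of `s` acts by the restriction of `φ_s`. -/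
instance [IsNormalSubmonoid S'] : MulSemiringAction (QuotMonoid S') (InvRing S' R) :=
  MulSemiringAction.compHom _ <| QuotMonoid.lift S'
    { toFun := invRingAct S' (R := R)
      map_one' := by ext a; exact one_smul S (a : R)
      map_mul' := fun s t => by ext a; exact mul_smul s t (a : R) }
    fun s hs => by ext a; exact (mem_invRing S').1 a.2 s hs

@[simp] lemma coe_mk_smul [IsNormalSubmonoid S'] (s : S) (a : InvRing S' R) :
    (((s : QuotMonoid S') • a : InvRing S' R) : R) = s • (a : R) := rfl

namespace SModule

/-- The invariants `D^{S'}`, an `R^{S'}`-submodule of `D`. -/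
def invariants (D : SModule.{w, u} S R) : Submodule (InvRing S' R) D where
  carrier := {d | ∀ s ∈ S', D.φ s d = d}
  add_mem' hd he s hs := by rw [map_add, hd s hs, he s hs]
  zero_mem' s _ := map_zero _
  smul_mem' a d hd s hs := by
    change D.φ s ((a : R) • d) = (a : R) • d
    rw [D.φ_smul, hd s hs, (mem_invRing S').1 a.2 s hs]

variable {S'} in
lemma mem_invariants {D : SModule.{w, u} S R} {d : D} :
    d ∈ D.invariants S' ↔ ∀ s ∈ S', D.φ s d = d := Iff.rfl

/-- The comparison morphism `R ⊗_{R^{S'}} D^{S'} → D`, `a ⊗ d ↦ a • d`. -/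
noncomputable def comparison (D : SModule.{w, u} S R) :
    R ⊗[InvRing S' R] D.invariants S' →ₗ[R] D :=
  LinearMap.liftBaseChange R (D.invariants S').subtype

variable [IsNormalSubmonoid S']

lemma φ_mem_invariants (D : SModule.{w, u} S R) (s : S) {d : D} (hd : d ∈ D.invariants S') :
    D.φ s d ∈ D.invariants S' := by
  intro t ht
  obtain ⟨t', ht', h⟩ : t * s ∈ (fun t => s * t) '' (S' : Set S) := by
    rw [IsNormalSubmonoid.coset_eq s]
    exact ⟨t, ht, rfl⟩
  rw [← φ_mul_apply, ← h]
  change D.φ (s * t') d = _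
  rw [φ_mul_apply, hd t' ht']

/-- The endomorphism of `D^{S'}` induced by `φ s`. -/
def invariantsAct (D : SModule.{w, u} S R) (s : S) : AddMonoid.End (D.invariants S') where
  toFun d := ⟨D.φ s d, D.φ_mem_invariants S' s d.2⟩
  map_zero' := Subtype.ext (map_zero (D.φ s))
  map_add' d e := Subtype.ext (map_add (D.φ s) (d : D) (e : D))

/-- `Inv(D) = D^{S'}` as an `S / S'`-module over `R^{S'}`: the class of `s` acts by the restriction
of `φ s`. -/
abbrev invObj (D : SModule.{w, u} S R) : SModule.{w, u} (QuotMonoid S') (InvRing S' R) where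
  carrier := D.invariants S'
  φ := QuotMonoid.lift S'
    { toFun := D.invariantsAct S'
      map_one' := by ext d; exact D.φ_one_apply d
      map_mul' := fun s t => by ext d; exact D.φ_mul_apply s t d }
    fun s hs => by ext d; exact d.2 s hs
  φ_smul q a d := by
    induction q using Con.induction_on with
    | H s => exact Subtype.ext (D.φ_smul s (a : R) (d : D))

/-- The functor `Inv`. -/
abbrev invFunctor : SModule.{w, u} S R ⥤ SModule.{w, u} (QuotMonoid S') (InvRing S' R) where
  obj D := D.invObj S'
  map {D E} f :=
    { lin := (f.lin.restrictScalars (InvRing S' R)).restrict fun d hd s hs => by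
        change E.φ s (f.lin d) = f.lin d
        rw [← f.comm, hd s hs]
      comm := fun q d => by
        induction q using Con.induction_on with
        | H s => exact Subtype.ext (f.comm s (d : D)) }

/-- The unit map `R^{S'} → Inv(R)`, the identity of `R^{S'}`. -/
def invUnit : unit (QuotMonoid S') (InvRing S' R) ⟶ (invFunctor S').obj (unit S R) where
  lin :=
    { toFun := fun a => ⟨(a : R), (mem_invRing S').1 a.2⟩
      map_add' := fun _ _ => rfl
      map_smul' := fun _ _ => rfl }
  comm q a := by
    induction q using Con.induction_on with
    | H s => rfl

/-- The tensorator `D^{S'} ⊗ E^{S'} → (D ⊗ E)^{S'}`, `d ⊗ e ↦ d ⊗ e`. -/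
noncomputable def invTensor (D E : SModule.{w, u} S R) :
    (D.invObj S').tensor (E.invObj S') ⟶ (invFunctor S').obj (D.tensor E) where
  lin := TensorProduct.lift <| LinearMap.mk₂ (InvRing S' R)
    (fun d e => (⟨(d : D) ⊗ₜ[R] (e : E), fun s hs => by
      change D.φ s (d : D) ⊗ₜ[R] E.φ s (e : E) = _
      rw [d.2 s hs, e.2 s hs]⟩ : (D.tensor E).invariants S'))
    (fun _ _ _ => Subtype.ext (TensorProduct.add_tmul _ _ _))
    (fun _ _ _ => Subtype.ext rfl)
    (fun _ _ _ => Subtype.ext (TensorProduct.tmul_add _ _ _))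
    (fun a d e => Subtype.ext (TensorProduct.tmul_smul (a : R) (d : D) (e : E)))
  comm q := by
    refine comm_of_tmul (F := (invFunctor S').obj (D.tensor E)) _ (fun q d e => ?_) q
    induction q using Con.induction_on with
    | H s => rfl

/-- The canonical lax symmetric monoidal structure of `Inv`. -/
noncomputable instance : (invFunctor (R := R) S').LaxBraided where
  ε := invUnit S'
  μ D E := invTensor S' D E
  μ_natural_left _ _ := Hom.ext (TensorProduct.ext' fun _ _ => rfl)
  μ_natural_right _ _ := Hom.ext (TensorProduct.ext' fun _ _ => rfl)
  associativity _ _ _ := Hom.ext (TensorProduct.ext_threefold fun _ _ _ => rfl)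
  left_unitality _ := Hom.ext (TensorProduct.ext' fun _ _ => rfl)
  right_unitality _ := Hom.ext (TensorProduct.ext' fun _ _ => rfl)
  braided _ _ := Hom.ext (TensorProduct.ext' fun _ _ => rfl)

/-- The canonical morphism `Inv(Hom_R(D, E)) → Hom_{R^{S'}}(Inv D, Inv E)` from the invariants of
the internal Hom to the internal Hom of the invariants, `f ↦ f|_{D^{S'}}`, when `D` and `Inv D`
are étale. -/
noncomputable def invIhom {D : SModule.{w, u} S R} (hD : D.IsEtale)
    (hD' : ((invFunctor S').obj D).IsEtale) (E : SModule.{w, u} S R) :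
    (invFunctor S').obj (ihom hD E) ⟶ ihom hD' ((invFunctor S').obj E) where
  lin :=
    { toFun := fun f => ((f : D →ₗ[R] E).restrictScalars (InvRing S' R)).restrict
        fun d hd s hs => by
          change E.φ s ((f : D →ₗ[R] E) d) = (f : D →ₗ[R] E) d
          rw [← ihomAct_apply hD E s, hd s hs]
          exact congrArg (fun g : D →ₗ[R] E => g d) (f.2 s hs)
      map_add' := fun _ _ => rfl
      map_smul' := fun _ _ => rfl }
  comm q f := by
    induction q using Con.induction_on with
    | H s =>
      refine (ihomAct_unique hD' fun d => ?_).symm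
      exact Subtype.ext (ihomAct_apply hD E s (f : D →ₗ[R] E) (d : D))

end SModule

end Invariants

/-! ### First monoid cohomology -/

section Cohomology

variable (G : Type w) [Monoid G] (A : Type u) [AddCommGroup A] [DistribMulAction G A]

/-- `1`-cocycles: maps `f : G → A` with `f (s t) = f s + s • f t`. -/
def oneCocycles : AddSubgroup (G → A) where
  carrier := {f | ∀ s t, f (s * t) = f s + s • f t}
  add_mem' {f g} hf hg s t := by
    simp only [Pi.add_apply, hf s t, hg s t, smul_add]
    abel
  zero_mem' s t := by simp
  neg_mem' {f} hf s t := by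
    simp only [Pi.neg_apply, hf s t, smul_neg]
    abel

/-- `1`-coboundaries: the maps `s ↦ s • a - a`. -/
def oneCoboundaries : AddSubgroup (G → A) where
  carrier := {f | ∃ a : A, ∀ s, f s = s • a - a}
  add_mem' := by
    rintro f g ⟨a, ha⟩ ⟨b, hb⟩
    refine ⟨a + b, fun s => ?_⟩
    simp only [Pi.add_apply, ha, hb, smul_add]
    abel
  zero_mem' := ⟨0, fun s => by simp⟩
  neg_mem' := by
    rintro f ⟨a, ha⟩
    refine ⟨-a, fun s => ?_⟩
    simp only [Pi.neg_apply, ha, smul_neg]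
    abel

/-- `H¹(G, A)` for a monoid `G` acting on an abelian group `A`, by inhomogeneous cochains. -/
abbrev MonoidH1 : Type (max w u) :=
  oneCocycles G A ⧸ (oneCoboundaries G A).addSubgroupOf (oneCocycles G A)

end Cohomology

/-! ### Dévissage -/

section Devissage

/-- The submodule `r^n M`. -/
abbrev powSubmodule {R : Type u} [CommRing R] (r : R) (M : Type u) [AddCommGroup M] [Module R M]
    (n : ℕ) : Submodule R M :=
  LinearMap.range (LinearMap.lsmul R M (r ^ n))

/-- `r · (r^n M) = r^(n+1) M` as submodules of `r^n M`. -/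
lemma span_smul_top_powSubmodule {R : Type u} [CommRing R] (r : R) (M : Type u) [AddCommGroup M]
    [Module R M] (n : ℕ) :
    (Ideal.span {r} • ⊤ : Submodule R (powSubmodule r M n)) =
      (powSubmodule r M (n + 1)).submoduleOf (powSubmodule r M n) := by
  ext ⟨x, y, rfl⟩
  rw [Submodule.ideal_span_singleton_smul, Submodule.mem_smul_pointwise_iff_exists]
  constructor
  · rintro ⟨⟨_, z, rfl⟩, -, h⟩
    refine ⟨z, ?_⟩
    have h' := congrArg Subtype.val h
    simpa [pow_succ', mul_smul] using h'
  · rintro ⟨z, hz⟩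
    refine ⟨⟨_, z, rfl⟩, trivial, Subtype.ext ?_⟩
    simpa [pow_succ', mul_smul] using hz

/-- `M` has finite projective `(r, μ)`-dévissage: each `r^n M / r^(n+1) M` is a finite projective
`R / r`-module of constant rank. -/
def HasFiniteProjectiveDevissage {R : Type u} [CommRing R] (r : R) (M : Type u) [AddCommGroup M]
    [Module R M] : Prop :=
  ∀ n : ℕ, IsFiniteProjectiveOfConstantRank (R ⧸ Ideal.span {r})
    (powSubmodule r M n ⧸ (Ideal.span {r} • ⊤ : Submodule R (powSubmodule r M n)))

/-- `M` has bounded `r^∞`-torsion. -/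
def HasBoundedTorsion {R : Type u} [CommRing R] (r : R) (M : Type u) [AddCommGroup M]
    [Module R M] : Prop :=
  ∃ N : ℕ, ∀ (m : M) (k : ℕ), r ^ k • m = 0 → r ^ N • m = 0

/-- `(R, r)` is an `S`-dévissage setup: `R` is `r`-torsion-free, `r`-adically complete and
separated, and `φ_s(r) R = r R` for all `s`. -/
class IsDevissageSetup (S : Type w) [Monoid S] {R : Type u} [CommRing R] [MulSemiringAction S R]
    (r : R) : Prop where
  torsionFree : ∀ a : R, r * a = 0 → a = 0
  complete : IsAdicComplete (Ideal.span {r}) R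
  span_smul : ∀ s : S, Ideal.span {s • r} = Ideal.span {r}

variable {S : Type w} [Monoid S] {R : Type u} [CommRing R] [MulSemiringAction S R]

lemma IsDevissageSetup.le_comap (r : R) [h : IsDevissageSetup S r] (s : S) :
    Ideal.span {r} ≤ (Ideal.span {r}).comap (MulSemiringAction.toRingHom S R s) := by
  rw [Ideal.span_singleton_le_iff_mem, Ideal.mem_comap, ← h.span_smul s]
  exact Ideal.mem_span_singleton_self _

/-- The `S`-ring structure of `R / r`: `φ_s` of the class of `a` is the class of `φ_s a`. -/
instance (r : R) [IsDevissageSetup S r] : MulSemiringAction S (R ⧸ Ideal.span {r}) :=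
  MulSemiringAction.compHom (M := R ⧸ Ideal.span {r} →+* R ⧸ Ideal.span {r}) _
    { toFun := fun s => Ideal.quotientMap _ _ (IsDevissageSetup.le_comap r s)
      map_one' := Ideal.Quotient.ringHom_ext <| by
        ext a
        exact congrArg (Ideal.Quotient.mk _) (one_smul S a)
      map_mul' := fun s t => Ideal.Quotient.ringHom_ext <| by
        ext a
        exact congrArg (Ideal.Quotient.mk _) (mul_smul s t a) }

/-- The quotient map `R → R / r` as a morphism of `S`-rings. -/
def quotientHom (S : Type w) [Monoid S] [MulSemiringAction S R] (r : R) [IsDevissageSetup S r] :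
    R →+*[S] R ⧸ Ideal.span {r} where
  __ := Ideal.Quotient.mk (Ideal.span {r})
  map_smul' _ _ := rfl

/-- The map `R^{S'} / r → R / r` induced by the inclusion, for `r ∈ R^{S'}`. -/
def invQuotientMap (S' : Submonoid S) (r : InvRing S' R) :
    (InvRing S' R ⧸ Ideal.span {r}) →+* R ⧸ Ideal.span {(r : R)} :=
  Ideal.quotientMap _ (InvRing S' R).subtype <| by
    rw [Ideal.span_singleton_le_iff_mem, Ideal.mem_comap]
    exact Ideal.mem_span_singleton_self _

namespace SModule

/-- Étale `S`-modules over `R` with projective `r`-dévissage. -/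
def IsEtaleDv (r : R) : ObjectProperty (SModule.{w, u} S R) := fun D =>
  D.IsEtale ∧ HasFiniteProjectiveDevissage r D ∧ HasBoundedTorsion r D

/-- The functor induced by `Inv` between full subcategories given by properties `P` and `Q`. -/
def invRestrict (S' : Submonoid S) [IsNormalSubmonoid S']
    {P : ObjectProperty (SModule.{w, u} S R)}
    {Q : ObjectProperty (SModule.{w, u} (QuotMonoid S') (InvRing S' R))}
    (h : ∀ D, P D → Q ((invFunctor S').obj D)) : P.FullSubcategory ⥤ Q.FullSubcategory :=
  Q.lift (P.ι ⋙ invFunctor S') fun D => h D.obj D.property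

end SModule

end Devissage

/-! ### Finite projective modules of constant rank -/

/-! Write A for R^{S'}. The proof is a dévissage along 0 → rD → D → D/rD → 0. If r^N kills the
r-power torsion of D, then r^N D is torsion-free, so N such steps lead to a torsion-free module
(`HasDevissageOfLength`).

Modules killed by r (`satisfiesDescent_of_quotient`). Hypothesis 3 gives D/rD ≅ R ⊗ G with G =
(D/rD)^{S'}. Faithfully flat descent along A/r → R/r makes G finite projective of constant rank over
A/r and makes its linearisations bijective. As G is a direct summand of a finite free A/r-module,
hypothesis 2 gives H¹(S', D/rD) = 0.

Torsion-free modules (`satisfiesDevissageDescent_of_torsionFree`). Such a D is projective over R,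
and H¹(S', D) = 0 by successive approximation. So invariants of D/rD lift to D. A projective
A-module P lifting G then maps to D^{S'}, and R ⊗ P → D is bijective because it is so modulo r. As
the invariants of R ⊗ P are P, this gives D^{S'} ≅ P.

Induction step (`SatisfiesDevissageDescent.of_powObj`). Since H¹(S', rD) = 0, the sequence of
invariants is exact on the right too, and the five lemma transfers comparison and linearisations
from rD and D/rD to D. The delicate point is rD ∩ D^{S'} = r D^{S'}, without which D^{S'} would not
inherit the dévissage (`exists_smul_of_powObj`). Being étale is not carried through the induction:
only surjectivity of the linearisations is passed to rD, and on D/rD equality of ranks turns it into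
bijectivity.

Tensor products are not exact, so they are treated by a structure theorem
(`HasDevissageOfLength.isElementary`): a module with dévissage is a finite direct sum of modules
P/cP, with P finite projective and c zero or a positive power of r. Tensor products of these are of
the same kind (`IsElementary.tensorProduct_induction`), which gives stability. For an A-module X of
this kind the invariants of R ⊗ X are X, because (R/c)^{S'} = A/c
(`IsInvariantsOfInduced.modSMul_self`); with X = Inv(D₁) ⊗ Inv(D₂) this is strong monoidality.
Closedness follows from the comparison isomorphism, as a linear map on D ≅ R ⊗ D^{S'} is determined
by its restriction to D^{S'} (`invIhom_bijective`). -/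

namespace IsFiniteProjectiveOfConstantRank

variable {A M N : Type u} [CommRing A] [AddCommGroup M] [Module A M] [AddCommGroup N] [Module A N]

lemma of_equiv (e : M ≃ₗ[A] N) (h : IsFiniteProjectiveOfConstantRank A M) :
    IsFiniteProjectiveOfConstantRank A N := by
  obtain ⟨h1, h2, n, hn⟩ := h
  exact ⟨Module.Finite.equiv e, Module.Projective.of_equiv e, n, fun p => by
    rw [← Module.rankAtStalk_eq_of_equiv e, hn]⟩

lemma of_subsingleton [Subsingleton M] : IsFiniteProjectiveOfConstantRank A M :=
  ⟨inferInstance, inferInstance, 0, fun p => by simp⟩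

lemma ker {f : M →ₗ[A] N} (hf : Function.Surjective f)
    (hM : IsFiniteProjectiveOfConstantRank A M) (hN : IsFiniteProjectiveOfConstantRank A N) :
    IsFiniteProjectiveOfConstantRank A (LinearMap.ker f) := by
  obtain ⟨h1, h2, n, hn⟩ := hM
  obtain ⟨h3, h4, m, hm⟩ := hN
  obtain ⟨s, hs⟩ := Module.projective_lifting_property f LinearMap.id hf
  have hs' : ∀ y, f (s y) = y := fun y => LinearMap.congr_fun hs y
  let q : M →ₗ[A] LinearMap.ker f :=
    (LinearMap.id - s ∘ₗ f).codRestrict _ fun x => by simp [hs']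
  have hq : q ∘ₗ (LinearMap.ker f).subtype = LinearMap.id := by
    ext x
    simp [q]
  have hqs : Function.Surjective q := fun x => ⟨x, LinearMap.congr_fun hq x⟩
  have : Module.Finite A (LinearMap.ker f) := Module.Finite.of_surjective q hqs
  have : Module.Projective A (LinearMap.ker f) :=
    Module.Projective.of_split (LinearMap.ker f).subtype q hq
  -- Truncated subtraction is harmless: at every prime the splitting M ≅ ker f × N gives n = rank +
  -- m.
  refine ⟨‹_›, ‹_›, n - m, fun p => ?_⟩
  let e : M ≃ₗ[A] LinearMap.ker f × N := LinearEquiv.ofLinearMap (q.prod f)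
    ((LinearMap.ker f).subtype.coprod s)
    (by
      refine LinearMap.ext fun x => Prod.ext (Subtype.ext ?_) ?_ <;> simp [q, hs'])
    (by ext x; simp [q])
  have h := congrFun (Module.rankAtStalk_eq_of_equiv e) p
  rw [Module.rankAtStalk_prod, Pi.add_apply, hn, hm] at h
  omega

lemma tensorProduct (hM : IsFiniteProjectiveOfConstantRank A M)
    (hN : IsFiniteProjectiveOfConstantRank A N) :
    IsFiniteProjectiveOfConstantRank A (M ⊗[A] N) := by
  obtain ⟨h1, h2, n, hn⟩ := hM
  obtain ⟨h3, h4, m, hm⟩ := hN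
  exact ⟨inferInstance, inferInstance, n * m, fun p => by
    rw [Module.rankAtStalk_tensorProduct, Pi.mul_apply, hn, hm]⟩

end IsFiniteProjectiveOfConstantRank

lemma Module.Projective.pi_of_finite {A : Type*} [CommRing A] {ι : Type*} [Finite ι]
    (M : ι → Type*) [∀ i, AddCommGroup (M i)] [∀ i, Module A (M i)]
    [∀ i, Module.Projective A (M i)] : Module.Projective A (∀ i, M i) := by
  classical
  cases nonempty_fintype ι
  exact Module.Projective.of_equiv (DirectSum.linearEquivFunOnFintype A ι M)

lemma IsFiniteProjectiveOfConstantRank.pi {A : Type u} [CommRing A] {ι : Type} [Finite ι]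
    {M : ι → Type u} [∀ i, AddCommGroup (M i)]
    [∀ i, Module A (M i)] (h : ∀ i, IsFiniteProjectiveOfConstantRank A (M i)) :
    IsFiniteProjectiveOfConstantRank A (∀ i, M i) := by
  cases nonempty_fintype ι
  have h1 := fun i => (h i).1
  have h2 := fun i => (h i).2.1
  choose n hn using fun i => (h i).2.2
  refine ⟨inferInstance, Module.Projective.pi_of_finite M, ∑ i, n i, fun p => ?_⟩
  rw [Module.rankAtStalk_pi, finsum_eq_sum_of_fintype]
  exact Finset.sum_congr rfl fun i _ => hn i p

/-! ### Modules modulo `r` -/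

section Modulo

variable {R : Type u} [CommRing R] (r : R)

lemma mem_span_singleton_smul_top {M : Type*} [AddCommGroup M] [Module R M] {x : M} :
    x ∈ (Ideal.span {r} • ⊤ : Submodule R M) ↔ ∃ y, x = r • y := by
  rw [Submodule.ideal_span_singleton_smul, Submodule.mem_smul_pointwise_iff_exists]
  exact ⟨fun ⟨y, _, h⟩ => ⟨y, h.symm⟩, fun ⟨y, h⟩ => ⟨y, trivial, h.symm⟩⟩

/-- `M / r M` is a finite projective `R / r`-module of constant rank. -/
def IsProjectiveModulo (M : Type u) [AddCommGroup M] [Module R M] : Prop :=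
  IsFiniteProjectiveOfConstantRank (R ⧸ Ideal.span {r})
    (M ⧸ (Ideal.span {r} • ⊤ : Submodule R M))

variable {r} {M N : Type u} [AddCommGroup M] [Module R M] [AddCommGroup N] [Module R N]

/-- A linear map that induces a bijection modulo `r`. -/
structure IsBijectiveModulo (r : R) {M N : Type*} [AddCommGroup M] [Module R M]
    [AddCommGroup N] [Module R N] (f : M →ₗ[R] N) : Prop where
  surj : ∀ y, ∃ x z, y = f x + r • z
  inj : ∀ x z, f x = r • z → ∃ w, x = r • w

/-- The isomorphism modulo `r` induced by `f`. -/
noncomputable def IsBijectiveModulo.equiv {f : M →ₗ[R] N} (hf : IsBijectiveModulo r f) :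
    (M ⧸ (Ideal.span {r} • ⊤ : Submodule R M)) ≃ₗ[R ⧸ Ideal.span {r}]
      (N ⧸ (Ideal.span {r} • ⊤ : Submodule R N)) :=
  LinearEquiv.extendScalarsOfSurjective (R := R) Ideal.Quotient.mk_surjective <|
    LinearEquiv.ofBijective (Submodule.mapQ _ _ f <| by
      intro x hx
      obtain ⟨y, rfl⟩ := (mem_span_singleton_smul_top r).1 hx
      exact (mem_span_singleton_smul_top r).2 ⟨f y, map_smul f r y⟩) <| by
      constructor
      · rw [← LinearMap.ker_eq_bot, eq_bot_iff]
        intro x hx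
        obtain ⟨x, rfl⟩ := Submodule.mkQ_surjective _ x
        simp only [LinearMap.mem_ker, Submodule.mkQ_apply, Submodule.mapQ_apply,
          Submodule.Quotient.mk_eq_zero, mem_span_singleton_smul_top] at hx
        obtain ⟨z, hz⟩ := hx
        simpa [Submodule.Quotient.mk_eq_zero, mem_span_singleton_smul_top] using hf.inj x z hz
      · intro y
        obtain ⟨y, rfl⟩ := Submodule.mkQ_surjective _ y
        obtain ⟨x, z, rfl⟩ := hf.surj y
        refine ⟨Submodule.Quotient.mk x, ?_⟩
        simp only [Submodule.mapQ_apply, Submodule.mkQ_apply]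
        rw [eq_comm, Submodule.Quotient.eq, add_sub_cancel_left, mem_span_singleton_smul_top]
        exact ⟨z, rfl⟩

lemma IsBijectiveModulo.isProjectiveModulo_iff {f : M →ₗ[R] N} (hf : IsBijectiveModulo r f) :
    IsProjectiveModulo r M ↔ IsProjectiveModulo r N :=
  ⟨fun h => h.of_equiv hf.equiv, fun h => h.of_equiv hf.equiv.symm⟩

lemma IsBijectiveModulo.of_equiv (e : M ≃ₗ[R] N) : IsBijectiveModulo r e.toLinearMap where
  surj y := ⟨e.symm y, 0, by simp⟩
  inj x z h := ⟨e.symm z, e.injective (by simpa using h)⟩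

lemma IsBijectiveModulo.mkQ {p : Submodule R M} (hp : ∀ x ∈ p, ∃ w, x = r • w) :
    IsBijectiveModulo r p.mkQ where
  surj y := by
    obtain ⟨x, rfl⟩ := p.mkQ_surjective y
    exact ⟨x, 0, by simp⟩
  inj x z h := by
    obtain ⟨z, rfl⟩ := p.mkQ_surjective z
    rw [← map_smul, ← sub_eq_zero, ← map_sub, Submodule.mkQ_apply,
      Submodule.Quotient.mk_eq_zero] at h
    obtain ⟨w, hw⟩ := hp _ h
    exact ⟨z + w, by rw [smul_add, ← hw]; abel⟩

lemma IsProjectiveModulo.of_equiv (e : M ≃ₗ[R] N) (h : IsProjectiveModulo r M) :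
    IsProjectiveModulo r N :=
  (IsBijectiveModulo.of_equiv e).isProjectiveModulo_iff.1 h

lemma IsProjectiveModulo.of_subsingleton [Subsingleton M] : IsProjectiveModulo r M :=
  IsFiniteProjectiveOfConstantRank.of_subsingleton

/-! ### Adic limits -/

variable (r) in
/-- `M` is `r`-adically separated. -/
def IsAdicSeparated (M : Type*) [AddCommGroup M] [Module R M] : Prop :=
  ∀ x : M, (∀ n : ℕ, ∃ y, x = r ^ n • y) → x = 0

variable (r) in
/-- `r`-adic Cauchy sequences in `M` converge. -/
def HasAdicLimits (M : Type*) [AddCommGroup M] [Module R M] : Prop :=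
  ∀ x : ℕ → M, (∀ n, ∃ z, x (n + 1) = x n + r ^ n • z) → ∃ L, ∀ n, ∃ c, L = x n + r ^ n • c

lemma isAdicSeparated_self [h : IsAdicComplete (Ideal.span {r}) R] : IsAdicSeparated r R := by
  intro x hx
  refine h.toIsHausdorff.haus x fun n => ?_
  rw [SModEq.zero, Ideal.span_singleton_pow, mem_span_singleton_smul_top]
  exact hx n

lemma hasAdicLimits_self [h : IsAdicComplete (Ideal.span {r}) R] : HasAdicLimits r R := by
  intro x hx
  obtain ⟨L, hL⟩ := h.toIsPrecomplete.prec (f := x) fun {m n} hmn => by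
    induction n, hmn using Nat.le_induction with
    | base => exact SModEq.refl _
    | succ n hmn ih =>
      refine ih.trans ?_
      obtain ⟨z, hz⟩ := hx n
      rw [SModEq.comm, SModEq.sub_mem, hz, add_sub_cancel_left, Ideal.span_singleton_pow,
        mem_span_singleton_smul_top]
      exact ⟨r ^ (n - m) • z, by rw [← mul_smul, ← pow_add, Nat.add_sub_cancel' hmn]⟩
  refine ⟨L, fun n => ?_⟩
  have := (hL n).symm
  rw [SModEq.sub_mem, Ideal.span_singleton_pow, mem_span_singleton_smul_top] at this
  obtain ⟨y, hy⟩ := this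
  exact ⟨y, by rw [← hy]; abel⟩

lemma IsAdicSeparated.of_injective {M N : Type*} [AddCommGroup M] [Module R M] [AddCommGroup N]
    [Module R N] (hN : IsAdicSeparated r N) (f : M →ₗ[R] N) (hf : Function.Injective f) :
    IsAdicSeparated r M := fun x hx => hf <| by
  rw [map_zero]
  refine hN _ fun n => ?_
  obtain ⟨y, rfl⟩ := hx n
  exact ⟨f y, map_smul _ _ _⟩

lemma IsAdicSeparated.pi {ι : Type*} {M : ι → Type*} [∀ i, AddCommGroup (M i)]
    [∀ i, Module R (M i)] (h : ∀ i, IsAdicSeparated r (M i)) : IsAdicSeparated r (∀ i, M i) := by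
  intro x hx
  funext i
  refine h i _ fun n => ?_
  obtain ⟨y, rfl⟩ := hx n
  exact ⟨y i, rfl⟩

lemma HasAdicLimits.pi {ι : Type*} {M : ι → Type*} [∀ i, AddCommGroup (M i)]
    [∀ i, Module R (M i)] (h : ∀ i, HasAdicLimits r (M i)) : HasAdicLimits r (∀ i, M i) := by
  intro x hx
  choose z hz using hx
  choose L hL using fun i => h i (fun n => x n i) fun n => ⟨z n i, congrFun (hz n) i⟩
  choose c hc using hL
  exact ⟨L, fun n => ⟨fun i => c i n, funext fun i => hc i n⟩⟩

/-- The increments of a Cauchy sequence lift one at a time, and their partial sums form a Cauchy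
sequence upstairs whose limit is pushed down. Limits need not be unique here. -/
lemma HasAdicLimits.of_surjective {M N : Type*} [AddCommGroup M] [Module R M] [AddCommGroup N]
    [Module R N] (hM : HasAdicLimits r M) (f : M →ₗ[R] N) (hf : Function.Surjective f) :
    HasAdicLimits r N := by
  intro x hx
  choose z hz using hx
  choose w hw using fun n => hf (z n)
  obtain ⟨y, hy⟩ := hf (x 0)
  have key : ∀ n, f (y + ∑ i ∈ Finset.range n, r ^ i • w i) = x n := by
    intro n
    induction n with
    | zero => simp [hy]
    | succ n ih => rw [Finset.sum_range_succ, ← add_assoc, map_add, ih, map_smul, hw, hz]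
  obtain ⟨L, hL⟩ := hM (fun n => y + ∑ i ∈ Finset.range n, r ^ i • w i) fun n =>
    ⟨w n, by rw [Finset.sum_range_succ, ← add_assoc]⟩
  refine ⟨f L, fun n => ?_⟩
  obtain ⟨c, rfl⟩ := hL n
  exact ⟨f c, by rw [map_add, key, map_smul]⟩

lemma hasAdicLimits_of_finite [IsAdicComplete (Ideal.span {r}) R] (M : Type*) [AddCommGroup M]
    [Module R M] [Module.Finite R M] : HasAdicLimits r M := by
  obtain ⟨n, f, hf⟩ := Module.Finite.exists_fin' R M
  exact (HasAdicLimits.pi fun _ => hasAdicLimits_self).of_surjective f hf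

/-- A section of the canonical free cover embeds a projective module in a power of R. -/
lemma isAdicSeparated_of_projective [IsAdicComplete (Ideal.span {r}) R] (M : Type*)
    [AddCommGroup M] [Module R M] [Module.Projective R M] : IsAdicSeparated r M := by
  obtain ⟨s, hs⟩ := Module.projective_def'.1 ‹Module.Projective R M›
  refine IsAdicSeparated.of_injective (IsAdicSeparated.pi fun _ : M => isAdicSeparated_self)
    (Finsupp.lcoeFun ∘ₗ s) ?_
  intro x y h
  have h' : s x = s y := DFunLike.coe_injective h
  rw [← LinearMap.id_apply (R := R) x, ← hs, LinearMap.comp_apply, h', ← LinearMap.comp_apply, hs,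
    LinearMap.id_apply]

lemma eq_zero_of_smul_eq_zero_of_projective (hr : ∀ a : R, r * a = 0 → a = 0) (M : Type*)
    [AddCommGroup M] [Module R M] [Module.Projective R M] (x : M) (hx : r • x = 0) : x = 0 := by
  obtain ⟨s, hs⟩ := Module.projective_def'.1 ‹Module.Projective R M›
  have h : s x = 0 := by
    ext i
    refine hr _ ?_
    have := DFunLike.congr_fun (congrArg s hx) i
    simpa using this
  rw [← LinearMap.id_apply (R := R) x, ← hs, LinearMap.comp_apply, h, map_zero]

/-! ### Nakayama and lifting -/

lemma surjective_of_surjective_modulo [IsAdicComplete (Ideal.span {r}) R] {M N : Type*}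
    [AddCommGroup M] [Module R M] [AddCommGroup N] [Module R N] [Module.Finite R N]
    {f : M →ₗ[R] N} (hf : ∀ y, ∃ x z, y = f x + r • z) : Function.Surjective f := by
  rw [← LinearMap.range_eq_top, eq_top_iff]
  refine Submodule.le_of_le_smul_of_le_jacobson_bot Module.Finite.fg_top
    (IsAdicComplete.le_jacobson_bot (Ideal.span {r})) fun y _ => ?_
  obtain ⟨x, z, rfl⟩ := hf y
  exact Submodule.add_mem_sup ⟨x, rfl⟩ ((mem_span_singleton_smul_top r).2 ⟨z, rfl⟩)

/-- An element of the kernel is divisible by r, and the quotient lies in the kernel again because N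
is torsion-free. Iterating, the element is infinitely divisible. -/
lemma injective_of_injective_modulo {M N : Type*}
    [AddCommGroup M] [Module R M] [AddCommGroup N] [Module R N] (hM : IsAdicSeparated r M)
    (hN : ∀ y : N, r • y = 0 → y = 0) {f : M →ₗ[R] N}
    (hf : ∀ x z, f x = r • z → ∃ w, x = r • w) : Function.Injective f := by
  rw [injective_iff_map_eq_zero]
  intro x hx
  suffices h : ∀ n : ℕ, ∃ y, x = r ^ n • y ∧ f y = 0 from
    hM x fun n => (h n).imp fun y hy => hy.1
  intro n
  induction n with
  | zero => exact ⟨x, by simp, hx⟩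
  | succ n ih =>
    obtain ⟨y, rfl, hy⟩ := ih
    obtain ⟨w, rfl⟩ := hf y 0 (by rw [hy, smul_zero])
    exact ⟨w, by rw [pow_succ, mul_smul], hN _ (by rw [← map_smul, hy])⟩

/-- Newton iteration for the equation x² = x. Although B is not commutative, each iterate is a
polynomial in the single element `a`. -/
lemma exists_isIdempotentElem_sub_eq_smul {B : Type*} [Ring B] [Algebra R B]
    (hs : IsAdicSeparated r B) (hl : HasAdicLimits r B) {a b : B} (h : a * a - a = r • b) :
    ∃ e c : B, e * e = e ∧ e = a + r • c := by
  -- The polynomial 3x² − 2x³ is the one for which F(x)² − F(x) is a multiple of (x² − x)².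
  let F : B → B := fun x => 3 * (x * x) - 2 * (x * x * x)
  let x : ℕ → B := fun n => F^[n] a
  have hx : ∀ n, x (n + 1) = F (x n) := fun n => Function.iterate_succ_apply' F n a
  have hF : ∀ x, F x = x + (x * x - x) * (1 - 2 * x) := fun x => by
    simp only [F]; noncomm_ring
  have hF' : ∀ x, F x * F x - F x = (x * x - x) * (x * x - x) * (4 * (x * x) - 4 * x - 3) :=
    fun x => by simp only [F]; noncomm_ring
  -- The defect is squared at each step, but one more factor r per step is enough for convergence.
  have key : ∀ n, ∃ y, x n * x n - x n = r ^ (n + 1) • y := by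
    intro n
    induction n with
    | zero => exact ⟨b, by simpa [x] using h⟩
    | succ n ih =>
      obtain ⟨y, hy⟩ := ih
      refine ⟨r ^ n • (y * y * (4 * (x n * x n) - 4 * x n - 3)), ?_⟩
      rw [hx, hF', hy, ← mul_smul, ← pow_add, smul_mul_smul_comm, ← pow_add, smul_mul_assoc]
      congr 2
      ring
  obtain ⟨e, he⟩ := hl (fun n => x n) fun n => by
    obtain ⟨y, hy⟩ := key n
    refine ⟨r • (y * (1 - 2 * x n)), ?_⟩
    rw [hx, hF, hy, ← mul_smul, ← pow_succ, smul_mul_assoc]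
  -- Index 1 is needed: at index 0 the limit is compared with `a` modulo r ^ 0 = 1, which says
  -- nothing, whereas the first iterate is already congruent to `a` modulo r.
  obtain ⟨c, hc⟩ := he 1
  obtain ⟨y, hy⟩ := key 0
  refine ⟨e, c + b * (1 - 2 * a), sub_eq_zero.1 (hs _ fun n => ?_), ?_⟩
  · obtain ⟨c, rfl⟩ := he n
    obtain ⟨y, hy⟩ := key n
    refine ⟨r • y + c * x n + x n * c + r ^ n • (c * c) - c, ?_⟩
    rw [sub_eq_iff_eq_add] at hy
    simp only [mul_add, add_mul, hy, smul_add, smul_sub, smul_mul_assoc, mul_smul_comm, pow_succ,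
      mul_smul]
    abel
  · rw [hc, hx 0, hF]
    change a + (a * a - a) * (1 - 2 * a) + r ^ 1 • c = _
    rw [h, pow_one, smul_mul_assoc, smul_add]
    abel

/-- Finite projective `R / r`-modules of the form `M / r M` lift to finite projective
`R`-modules. -/
lemma IsProjectiveModulo.exists_lift [IsAdicComplete (Ideal.span {r}) R]
    (h : IsProjectiveModulo r M) :
    ∃ (P : Type u) (_ : AddCommGroup P) (_ : Module R P) (g : P →ₗ[R] M),
      Module.Finite R P ∧ Module.Projective R P ∧ IsBijectiveModulo r g := by
  let k := R ⧸ Ideal.span {r}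
  let N := M ⧸ (Ideal.span {r} • ⊤ : Submodule R M)
  obtain ⟨h1, h2, -⟩ := h
  obtain ⟨n, p, hp⟩ := Module.Finite.exists_fin' k N
  obtain ⟨i, hi⟩ := Module.projective_lifting_property p LinearMap.id hp
  have hi' : ∀ y, p (i y) = y := fun y => LinearMap.congr_fun hi y
  let F := Fin n → R
  let π : F →ₗ[R] (Fin n → k) := LinearMap.compLeft (Algebra.linearMap R k) (Fin n)
  have hπ : Function.Surjective π := fun y => by
    choose x hx using fun j => Ideal.Quotient.mk_surjective (y j)
    exact ⟨x, funext hx⟩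
  have hπ0 : ∀ x, π x = 0 → ∃ y, x = r • y := fun x hx => by
    have : ∀ j, ∃ y, x j = r * y := fun j => by
      have := congrFun hx j
      exact Ideal.mem_span_singleton.1 (Ideal.Quotient.eq_zero_iff_mem.1 this)
    choose y hy using this
    exact ⟨y, funext hy⟩
  have hπr : ∀ x, π (r • x) = 0 := fun x => by
    ext j
    exact Ideal.Quotient.eq_zero_iff_mem.2
      (Ideal.mem_span_singleton.2 (Dvd.intro (x j) rfl))
  -- M/rM is the image of the idempotent i ∘ p of k^n. This idempotent is lifted to an endomorphism
  -- `a` of R^n, then corrected to an idempotent `e` congruent to `a` modulo r; the range of `e` is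
  -- the desired lift.
  obtain ⟨a, ha⟩ := Module.projective_lifting_property π
    ((i ∘ₗ p).restrictScalars R ∘ₗ π) hπ
  have ha' : ∀ x, π (a x) = i (p (π x)) := fun x => LinearMap.congr_fun ha x
  have hab : ∀ x, ∃ y, (a * a - a) x = r • y := fun x => hπ0 _ <| by
    simp [ha', hi']
  -- Divisibility of a² − a by r is known only value by value; projectivity of R^n makes the
  -- quotient a linear map.
  obtain ⟨b, hb⟩ := Module.projective_lifting_property
    (LinearMap.rangeRestrict (LinearMap.lsmul R F r))
    ((a * a - a).codRestrict _ fun x => (hab x).imp fun y hy => hy.symm)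
    (LinearMap.surjective_rangeRestrict _)
  have hb' : a * a - a = r • b := by
    refine LinearMap.ext fun x => ?_
    exact (congrArg Subtype.val (LinearMap.congr_fun hb x)).symm
  have hsep : IsAdicSeparated r F := IsAdicSeparated.pi fun _ => isAdicSeparated_self
  obtain ⟨e, c, he, hec⟩ := exists_isIdempotentElem_sub_eq_smul (B := Module.End R F)
    (fun f hf => by
      refine LinearMap.ext fun x => ?_
      refine hsep _ fun n => ?_
      obtain ⟨y, rfl⟩ := hf n
      exact ⟨y x, rfl⟩) (hasAdicLimits_of_finite _) hb'
  have he' : ∀ x, e (e x) = e x := fun x => LinearMap.congr_fun he x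
  have hπe : ∀ x, π (e x) = i (p (π x)) := fun x => by
    rw [hec, LinearMap.add_apply, map_add, ha', LinearMap.smul_apply, hπr, add_zero]
  have hes : e.rangeRestrict ∘ₗ (LinearMap.range e).subtype = LinearMap.id := by
    ext ⟨_, y, rfl⟩ : 2
    exact he' y
  have hproj : Module.Projective R (LinearMap.range e) := Module.Projective.of_split _ _ hes
  obtain ⟨g, hg⟩ := Module.projective_lifting_property
    (Submodule.mkQ (Ideal.span {r} • ⊤ : Submodule R M))
    (p.restrictScalars R ∘ₗ π ∘ₗ (LinearMap.range e).subtype) (Submodule.mkQ_surjective _)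
  have hg' : ∀ x : LinearMap.range e, Submodule.Quotient.mk (g x) = p (π x) :=
    fun x => LinearMap.congr_fun hg x
  refine ⟨LinearMap.range e, inferInstance, inferInstance, g, inferInstance, hproj, ?_, ?_⟩
  · intro y
    obtain ⟨v, hv⟩ := hp (Submodule.Quotient.mk y)
    obtain ⟨f, rfl⟩ := hπ v
    have h3 : (Submodule.Quotient.mk y : N) = Submodule.Quotient.mk (g ⟨e f, f, rfl⟩) := by
      rw [hg', hπe, hi', hv]
    rw [Submodule.Quotient.eq, mem_span_singleton_smul_top] at h3
    obtain ⟨z, hz⟩ := h3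
    exact ⟨_, z, by rw [← hz]; abel⟩
  · rintro ⟨_, x, rfl⟩ z hz
    have h3 : p (π (e x)) = 0 := by
      rw [← hg' ⟨e x, x, rfl⟩, hz, Submodule.Quotient.mk_eq_zero, mem_span_singleton_smul_top]
      exact ⟨z, rfl⟩
    have h4 : π (e x) = 0 := by rw [← he', hπe, h3, map_zero]
    obtain ⟨y, hy⟩ := hπ0 _ h4
    refine ⟨⟨e y, y, rfl⟩, Subtype.ext ?_⟩
    change e x = r • e y
    -- The quotient y need not lie in the range of `e`; applying `e` once more replaces it by e y,
    -- which does.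
    rw [← he', hy, map_smul]

/-- A finite `r`-torsion-free module that is projective modulo `r` is projective. -/
lemma IsProjectiveModulo.projective [IsAdicComplete (Ideal.span {r}) R] [Module.Finite R M]
    (h : IsProjectiveModulo r M) (hM : ∀ y : M, r • y = 0 → y = 0) : Module.Projective R M := by
  obtain ⟨P, _, _, g, hP, hP', hg⟩ := h.exists_lift
  exact Module.Projective.of_equiv (LinearEquiv.ofBijective g
    ⟨injective_of_injective_modulo (isAdicSeparated_of_projective P) hM hg.inj,
      surjective_of_surjective_modulo hg.surj⟩)

end Modulo

section Structure

variable {R : Type u} [CommRing R] {r : R}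

lemma IsBijectiveModulo.mk_of_surjective {M N : Type*} [AddCommGroup M] [Module R M]
    [AddCommGroup N] [Module R N] {f : M →ₗ[R] N} (hf : Function.Surjective f)
    (h : ∀ x z, f x = r • z → ∃ w, x = r • w) : IsBijectiveModulo r f where
  surj y := by
    obtain ⟨x, rfl⟩ := hf y
    exact ⟨x, 0, by simp⟩
  inj := h

lemma smul_eq_zero_of_quotient {X : Type*} [AddCommGroup X] [Module R X]
    [Module (R ⧸ Ideal.span {r}) X] [IsScalarTower R (R ⧸ Ideal.span {r}) X] (x : X) :
    r • x = 0 := by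
  rw [← algebraMap_smul (R ⧸ Ideal.span {r}) r x]
  have : algebraMap R (R ⧸ Ideal.span {r}) r = 0 :=
    Ideal.Quotient.eq_zero_iff_mem.2 (Ideal.mem_span_singleton_self r)
  rw [this, zero_smul]

lemma isProjectiveModulo_iff_of_quotient {X : Type u} [AddCommGroup X] [Module R X]
    [Module (R ⧸ Ideal.span {r}) X] [IsScalarTower R (R ⧸ Ideal.span {r}) X] :
    IsProjectiveModulo r X ↔ IsFiniteProjectiveOfConstantRank (R ⧸ Ideal.span {r}) X := by
  have h : (Ideal.span {r} • ⊤ : Submodule R X) = ⊥ := by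
    rw [eq_bot_iff]
    intro x hx
    obtain ⟨y, rfl⟩ := (mem_span_singleton_smul_top r).1 hx
    exact smul_eq_zero_of_quotient y
  have e : (X ⧸ (Ideal.span {r} • ⊤ : Submodule R X)) ≃ₗ[R ⧸ Ideal.span {r}] X :=
    LinearEquiv.extendScalarsOfSurjective (R := R) Ideal.Quotient.mk_surjective
      (Submodule.quotEquivOfEqBot _ h)
  exact ⟨fun H => IsFiniteProjectiveOfConstantRank.of_equiv e H,
    fun H => IsFiniteProjectiveOfConstantRank.of_equiv e.symm H⟩

lemma IsProjectiveModulo.pi {ι : Type} [Finite ι] {M : ι → Type u} [∀ i, AddCommGroup (M i)]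
    [∀ i, Module R (M i)] (h : ∀ i, IsProjectiveModulo r (M i)) :
    IsProjectiveModulo r (∀ i, M i) := by
  let p := fun i => (Ideal.span {r} • ⊤ : Submodule R (M i))
  have hb : IsBijectiveModulo r (LinearMap.piMap fun i => (p i).mkQ) := by
    refine .mk_of_surjective (fun y => ?_) fun x z hz => ?_
    · choose x hx using fun i => (p i).mkQ_surjective (y i)
      exact ⟨x, funext hx⟩
    · have : ∀ i, ∃ w, x i = r • w := fun i => by
        rw [← mem_span_singleton_smul_top, ← Submodule.Quotient.mk_eq_zero]
        exact (congrFun hz i).trans (smul_eq_zero_of_quotient (r := r) (z i))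
      choose w hw using this
      exact ⟨w, funext hw⟩
  rw [hb.isProjectiveModulo_iff, isProjectiveModulo_iff_of_quotient]
  exact IsFiniteProjectiveOfConstantRank.pi h

/-! ### Dévissage by induction -/

variable (r) in
/-- A finite module `M` with `M / r M, r M / r² M, …` projective of constant rank over `R / r` and
`r ^ N M` torsion-free, expressed by recursion on `N`. -/
def HasDevissageOfLength :
    ℕ → ∀ (M : Type u) [AddCommGroup M] [Module R M], Prop
  | 0, M, _, _ => Module.Finite R M ∧ IsProjectiveModulo r M ∧ ∀ y : M, r • y = 0 → y = 0
  | N + 1, M, _, _ => Module.Finite R M ∧ IsProjectiveModulo r M ∧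
      HasDevissageOfLength N (powSubmodule r M 1)

lemma HasDevissageOfLength.finite {N : ℕ} {M : Type u} [AddCommGroup M] [Module R M]
    (h : HasDevissageOfLength r N M) : Module.Finite R M := by
  cases N <;> exact h.1

lemma HasDevissageOfLength.isProjectiveModulo {N : ℕ} {M : Type u} [AddCommGroup M] [Module R M]
    (h : HasDevissageOfLength r N M) : IsProjectiveModulo r M := by
  cases N <;> exact h.2.1

lemma mem_powSubmodule {M : Type u} [AddCommGroup M] [Module R M] {n : ℕ} {x : M} :
    x ∈ powSubmodule r M n ↔ ∃ y, x = r ^ n • y :=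
  ⟨fun ⟨y, h⟩ => ⟨y, h.symm⟩, fun ⟨y, h⟩ => ⟨y, h.symm⟩⟩

/-- A linear equivalence restricts to `r ^ n M`. -/
noncomputable def powSubmoduleCongr {M N : Type u} [AddCommGroup M] [Module R M] [AddCommGroup N]
    [Module R N] (e : M ≃ₗ[R] N) (n : ℕ) : powSubmodule r M n ≃ₗ[R] powSubmodule r N n :=
  e.ofSubmodules _ _ <| by
    ext y
    constructor
    · rintro ⟨_, ⟨x, rfl⟩, rfl⟩
      exact ⟨e x, (map_smul _ _ _).symm⟩
    · rintro ⟨x, rfl⟩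
      exact ⟨_, ⟨e.symm x, rfl⟩, by simp⟩

/-- `r ^ n (r M) = r ^ (n + 1) M`. -/
noncomputable def powSubmoduleOneEquiv (M : Type u) [AddCommGroup M] [Module R M] (n : ℕ) :
    powSubmodule r (powSubmodule r M 1) n ≃ₗ[R] powSubmodule r M (n + 1) :=
  LinearEquiv.ofBijective
    ((powSubmodule r M 1).subtype.restrict (p := powSubmodule r (powSubmodule r M 1) n)
      (q := powSubmodule r M (n + 1)) fun x hx => by
        obtain ⟨⟨_, z, rfl⟩, rfl⟩ := mem_powSubmodule.1 hx
        refine mem_powSubmodule.2 ⟨z, ?_⟩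
        simp [pow_succ, mul_smul]) <| by
    refine ⟨fun x y h => Subtype.ext (Subtype.ext
      (congrArg (Subtype.val (p := (· ∈ powSubmodule r M (n + 1)))) h)), ?_⟩
    rintro ⟨_, z, rfl⟩
    refine ⟨⟨⟨r ^ (n + 1) • z, r ^ n • z, ?_⟩, ⟨⟨r • z, z, ?_⟩, Subtype.ext ?_⟩⟩, rfl⟩
    all_goals simp [pow_succ, mul_smul]

/-- `r ^ 0 M = M`. -/
noncomputable def powSubmoduleZeroEquiv (M : Type u) [AddCommGroup M] [Module R M] :
    powSubmodule r M 0 ≃ₗ[R] M :=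
  (LinearEquiv.ofEq _ _ (by ext; simp)).trans Submodule.topEquiv

lemma hasFiniteProjectiveDevissage_iff {M : Type u} [AddCommGroup M] [Module R M] :
    HasFiniteProjectiveDevissage r M ↔ ∀ n, IsProjectiveModulo r (powSubmodule r M n) := Iff.rfl

/-- Trades the graded definition for the recursive one, on which the inductions run. In length 0,
multiplication by r ^ n identifies M with r ^ n M; a step of the recursion uses r ^ n (r M) = r ^
(n+1) M. -/
lemma hasDevissageOfLength_iff {N : ℕ} {M : Type u} [AddCommGroup M] [Module R M] :
    HasDevissageOfLength r N M ↔ Module.Finite R M ∧ HasFiniteProjectiveDevissage r M ∧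
      ∀ (m : M) (k : ℕ), r ^ k • m = 0 → r ^ N • m = 0 := by
  rw [hasFiniteProjectiveDevissage_iff]
  induction N generalizing M with
  | zero =>
    constructor
    · rintro ⟨h1, h2, h3⟩
      have h4 : ∀ (n : ℕ) (m : M), r ^ n • m = 0 → m = 0 := by
        intro n
        induction n with
        | zero => simp
        | succ n ih => exact fun m hm => ih m (h3 _ (by rwa [← mul_smul, ← pow_succ']))
      refine ⟨h1, fun n => h2.of_equiv (LinearEquiv.ofInjective (LinearMap.lsmul R M (r ^ n)) ?_),
        fun m k h => by simpa using h4 k m h⟩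
      exact (injective_iff_map_eq_zero _).2 (h4 n)
    · rintro ⟨h1, h2, h3⟩
      exact ⟨h1, (h2 0).of_equiv (powSubmoduleZeroEquiv M),
        fun y hy => by simpa using h3 y 1 (by simpa using hy)⟩
  | succ N ih =>
    rw [HasDevissageOfLength, ih]
    constructor
    · rintro ⟨h1, h2, -, h3, h4⟩
      refine ⟨h1, ?_, fun m k h => ?_⟩
      · rintro (_ | n)
        · exact h2.of_equiv (powSubmoduleZeroEquiv M).symm
        · exact (h3 n).of_equiv (powSubmoduleOneEquiv M n)
      · have := congrArg Subtype.val (h4 ⟨r • m, m, by simp⟩ k (Subtype.ext <| by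
          simp [smul_comm _ r, h]))
        simpa [pow_succ, mul_smul] using this
    · rintro ⟨h1, h2, h3⟩
      refine ⟨h1, (h2 0).of_equiv (powSubmoduleZeroEquiv M), inferInstance,
        fun n => (h2 (n + 1)).of_equiv (powSubmoduleOneEquiv M n).symm, ?_⟩
      rintro ⟨_, m, rfl⟩ k h
      have h' := h3 m (k + 1) (by simpa [pow_succ, mul_smul] using congrArg Subtype.val h)
      exact Subtype.ext (by simpa [pow_succ, mul_smul] using h')

/-! ### Structure of modules with dévissage -/

variable (r) in
/-- The pairs `(P, c)` with `P` finite projective, of constant rank modulo `r`, and `c` zero or a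
positive power of `r`. -/
structure IsElementaryPair (P : Type u) [AddCommGroup P] [Module R P] (c : R) : Prop where
  finite : Module.Finite R P
  projective : Module.Projective R P
  isProjectiveModulo : IsProjectiveModulo r P
  eq : c = 0 ∨ ∃ m : ℕ, c = r ^ (m + 1)

variable (r) in
/-- `M` is a finite direct sum of modules `P / c P`, for elementary pairs `(P, c)`. -/
def IsElementary (M : Type u) [AddCommGroup M] [Module R M] : Prop :=
  ∃ (ι : Type) (_ : Finite ι) (P : ι → ModuleCat.{u} R) (c : ι → R) (g : (∀ i, P i) →ₗ[R] M),
    (∀ i, IsElementaryPair r (P i) (c i)) ∧ Function.Surjective g ∧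
    ∀ y, g y = 0 ↔ ∀ i, ∃ w, y i = c i • w

lemma IsElementary.of_torsionFree [IsAdicComplete (Ideal.span {r}) R] {M : Type u}
    [AddCommGroup M] [Module R M] (h1 : Module.Finite R M) (h2 : IsProjectiveModulo r M)
    (h3 : ∀ y : M, r • y = 0 → y = 0) : IsElementary r M := by
  refine ⟨Unit, inferInstance, fun _ => ModuleCat.of R M, fun _ => 0,
    LinearMap.proj (φ := fun _ => M) (), fun _ => ⟨h1, h2.projective h3, h2, Or.inl rfl⟩,
    fun y => ⟨fun _ => y, rfl⟩, fun y => ⟨fun h i => ⟨0, ?_⟩, fun h => ?_⟩⟩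
  · rw [smul_zero]; exact h
  · obtain ⟨w, hw⟩ := h ()
    rw [zero_smul] at hw
    exact hw

/-- The kernel of `r : M / r M → r M / r² M` lifts to a finite projective module that maps to the
`r`-torsion of `M`. -/
lemma exists_lift_torsion [IsAdicComplete (Ideal.span {r}) R] {M : Type u}
    [AddCommGroup M] [Module R M] (h0 : IsProjectiveModulo r M)
    (h1 : IsProjectiveModulo r (powSubmodule r M 1)) :
    ∃ (P : ModuleCat.{u} R) (g : P →ₗ[R] M), IsElementaryPair r P r ∧ (∀ p, r • g p = 0) ∧
      (∀ p z, g p = r • z → ∃ w, p = r • w) ∧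
      ∀ d, r • d = 0 → ∃ p z, d = g p + r • z := by
  let k := R ⧸ Ideal.span {r}
  let E := powSubmodule r M 1
  let t : M →ₗ[R] E := (LinearMap.lsmul R M (r ^ 1)).rangeRestrict
  have ht : ∀ d, ((t d : E) : M) = r • d := fun d => by simp [t]
  have hts : Function.Surjective t := LinearMap.surjective_rangeRestrict _
  let τ : (M ⧸ (Ideal.span {r} • ⊤ : Submodule R M)) →ₗ[R]
      (E ⧸ (Ideal.span {r} • ⊤ : Submodule R E)) := Submodule.mapQ _ _ t <| by
    intro x hx
    obtain ⟨y, rfl⟩ := (mem_span_singleton_smul_top r).1 hx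
    exact (mem_span_singleton_smul_top r).2 ⟨t y, map_smul t r y⟩
  let τ' := LinearMap.extendScalarsOfSurjective (R := R) (S := k) Ideal.Quotient.mk_surjective τ
  have hτ' : Function.Surjective τ' := fun y => by
    obtain ⟨y, rfl⟩ := Submodule.mkQ_surjective _ y
    obtain ⟨x, rfl⟩ := hts y
    exact ⟨Submodule.Quotient.mk x, rfl⟩
  let L := LinearMap.ker τ'
  have hL : IsProjectiveModulo r L :=
    -- Constancy of the ranks of both M/rM and rM/r²M is used here: the rank of the kernel is their
    -- difference.
    isProjectiveModulo_iff_of_quotient.2 (IsFiniteProjectiveOfConstantRank.ker hτ' h0 h1)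
  obtain ⟨P, _, _, g0, hP, hP', hg0⟩ := hL.exists_lift
  have hPm : IsProjectiveModulo r P := hg0.isProjectiveModulo_iff.2 hL
  obtain ⟨g1, hg1⟩ := Module.projective_lifting_property
    (Submodule.mkQ (Ideal.span {r} • ⊤ : Submodule R M))
    ((L.subtype.restrictScalars R) ∘ₗ g0) (Submodule.mkQ_surjective _)
  have hg1' : ∀ p, Submodule.Quotient.mk (g1 p) = (g0 p).1 :=
    fun p => LinearMap.congr_fun hg1 p
  have hr : ∀ p, r • g1 p ∈ LinearMap.range (LinearMap.lsmul R M (r ^ 2)) := by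
    intro p
    have h2 : τ' (Submodule.Quotient.mk (g1 p)) = 0 := by
      rw [hg1']
      exact (g0 p).2
    have h3 : (Submodule.Quotient.mk (t (g1 p)) : E ⧸ (Ideal.span {r} • ⊤ : Submodule R E)) = 0 :=
      h2
    rw [Submodule.Quotient.mk_eq_zero, mem_span_singleton_smul_top] at h3
    obtain ⟨y, hy⟩ := h3
    obtain ⟨z, rfl⟩ := hts y
    refine ⟨z, ?_⟩
    rw [← ht, hy, Submodule.coe_smul, ht, LinearMap.lsmul_apply, pow_two, mul_smul]
  -- The lift `g1` satisfies only r g1 ∈ r²M. A linear h with r² h = r g1 corrects it: g1 − r h has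
  -- the same reduction modulo r and is killed by r.
  obtain ⟨h, hh⟩ := Module.projective_lifting_property
    (LinearMap.lsmul R M (r ^ 2)).rangeRestrict ((r • g1).codRestrict _ hr)
    (LinearMap.surjective_rangeRestrict _)
  have hh' : ∀ p, r ^ 2 • h p = r • g1 p :=
    fun p => congrArg Subtype.val (LinearMap.congr_fun hh p)
  let g := g1 - r • h
  have hg : ∀ p, Submodule.Quotient.mk (g p) = (g0 p).1 := by
    intro p
    rw [← hg1', Submodule.Quotient.eq, mem_span_singleton_smul_top]
    exact ⟨- h p, by simp [g]⟩
  refine ⟨ModuleCat.of R P, g, ⟨hP, hP', hPm, Or.inr ⟨0, by simp⟩⟩, fun p => ?_, fun p z hz => ?_,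
    fun d hd => ?_⟩
  · change r • (g1 p - r • h p) = 0
    rw [smul_sub, ← mul_smul, ← pow_two, hh', sub_self]
  · refine hg0.inj p 0 (Subtype.ext ?_)
    rw [← hg p, hz, smul_zero, Submodule.coe_zero, Submodule.Quotient.mk_eq_zero,
      mem_span_singleton_smul_top]
    exact ⟨z, rfl⟩
  · have hd' : Submodule.Quotient.mk d ∈ L := by
      change (Submodule.Quotient.mk (t d) : E ⧸ (Ideal.span {r} • ⊤ : Submodule R E)) = 0
      rw [Submodule.Quotient.mk_eq_zero, mem_span_singleton_smul_top]
      exact ⟨0, Subtype.ext (by rw [ht, hd, smul_zero, Submodule.coe_zero])⟩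
    obtain ⟨p, z, hp⟩ := hg0.surj ⟨Submodule.Quotient.mk d, hd'⟩
    rw [smul_eq_zero_of_quotient, add_zero] at hp
    have hp' : Submodule.Quotient.mk d = (g0 p).1 := congrArg Subtype.val hp
    rw [← hg, Submodule.Quotient.eq, mem_span_singleton_smul_top] at hp'
    obtain ⟨z, hz⟩ := hp'
    exact ⟨p, z, by rw [← hz]; abel⟩

/-- If rM is the sum of the P_i / c_i, then M is the sum of the P_i / (r c_i) and of one new term P'
/ r. The presentation q of rM lifts to g with r g = q, and P' accounts for the r-torsion that g
misses modulo r. -/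
lemma IsElementary.of_powSubmodule_one [IsAdicComplete (Ideal.span {r}) R] {M : Type u}
    [AddCommGroup M] [Module R M] (h0 : IsProjectiveModulo r M)
    (h1 : IsProjectiveModulo r (powSubmodule r M 1)) (h : IsElementary r (powSubmodule r M 1)) :
    IsElementary r M := by
  obtain ⟨ι, _, P, c, q, hP, hq, hqc⟩ := h
  obtain ⟨P', g', hP', hg'r, hg', hg'M⟩ := exists_lift_torsion h0 h1
  have hPp := fun i => (hP i).projective
  have hproj : Module.Projective R (∀ i, P i) := Module.Projective.pi_of_finite _
  let t : M →ₗ[R] powSubmodule r M 1 := (LinearMap.lsmul R M (r ^ 1)).rangeRestrict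
  have ht : ∀ d, ((t d : powSubmodule r M 1) : M) = r • d := fun d => by simp [t]
  have hts : Function.Surjective t := LinearMap.surjective_rangeRestrict _
  obtain ⟨g, hg⟩ := Module.projective_lifting_property t q hts
  have hgq : ∀ x, ((q x : powSubmodule r M 1) : M) = r • g x := fun x => by
    rw [← ht, ← hg, LinearMap.comp_apply]
  have hg0 : ∀ x, r • g x = 0 ↔ ∀ i, ∃ w, x i = c i • w := fun x => by
    rw [← hqc, ← hgq, Submodule.coe_eq_zero]
  -- The power of r in an elementary pair is positive for this reason: x ∈ ∏ c_i P_i forces g x ∈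
  -- rM.
  have hc : ∀ i, ∃ b, c i = r * b := fun i => by
    rcases (hP i).eq with h | ⟨m, h⟩
    · exact ⟨0, by simp [h]⟩
    · exact ⟨r ^ m, by rw [h, pow_succ']⟩
  choose b hb using hc
  let Q : Option ι → ModuleCat.{u} R := fun o => o.elim P' P
  let G : (∀ o, Q o) →ₗ[R] M := g' ∘ₗ LinearMap.proj (φ := fun o => Q o) none +
    g ∘ₗ LinearMap.pi (φ := fun i => P i) fun i => LinearMap.proj (φ := fun o => Q o) (some i)
  have hG : ∀ y, G y = g' (y none) + g (fun i => y (some i)) := fun y => rfl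
  refine ⟨Option ι, inferInstance, Q, fun o => o.elim r fun i => r * c i, G, ?_, ?_, ?_⟩
  · rintro (_ | i)
    · exact hP'
    · refine ⟨(hP i).finite, (hP i).projective, (hP i).isProjectiveModulo, ?_⟩
      rcases (hP i).eq with h | ⟨m, h⟩
      · exact Or.inl (by simp [h])
      · exact Or.inr ⟨m + 1, by simp [h, pow_succ']⟩
  · intro d
    obtain ⟨x, hx⟩ := hq (t d)
    have hx' : r • (d - g x) = 0 := by
      rw [smul_sub, ← ht, ← hgq, hx, sub_self]
    obtain ⟨p, z, hz⟩ := hg'M _ hx'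
    obtain ⟨x', hx'⟩ := hq (t z)
    -- First d − g x is r-torsion, so it equals g' p + r z; then r z = q x' = r g(x') is absorbed by
    -- g.
    refine ⟨fun o => match o with | none => p | some i => (x + r • x') i, ?_⟩
    rw [hG]
    change g' p + g (x + r • x') = d
    rw [map_add, map_smul, ← hgq, hx', ht]
    rw [sub_eq_iff_eq_add] at hz
    rw [hz]
    abel
  · intro y
    have key : ∀ (p : P') (x : ∀ i, P i), g' p + g x = 0 ↔
        (∃ w, p = r • w) ∧ ∀ i, ∃ w, x i = (r * c i) • w := by
      intro p x
      constructor
      · intro hy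
        -- Multiplying the relation by r removes g' p, which puts x in ∏ c_i P_i. Then g' p lies in
        -- rM, so p ∈ rP' and g' p = 0. Finally g x = 0 with x = r x' puts x' in ∏ c_i P_i.
        have h2 : r • g x = 0 := by
          have := congrArg (r • ·) hy
          rwa [smul_zero, smul_add, hg'r, zero_add] at this
        choose w hw using (hg0 _).1 h2
        have h3 : x = r • (fun i => b i • w i : ∀ i, P i) := by
          funext i
          rw [hw, hb, mul_smul]
          rfl
        rw [h3, map_smul] at hy
        obtain ⟨p, rfl⟩ := hg' p (- g fun i => b i • w i) (by
          rw [smul_neg]; exact eq_neg_of_add_eq_zero_left hy)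
        rw [map_smul, hg'r, zero_add] at hy
        choose v hv using (hg0 _).1 hy
        refine ⟨⟨p, rfl⟩, fun i => ⟨v i, ?_⟩⟩
        rw [h3, Pi.smul_apply, hv, ← mul_smul]
      · rintro ⟨⟨p, rfl⟩, hx⟩
        choose v hv using hx
        have h3 : x = r • (fun i => c i • v i : ∀ i, P i) := by
          funext i
          rw [hv, mul_smul]
          rfl
        rw [h3, map_smul, map_smul, hg'r, (hg0 _).2 fun i => ⟨v i, rfl⟩, add_zero]
    refine (key (y none) fun i => y (some i)).trans ⟨fun h => ?_, fun h => ⟨h none, fun i => h (some i)⟩⟩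
    rintro (_ | i)
    · exact h.1
    · exact h.2 i

lemma HasDevissageOfLength.isElementary [IsAdicComplete (Ideal.span {r}) R] {N : ℕ} {M : Type u}
    [AddCommGroup M] [Module R M] (h : HasDevissageOfLength r N M) : IsElementary r M := by
  induction N generalizing M with
  | zero => exact .of_torsionFree h.1 h.2.1 h.2.2
  | succ N ih => exact .of_powSubmodule_one h.2.1 h.2.2.isProjectiveModulo (ih h.2.2)

end Structure

/-! ### Tensor products of elementary quotients -/

section Tensor

variable {R : Type u} [CommRing R] {r : R}

/-- The quotient `P / c P`. -/
abbrev ModSMul {R : Type u} [CommRing R] (c : R) (P : Type u) [AddCommGroup P] [Module R P] :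
    Type u :=
  P ⧸ LinearMap.range (LinearMap.lsmul R P c)

lemma ModSMul.mk_eq_zero {c : R} {P : Type u} [AddCommGroup P] [Module R P] {x : P} :
    (Submodule.Quotient.mk x : ModSMul c P) = 0 ↔ ∃ w, x = c • w := by
  rw [Submodule.Quotient.mk_eq_zero]
  exact ⟨fun ⟨w, h⟩ => ⟨w, h.symm⟩, fun ⟨w, h⟩ => ⟨w, h.symm⟩⟩

lemma IsElementary.exists_equiv {M : Type u} [AddCommGroup M] [Module R M]
    (h : IsElementary r M) :
    ∃ (ι : Type) (_ : Fintype ι) (P : ι → ModuleCat.{u} R) (c : ι → R),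
      (∀ i, IsElementaryPair r (P i) (c i)) ∧ Nonempty ((∀ i, ModSMul (c i) (P i)) ≃ₗ[R] M) := by
  obtain ⟨ι, _, P, c, g, hP, hg, hgc⟩ := h
  cases nonempty_fintype ι
  refine ⟨ι, inferInstance, P, c, hP, ⟨?_⟩⟩
  let q : (∀ i, P i) →ₗ[R] ∀ i, ModSMul (c i) (P i) :=
    LinearMap.piMap fun i => Submodule.mkQ _
  have hq : Function.Surjective q := fun y => by
    choose x hx using fun i => Submodule.mkQ_surjective _ (y i)
    exact ⟨x, funext hx⟩
  have hker : LinearMap.ker q = LinearMap.ker g := by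
    ext x
    rw [LinearMap.mem_ker, LinearMap.mem_ker, hgc, funext_iff]
    exact forall_congr' fun i => ModSMul.mk_eq_zero
  exact (q.quotKerEquivOfSurjective hq).symm.trans
    ((Submodule.quotEquivOfEq _ _ hker).trans (g.quotKerEquivOfSurjective hg))

lemma range_lsmul_le {P : Type*} [AddCommGroup P] [Module R P] {c d : R} (h : c ∣ d) :
    LinearMap.range (LinearMap.lsmul R P d) ≤ LinearMap.range (LinearMap.lsmul R P c) := by
  obtain ⟨b, rfl⟩ := h
  rintro _ ⟨x, rfl⟩
  exact ⟨b • x, by simp [mul_smul, smul_comm b c x]⟩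

/-- Together with its mirror image, this rewrites the submodules by which
`TensorProduct.quotientTensorQuotientEquiv` divides, so that P/c ⊗ Q/d becomes the quotient of P ⊗ Q
by multiples of c and d. -/
lemma range_map_range_lsmul_left (P Q : Type*) [AddCommGroup P] [Module R P] [AddCommGroup Q]
    [Module R Q] (c : R) :
    LinearMap.range (TensorProduct.map (LinearMap.range (LinearMap.lsmul R P c)).subtype
      (LinearMap.id : Q →ₗ[R] Q)) = LinearMap.range (LinearMap.lsmul R (P ⊗[R] Q) c) := by
  have h : LinearMap.lsmul R (P ⊗[R] Q) c =
      TensorProduct.map (LinearMap.range (LinearMap.lsmul R P c)).subtype LinearMap.id ∘ₗ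
        (LinearMap.lsmul R P c).rangeRestrict.rTensor Q := by
    ext x y
    rfl
  rw [h, LinearMap.range_comp_of_range_eq_top]
  rw [LinearMap.range_eq_top]
  exact LinearMap.rTensor_surjective _ (LinearMap.surjective_rangeRestrict _)

lemma range_map_range_lsmul_right (P Q : Type*) [AddCommGroup P] [Module R P] [AddCommGroup Q]
    [Module R Q] (c : R) :
    LinearMap.range (TensorProduct.map (LinearMap.id : P →ₗ[R] P)
      (LinearMap.range (LinearMap.lsmul R Q c)).subtype) =
        LinearMap.range (LinearMap.lsmul R (P ⊗[R] Q) c) := by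
  have h : LinearMap.lsmul R (P ⊗[R] Q) c =
      TensorProduct.map LinearMap.id (LinearMap.range (LinearMap.lsmul R Q c)).subtype ∘ₗ
        (LinearMap.lsmul R Q c).rangeRestrict.lTensor P := by
    ext x y
    simp
  rw [h, LinearMap.range_comp_of_range_eq_top]
  rw [LinearMap.range_eq_top]
  exact LinearMap.lTensor_surjective _ (LinearMap.surjective_rangeRestrict _)

lemma IsProjectiveModulo.tensorProduct {M N : Type u} [AddCommGroup M] [Module R M]
    [AddCommGroup N] [Module R N] (hM : IsProjectiveModulo r M) (hN : IsProjectiveModulo r N) :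
    IsProjectiveModulo r (M ⊗[R] N) := by
  let k := R ⧸ Ideal.span {r}
  let M' := M ⧸ (Ideal.span {r} • ⊤ : Submodule R M)
  let N' := N ⧸ (Ideal.span {r} • ⊤ : Submodule R N)
  have hM' : (Ideal.span {r} • ⊤ : Submodule R M) = LinearMap.range (LinearMap.lsmul R M r) :=
    Submodule.ext fun x => by rw [mem_span_singleton_smul_top]; simp [eq_comm]
  have hN' : (Ideal.span {r} • ⊤ : Submodule R N) = LinearMap.range (LinearMap.lsmul R N r) :=
    Submodule.ext fun x => by rw [mem_span_singleton_smul_top]; simp [eq_comm]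
  let f : M ⊗[R] N →ₗ[R] M' ⊗[R] N' := TensorProduct.map (Submodule.mkQ _) (Submodule.mkQ _)
  have hf : Function.Surjective f :=
    TensorProduct.map_surjective (Submodule.mkQ_surjective _) (Submodule.mkQ_surjective _)
  have hf' : ∀ x, TensorProduct.quotientTensorQuotientEquiv _ _ (f x) =
      Submodule.Quotient.mk x := by
    intro x
    induction x using TensorProduct.induction_on with
    | zero => simp
    | tmul => rfl
    | add x y hx hy => rw [map_add, map_add, hx, hy, Submodule.Quotient.mk_add]
  have hb : IsBijectiveModulo r f := .mk_of_surjective hf fun x z hz => by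
    have h0 : f x = 0 := by
      obtain ⟨z, rfl⟩ := hf z
      rw [hz, ← map_smul, ← (TensorProduct.quotientTensorQuotientEquiv _ _).map_eq_zero_iff, hf',
        Submodule.Quotient.mk_eq_zero, hM', range_map_range_lsmul_left]
      exact Submodule.mem_sup_left ⟨z, rfl⟩
    rw [← (TensorProduct.quotientTensorQuotientEquiv _ _).map_eq_zero_iff, hf',
      Submodule.Quotient.mk_eq_zero, hM', hN', range_map_range_lsmul_left,
      range_map_range_lsmul_right, sup_idem] at h0
    obtain ⟨w, hw⟩ := h0
    exact ⟨w, hw.symm⟩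
  -- As R → R/r is surjective, M' ⊗ N' is the same over R and over R/r.
  have : TensorProduct.CompatibleSMul R k M' N' :=
    .of_algebraMap_surjective _ _ Ideal.Quotient.mk_surjective
  rw [hb.isProjectiveModulo_iff, isProjectiveModulo_iff_of_quotient]
  exact IsFiniteProjectiveOfConstantRank.of_equiv
    (TensorProduct.equivOfCompatibleSMul R k k M' N')
    (IsFiniteProjectiveOfConstantRank.tensorProduct hM hN)

/-- A property of modules that holds for elementary quotients and is stable under isomorphisms and
finite products holds for the tensor products of direct sums of elementary quotients. -/
lemma IsElementary.tensorProduct_induction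
    (C : ∀ (M : Type u) [AddCommGroup M] [Module R M], Prop)
    (equiv : ∀ (M N : Type u) [AddCommGroup M] [Module R M] [AddCommGroup N] [Module R N],
      (M ≃ₗ[R] N) → C M → C N)
    (pi : ∀ (ι : Type) [Fintype ι] (M : ι → Type u) [∀ i, AddCommGroup (M i)]
      [∀ i, Module R (M i)], (∀ i, C (M i)) → C (∀ i, M i))
    (quot : ∀ (P : Type u) [AddCommGroup P] [Module R P] (c : R), IsElementaryPair r P c →
      C (ModSMul c P)) {M N : Type u} [AddCommGroup M] [Module R M] [AddCommGroup N] [Module R N]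
    (hM : IsElementary r M) (hN : IsElementary r N) : C (M ⊗[R] N) := by
  classical
  obtain ⟨ι, _, P, c, hP, ⟨e⟩⟩ := hM.exists_equiv
  obtain ⟨κ, _, Q, d, hQ, ⟨f⟩⟩ := hN.exists_equiv
  refine equiv _ _ (TensorProduct.congr e f) <|
    equiv _ _ (TensorProduct.piRight R R (∀ i, ModSMul (c i) (P i))
      fun j => ModSMul (d j) (Q j)).symm <| pi _ _ fun j =>
    equiv _ _ (TensorProduct.comm R _ _) <|
    equiv _ _ (TensorProduct.piRight R R (ModSMul (d j) (Q j))
      fun i => ModSMul (c i) (P i)).symm <| pi _ _ fun i =>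
    equiv _ _ (TensorProduct.comm R _ _) <|
    equiv _ _ (TensorProduct.quotientTensorQuotientEquiv _ _).symm ?_
  rw [range_map_range_lsmul_left, range_map_range_lsmul_right]
  have hfin := (hP i).finite
  have hfin' := (hQ j).finite
  have hproj := (hP i).projective
  have hproj' := (hQ j).projective
  have hm := (hP i).isProjectiveModulo.tensorProduct (hQ j).isProjectiveModulo
  -- The admissible scalars are totally ordered by divisibility. So P/c ⊗ Q/d is P ⊗ Q modulo the
  -- one of c, d that divides the other, which is again an elementary quotient.
  have hcd : c i ∣ d j ∨ d j ∣ c i := by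
    rcases (hP i).eq with h | ⟨m, h⟩
    · exact Or.inr (h ▸ dvd_zero _)
    rcases (hQ j).eq with h' | ⟨n, h'⟩
    · exact Or.inl (h' ▸ dvd_zero _)
    rw [h, h']
    exact (le_total (m + 1) (n + 1)).imp (pow_dvd_pow r) (pow_dvd_pow r)
  rcases hcd with h | h
  · rw [sup_eq_left.2 (range_lsmul_le h)]
    exact quot _ _ ⟨inferInstance, inferInstance, hm, (hP i).eq⟩
  · rw [sup_eq_right.2 (range_lsmul_le h)]
    exact quot _ _ ⟨inferInstance, inferInstance, hm, (hQ j).eq⟩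

/-! ### Modules with projective dévissage are stable under tensor products -/

/-- The graded pieces of P/c are of two kinds: zero once c divides r ^ n, and P/rP before that, by
multiplication by r ^ n. -/
lemma isProjectiveModulo_powSubmodule_modSMul (hr : ∀ a : R, r * a = 0 → a = 0) {P : Type u}
    [AddCommGroup P] [Module R P] {c : R} (h : IsElementaryPair r P c) (n : ℕ) :
    IsProjectiveModulo r (powSubmodule r (ModSMul c P) n) := by
  have := h.projective
  have hrP : ∀ (n : ℕ) (x : P), r ^ n • x = 0 → x = 0 := by
    intro n
    induction n with
    | zero => simp
    | succ n ih =>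
      exact fun x hx => ih x (eq_zero_of_smul_eq_zero_of_projective hr P _ (by
        rwa [← mul_smul, ← pow_succ']))
  by_cases hn : ∃ b, r ^ n = c * b
  · obtain ⟨b, hb⟩ := hn
    have : Subsingleton (powSubmodule r (ModSMul c P) n) := by
      refine ⟨fun x y => ?_⟩
      have h0 : ∀ x : powSubmodule r (ModSMul c P) n, x = 0 := by
        rintro ⟨_, x, rfl⟩
        obtain ⟨x, rfl⟩ := Submodule.mkQ_surjective _ x
        refine Subtype.ext (ModSMul.mk_eq_zero.2 ⟨b • x, ?_⟩)
        rw [← mul_smul, ← hb]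
      rw [h0 x, h0 y]
    exact .of_subsingleton
  · refine (IsBijectiveModulo.mk_of_surjective
      (f := (LinearMap.lsmul R (ModSMul c P) (r ^ n)).rangeRestrict ∘ₗ Submodule.mkQ _)
      ((LinearMap.surjective_rangeRestrict _).comp (Submodule.mkQ_surjective _))
      fun x z hz => ?_).isProjectiveModulo_iff.1 h.isProjectiveModulo
    obtain ⟨_, z, rfl⟩ := z
    obtain ⟨z, rfl⟩ := Submodule.mkQ_surjective _ z
    have hz' : (Submodule.Quotient.mk (r ^ n • x) : ModSMul c P) =
      Submodule.Quotient.mk (r • r ^ n • z) := congrArg Subtype.val hz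
    rw [← sub_eq_zero, ← Submodule.Quotient.mk_sub, ModSMul.mk_eq_zero] at hz'
    obtain ⟨w, hw⟩ := hz'
    rw [smul_comm r, ← smul_sub] at hw
    rcases h.eq with rfl | ⟨m, rfl⟩
    · rw [zero_smul] at hw
      exact ⟨z, sub_eq_zero.1 (hrP n _ hw)⟩
    · have hmn : n ≤ m := by
        by_contra! hmn
        exact hn ⟨r ^ (n - (m + 1)), by rw [← pow_add]; congr 1; omega⟩
      refine ⟨z + r ^ (m - n) • w, ?_⟩
      have : r ^ n • (x - r • z - r • r ^ (m - n) • w) = 0 := by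
        rw [smul_sub, hw, ← mul_smul r, ← pow_succ', ← mul_smul, ← pow_add,
          show n + (m - n + 1) = m + 1 by omega, sub_self]
      rw [smul_add, ← sub_eq_zero, ← hrP n _ this]
      abel

lemma hasBoundedTorsion_modSMul (hr : ∀ a : R, r * a = 0 → a = 0) {P : Type u}
    [AddCommGroup P] [Module R P] {c : R} (h : IsElementaryPair r P c) :
    HasBoundedTorsion r (ModSMul c P) := by
  have := h.projective
  have hrP : ∀ (n : ℕ) (x : P), r ^ n • x = 0 → x = 0 := by
    intro n
    induction n with
    | zero => simp
    | succ n ih =>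
      exact fun x hx => ih x (eq_zero_of_smul_eq_zero_of_projective hr P _ (by
        rwa [← mul_smul, ← pow_succ']))
  rcases h.eq with rfl | ⟨m, rfl⟩
  · refine ⟨0, fun x k hx => ?_⟩
    obtain ⟨x, rfl⟩ := Submodule.mkQ_surjective _ x
    obtain ⟨w, hw⟩ := ModSMul.mk_eq_zero.1 hx
    rw [zero_smul] at hw
    rw [pow_zero, one_smul, hrP k x hw, map_zero]
  · refine ⟨m + 1, fun x k _ => ?_⟩
    obtain ⟨x, rfl⟩ := Submodule.mkQ_surjective _ x
    exact ModSMul.mk_eq_zero.2 ⟨x, rfl⟩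

lemma HasBoundedTorsion.of_equiv {M N : Type u} [AddCommGroup M] [Module R M] [AddCommGroup N]
    [Module R N] (e : M ≃ₗ[R] N) (h : HasBoundedTorsion r M) : HasBoundedTorsion r N := by
  obtain ⟨n, hn⟩ := h
  refine ⟨n, fun x k hx => ?_⟩
  have := hn (e.symm x) k (by rw [← map_smul, hx, map_zero])
  rwa [← map_smul, LinearEquiv.map_eq_zero_iff] at this

lemma HasBoundedTorsion.pi {ι : Type} [Fintype ι] {M : ι → Type u} [∀ i, AddCommGroup (M i)]
    [∀ i, Module R (M i)] (h : ∀ i, HasBoundedTorsion r (M i)) :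
    HasBoundedTorsion r (∀ i, M i) := by
  choose n hn using h
  refine ⟨∑ i, n i, fun x k hx => funext fun i => ?_⟩
  have h1 : r ^ n i • x i = 0 := hn i _ k (congrFun hx i)
  have h2 : n i ≤ ∑ i, n i := Finset.single_le_sum (fun _ _ => Nat.zero_le _) (Finset.mem_univ i)
  rw [Pi.smul_apply, ← Nat.sub_add_cancel h2, pow_add, mul_smul, h1, smul_zero, Pi.zero_apply]

lemma HasFiniteProjectiveDevissage.of_equiv {M N : Type u} [AddCommGroup M] [Module R M]
    [AddCommGroup N] [Module R N] (e : M ≃ₗ[R] N) (h : HasFiniteProjectiveDevissage r M) :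
    HasFiniteProjectiveDevissage r N :=
  fun n => IsProjectiveModulo.of_equiv (powSubmoduleCongr e n) (h n)

lemma HasFiniteProjectiveDevissage.pi {ι : Type} [Fintype ι] {M : ι → Type u}
    [∀ i, AddCommGroup (M i)] [∀ i, Module R (M i)]
    (h : ∀ i, HasFiniteProjectiveDevissage r (M i)) :
    HasFiniteProjectiveDevissage r (∀ i, M i) := by
  intro n
  refine IsProjectiveModulo.of_equiv (LinearEquiv.ofBijective
    ((LinearMap.piMap fun i => (powSubmodule r (M i) n).subtype).codRestrict
      (powSubmodule r (∀ i, M i) n) fun x => ?_) ⟨fun x y hxy => ?_, ?_⟩)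
    (IsProjectiveModulo.pi fun i => h i n)
  · choose y hy using fun i => (x i).2
    exact ⟨y, funext hy⟩
  · funext i
    exact Subtype.ext (congrFun (congrArg Subtype.val hxy) i)
  · rintro ⟨_, x, rfl⟩
    exact ⟨fun i => ⟨r ^ n • x i, x i, rfl⟩, rfl⟩

lemma IsElementary.tensorProduct_devissage (hr : ∀ a : R, r * a = 0 → a = 0) {M N : Type u}
    [AddCommGroup M] [Module R M] [AddCommGroup N] [Module R N] (hM : IsElementary r M)
    (hN : IsElementary r N) :
    HasFiniteProjectiveDevissage r (M ⊗[R] N) ∧ HasBoundedTorsion r (M ⊗[R] N) :=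
  IsElementary.tensorProduct_induction
    (fun M _ _ => HasFiniteProjectiveDevissage r M ∧ HasBoundedTorsion r M)
    (fun _ _ _ _ _ _ e h => ⟨h.1.of_equiv e, h.2.of_equiv e⟩)
    (fun _ _ _ _ _ h => ⟨.pi fun i => (h i).1, .pi fun i => (h i).2⟩)
    (fun _ _ _ _ h => ⟨isProjectiveModulo_powSubmodule_modSMul hr h,
      hasBoundedTorsion_modSMul hr h⟩) hM hN

end Tensor

/-! ### Faithfully flat descent modulo r -/

section Descent

/-- Finiteness descends; it is applied to G and then to the kernel K of a finite free cover, whose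
base change is the kernel of the base-changed cover by flatness. -/
lemma Module.FinitePresentation.of_tensorProduct_of_faithfullyFlat {A B G : Type u} [CommRing A]
    [CommRing B] [Algebra A B] [Module.FaithfullyFlat A B] [AddCommGroup G] [Module A G]
    [h : Module.FinitePresentation B (B ⊗[A] G)] : Module.FinitePresentation A G := by
  have : Module.Finite A G := Module.Finite.of_finite_tensorProduct_of_faithfullyFlat B
  obtain ⟨n, f, hf⟩ := Module.Finite.exists_fin' A G
  let K := LinearMap.ker f
  have hex : Function.Exact (K.subtype.baseChange B) (f.baseChange B) :=
    Module.Flat.lTensor_exact B (LinearMap.exact_subtype_ker_map f)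
  have hinj : Function.Injective (K.subtype.baseChange B) :=
    Module.Flat.lTensor_preserves_injective_linearMap (M := B) K.subtype K.injective_subtype
  have hfg : (LinearMap.ker (f.baseChange B)).FG :=
    Module.FinitePresentation.fg_ker _ (LinearMap.lTensor_surjective B hf)
  have : Module.Finite B (B ⊗[A] K) := by
    rw [Module.Finite.equiv_iff (LinearEquiv.ofInjective _ hinj), Module.Finite.iff_fg,
      ← LinearMap.exact_iff.1 hex]
    exact hfg
  have : Module.Finite A K := Module.Finite.of_finite_tensorProduct_of_faithfullyFlat B
  exact Module.finitePresentation_of_surjective f hf (Module.Finite.iff_fg.1 this)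

lemma IsFiniteProjectiveOfConstantRank.of_tensorProduct_of_faithfullyFlat {A B G : Type u}
    [CommRing A] [CommRing B] [Algebra A B] [Module.FaithfullyFlat A B] [AddCommGroup G]
    [Module A G] (h : IsFiniteProjectiveOfConstantRank B (B ⊗[A] G)) :
    IsFiniteProjectiveOfConstantRank A G := by
  obtain ⟨h1, h2, n, hn⟩ := h
  have : Module.FinitePresentation B (B ⊗[A] G) := Module.finitePresentation_of_projective _ _
  have : Module.FinitePresentation A G := .of_tensorProduct_of_faithfullyFlat (B := B)
  have : Module.Flat A G := Module.Flat.of_flat_tensorProduct A G B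
  refine ⟨inferInstance, Module.Flat.projective_of_finitePresentation, n, fun p => ?_⟩
  -- Every prime of A comes from one of B, and the rank at a prime does not change under base
  -- change.
  obtain ⟨q, rfl⟩ := PrimeSpectrum.comap_surjective_of_faithfullyFlat (A := A) (B := B) p
  rw [← hn q, Module.rankAtStalk_baseChange]

variable {A R : Type u} [CommRing A] [CommRing R] [Algebra A R] {r : A} {ρ : R}

/-- `R ⊗ X → R / r ⊗ X` is bijective if `r X = 0`. -/
lemma rTensor_mk_bijective (hρ : algebraMap A R r = ρ) {X : Type u} [AddCommGroup X] [Module A X]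
    (hX : ∀ x : X, r • x = 0) :
    Function.Bijective (AlgebraTensorModule.rTensor A X
      (Submodule.mkQ (Ideal.span {ρ} : Ideal R)) : R ⊗[A] X →ₗ[R] (R ⧸ Ideal.span {ρ}) ⊗[A] X) := by
  have hsurj : Function.Surjective (Submodule.mkQ (Ideal.span {ρ} : Ideal R)) :=
    Submodule.mkQ_surjective _
  refine ⟨?_, LinearMap.rTensor_surjective X
    (g := (Submodule.mkQ (Ideal.span {ρ} : Ideal R)).restrictScalars A) hsurj⟩
  rw [injective_iff_map_eq_zero]
  intro x hx
  have hex : Function.Exact ((Submodule.subtype (Ideal.span {ρ} : Ideal R)).restrictScalars A)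
      ((Submodule.mkQ (Ideal.span {ρ} : Ideal R)).restrictScalars A) :=
    LinearMap.exact_subtype_mkQ _
  obtain ⟨y, rfl⟩ := (rTensor_exact X hex hsurj x).1 hx
  induction y using TensorProduct.induction_on with
  | zero => simp
  | tmul j x =>
    obtain ⟨j, hj⟩ := j
    obtain ⟨t, rfl⟩ := Ideal.mem_span_singleton.1 hj
    change (ρ * t) ⊗ₜ[A] x = 0
    rw [← hρ, ← Algebra.smul_def, TensorProduct.smul_tmul, hX, TensorProduct.tmul_zero]
  | add x y hx' hy' =>
    have h1 : ∀ y, (AlgebraTensorModule.rTensor A X (Submodule.mkQ (Ideal.span {ρ} : Ideal R)))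
        (LinearMap.rTensor X ((Submodule.subtype (Ideal.span {ρ} : Ideal R)).restrictScalars A) y)
          = 0 :=
      fun y => (rTensor_exact X hex hsurj _).2 ⟨y, rfl⟩
    rw [map_add, hx' (h1 _), hy' (h1 _), add_zero]

section

/-- The module structure over `A / r` of an `A`-module killed by `r`. -/
abbrev moduleOfSMulEqZero {X : Type u} [AddCommGroup X] [Module A X] (hX : ∀ x : X, r • x = 0) :
    Module (A ⧸ Ideal.span {r}) X :=
  Module.IsTorsionBySet.module (I := Ideal.span {r}) <| by
    rintro x ⟨a, ha⟩
    obtain ⟨b, rfl⟩ := Ideal.mem_span_singleton'.1 ha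
    change (b * r) • x = 0
    rw [mul_smul, hX, smul_zero]

lemma isScalarTower_moduleOfSMulEqZero {X : Type u} [AddCommGroup X] [Module A X]
    (hX : ∀ x : X, r • x = 0) :
    letI := moduleOfSMulEqZero hX
    IsScalarTower A (A ⧸ Ideal.span {r}) X :=
  Module.IsTorsionBySet.isScalarTower _

/-- Flatness is available for A/r → R/ρ, not for A → R. As r kills G, the tensor product over A can
be read over A/r, and descent applies there. -/
lemma IsProjectiveModulo.of_tensorProduct {f : (A ⧸ Ideal.span {r}) →+* (R ⧸ Ideal.span {ρ})}
    (hff : f.FaithfullyFlat)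
    (hf : ∀ a, f (Ideal.Quotient.mk _ a) = Ideal.Quotient.mk _ (algebraMap A R a))
    {G : Type u} [AddCommGroup G] [Module A G] (hG : ∀ x : G, r • x = 0)
    (h : IsFiniteProjectiveOfConstantRank (R ⧸ Ideal.span {ρ}) ((R ⧸ Ideal.span {ρ}) ⊗[A] G)) :
    IsProjectiveModulo r G := by
  let := f.toAlgebra
  have : Module.FaithfullyFlat (A ⧸ Ideal.span {r}) (R ⧸ Ideal.span {ρ}) := hff
  have : IsScalarTower A (A ⧸ Ideal.span {r}) (R ⧸ Ideal.span {ρ}) :=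
    IsScalarTower.of_algebraMap_eq fun a => (hf a).symm
  let := moduleOfSMulEqZero hG
  have := isScalarTower_moduleOfSMulEqZero hG
  rw [isProjectiveModulo_iff_of_quotient]
  refine IsFiniteProjectiveOfConstantRank.of_tensorProduct_of_faithfullyFlat
    (B := R ⧸ Ideal.span {ρ}) ?_
  have : TensorProduct.CompatibleSMul A (A ⧸ Ideal.span {r}) (R ⧸ Ideal.span {ρ}) G :=
    .of_algebraMap_surjective _ _ Ideal.Quotient.mk_surjective
  exact IsFiniteProjectiveOfConstantRank.of_equiv (TensorProduct.equivOfCompatibleSMul A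
    (A ⧸ Ideal.span {r}) (R ⧸ Ideal.span {ρ}) (R ⧸ Ideal.span {ρ}) G).symm h

/-- For modules killed by `r`, the map `R / r ⊗ h` over `A` is, up to isomorphism, the base change
of `h` along a faithfully flat morphism. -/
lemma exists_lTensor_comm {f : (A ⧸ Ideal.span {r}) →+* (R ⧸ Ideal.span {ρ})}
    (hff : f.FaithfullyFlat)
    (hf : ∀ a, f (Ideal.Quotient.mk _ a) = Ideal.Quotient.mk _ (algebraMap A R a))
    {X Y : Type u} [AddCommGroup X] [Module A X] [AddCommGroup Y]
    [Module A Y] (hX : ∀ x : X, r • x = 0) (hY : ∀ y : Y, r • y = 0) (h : X →ₗ[A] Y) :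
    ∃ (k : Type u) (_ : CommRing k) (_ : Algebra k (R ⧸ Ideal.span {ρ})) (_ : Module k X)
      (_ : Module k Y) (h' : X →ₗ[k] Y)
      (eX : (R ⧸ Ideal.span {ρ}) ⊗[A] X ≃ (R ⧸ Ideal.span {ρ}) ⊗[k] X)
      (eY : (R ⧸ Ideal.span {ρ}) ⊗[A] Y ≃ (R ⧸ Ideal.span {ρ}) ⊗[k] Y),
      Module.FaithfullyFlat k (R ⧸ Ideal.span {ρ}) ∧ (∀ x, h' x = h x) ∧
      ∀ z, eY (h.lTensor _ z) = h'.lTensor _ (eX z) := by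
  let := f.toAlgebra
  have hffl : Module.FaithfullyFlat (A ⧸ Ideal.span {r}) (R ⧸ Ideal.span {ρ}) := hff
  have : IsScalarTower A (A ⧸ Ideal.span {r}) (R ⧸ Ideal.span {ρ}) :=
    IsScalarTower.of_algebraMap_eq fun a => (hf a).symm
  let iX := moduleOfSMulEqZero hX
  have := isScalarTower_moduleOfSMulEqZero hX
  let iY := moduleOfSMulEqZero hY
  have := isScalarTower_moduleOfSMulEqZero hY
  have : TensorProduct.CompatibleSMul A (A ⧸ Ideal.span {r}) (R ⧸ Ideal.span {ρ}) X :=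
    .of_algebraMap_surjective _ _ Ideal.Quotient.mk_surjective
  have : TensorProduct.CompatibleSMul A (A ⧸ Ideal.span {r}) (R ⧸ Ideal.span {ρ}) Y :=
    .of_algebraMap_surjective _ _ Ideal.Quotient.mk_surjective
  let h' : X →ₗ[A ⧸ Ideal.span {r}] Y :=
    LinearMap.extendScalarsOfSurjective (R := A) Ideal.Quotient.mk_surjective h
  let eX := (TensorProduct.equivOfCompatibleSMul A (A ⧸ Ideal.span {r}) A
    (R ⧸ Ideal.span {ρ}) X).symm
  let eY := (TensorProduct.equivOfCompatibleSMul A (A ⧸ Ideal.span {r}) A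
    (R ⧸ Ideal.span {ρ}) Y).symm
  refine ⟨_, _, _, iX, iY, h', eX.toEquiv, eY.toEquiv, hffl, fun _ => rfl, fun z => ?_⟩
  change eY _ = LinearMap.lTensor _ h' (eX z)
  induction z using TensorProduct.induction_on with
  | zero => simp
  | tmul a x => rfl
  | add x y hx hy => simp only [map_add, hx, hy]

lemma surjective_of_lTensor_surjective {f : (A ⧸ Ideal.span {r}) →+* (R ⧸ Ideal.span {ρ})}
    (hff : f.FaithfullyFlat)
    (hf : ∀ a, f (Ideal.Quotient.mk _ a) = Ideal.Quotient.mk _ (algebraMap A R a))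
    {X Y : Type u} [AddCommGroup X] [Module A X]
    [AddCommGroup Y] [Module A Y] (hX : ∀ x : X, r • x = 0) (hY : ∀ y : Y, r • y = 0)
    (h : X →ₗ[A] Y) (H : Function.Surjective (h.lTensor (R ⧸ Ideal.span {ρ}))) :
    Function.Surjective h := by
  obtain ⟨k, _, _, _, _, h', eX, eY, _, hh', he⟩ := exists_lTensor_comm hff hf hX hY h
  have : Function.Surjective (h'.lTensor (R ⧸ Ideal.span {ρ})) := fun y => by
    obtain ⟨z, hz⟩ := H (eY.symm y)
    exact ⟨eX z, by rw [← he, hz, Equiv.apply_symm_apply]⟩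
  rw [Module.FaithfullyFlat.lTensor_surjective_iff_surjective] at this
  exact fun y => (this y).imp fun x hx => (hh' x).symm.trans hx

lemma injective_of_lTensor_injective {f : (A ⧸ Ideal.span {r}) →+* (R ⧸ Ideal.span {ρ})}
    (hff : f.FaithfullyFlat)
    (hf : ∀ a, f (Ideal.Quotient.mk _ a) = Ideal.Quotient.mk _ (algebraMap A R a))
    {X Y : Type u} [AddCommGroup X] [Module A X]
    [AddCommGroup Y] [Module A Y] (hX : ∀ x : X, r • x = 0) (hY : ∀ y : Y, r • y = 0)
    (h : X →ₗ[A] Y) (H : Function.Injective (h.lTensor (R ⧸ Ideal.span {ρ}))) :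
    Function.Injective h := by
  obtain ⟨k, _, _, _, _, h', eX, eY, _, hh', he⟩ := exists_lTensor_comm hff hf hX hY h
  have : Function.Injective (h'.lTensor (R ⧸ Ideal.span {ρ})) := fun x y hxy => by
    obtain ⟨x, rfl⟩ := eX.surjective x
    obtain ⟨y, rfl⟩ := eX.surjective y
    rw [← he, ← he] at hxy
    rw [H (eY.injective hxy)]
  rw [Module.FaithfullyFlat.lTensor_injective_iff_injective] at this
  exact fun x y hxy => this (by rw [hh', hh', hxy])

end

/-- If `π` is surjective with kernel in `r M`, then so is the kernel of its base change. -/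
lemma exists_eq_smul_of_lTensor_eq_zero {A R M N : Type*} [CommRing A] [AddCommGroup R]
    [Module A R] [AddCommGroup M] [Module A M] [AddCommGroup N] [Module A N] {r : A}
    {π : M →ₗ[A] N} (hπ : Function.Surjective π) (hker : ∀ x, π x = 0 → ∃ w, x = r • w)
    {x : R ⊗[A] M} (hx : π.lTensor R x = 0) : ∃ w, x = r • w := by
  obtain ⟨y, rfl⟩ := (lTensor_exact R (LinearMap.exact_subtype_ker_map π) hπ x).1 hx
  clear hx
  induction y using TensorProduct.induction_on with
  | zero => exact ⟨0, by simp⟩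
  | tmul a y =>
    obtain ⟨w, hw⟩ := hker y y.2
    exact ⟨a ⊗ₜ w, by rw [LinearMap.lTensor_tmul, Submodule.subtype_apply, hw,
      TensorProduct.tmul_smul]⟩
  | add x y hx hy =>
    obtain ⟨w, hw⟩ := hx
    obtain ⟨v, hv⟩ := hy
    exact ⟨w + v, by rw [map_add, hw, hv, smul_add]⟩

end Descent

/-! ### Bijectivity of linearisations and of base-changed maps -/

section Linearisation

/-- A form of the five lemma: the vertical map in the middle is bijective if the outer ones are,
where the top row is right exact and the bottom row is exact on the left. -/
lemma bijective_of_exact {X X' X'' Y Y' Y'' : Type*} [AddCommGroup X] [AddCommGroup X']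
    [AddCommGroup X''] [AddCommGroup Y] [AddCommGroup Y'] [AddCommGroup Y'']
    {i : X' →+ X} {p : X →+ X''} {j : Y' →+ Y} {q : Y →+ Y''} {v' : X' →+ Y'} {v : X →+ Y}
    {v'' : X'' →+ Y''} (hp : Function.Surjective p) (hip : ∀ x, p x = 0 → ∃ x', i x' = x)
    (hj : Function.Injective j) (hjq : ∀ y, q y = 0 → ∃ y', j y' = y)
    (h1 : ∀ x, v (i x) = j (v' x)) (h2 : ∀ x, q (v x) = v'' (p x))
    (hv' : Function.Bijective v') (hv'' : Function.Bijective v'') : Function.Bijective v := by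
  constructor
  · rw [injective_iff_map_eq_zero]
    intro x hx
    have h3 : p x = 0 := hv''.1 (by rw [← h2, hx, map_zero, map_zero])
    obtain ⟨x', rfl⟩ := hip x h3
    have h4 : x' = 0 := hv'.1 (hj (by rw [← h1, hx, map_zero, map_zero]))
    rw [h4, map_zero]
  · intro y
    obtain ⟨x'', hx''⟩ := hv''.2 (q y)
    obtain ⟨x, rfl⟩ := hp x''
    obtain ⟨y', hy'⟩ := hjq (y - v x) (by rw [map_sub, h2, hx'', sub_self])
    obtain ⟨x', rfl⟩ := hv'.2 y'
    exact ⟨i x' + x, by rw [map_add, h1, hy', sub_add_cancel]⟩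

/-- Base change to T keeps the upper row right exact, which is all that the five lemma above asks of
it; flatness of T plays no role. This serves both comparison morphisms and linearisations. -/
lemma liftBaseChange_bijective_of_exact {A T : Type*} [CommRing A] [CommRing T] [Algebra A T]
    {D D' D'' E E' E'' : Type*} [AddCommGroup D] [Module A D] [AddCommGroup D'] [Module A D']
    [AddCommGroup D''] [Module A D''] [AddCommGroup E] [Module T E] [Module A E]
    [IsScalarTower A T E] [AddCommGroup E'] [Module T E'] [Module A E'] [IsScalarTower A T E']
    [AddCommGroup E''] [Module T E''] [Module A E''] [IsScalarTower A T E'']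
    {c' : D' →ₗ[A] E'} {c : D →ₗ[A] E} {c'' : D'' →ₗ[A] E''}
    {i : D' →ₗ[A] D} {p : D →ₗ[A] D''} {j : E' →ₗ[T] E} {q : E →ₗ[T] E''}
    (hp : Function.Surjective p) (hip : Function.Exact i p) (hj : Function.Injective j)
    (hjq : Function.Exact j q) (h1 : ∀ x, c (i x) = j (c' x)) (h2 : ∀ x, q (c x) = c'' (p x))
    (hc' : Function.Bijective (c'.liftBaseChange T))
    (hc'' : Function.Bijective (c''.liftBaseChange T)) :
    Function.Bijective (c.liftBaseChange T) := by
  refine bijective_of_exact (i := (i.lTensor T).toAddMonoidHom) (p := (p.lTensor T).toAddMonoidHom)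
    (j := j.toAddMonoidHom) (q := q.toAddMonoidHom) (v := (c.liftBaseChange T).toAddMonoidHom)
    (v' := (c'.liftBaseChange T).toAddMonoidHom) (v'' := (c''.liftBaseChange T).toAddMonoidHom)
    (LinearMap.lTensor_surjective T hp) (fun x hx => (lTensor_exact T hip hp x).1 hx) hj
    (fun y hy => (hjq y).1 hy) (fun x => ?_) (fun x => ?_) hc' hc''
  · change c.liftBaseChange T (i.lTensor T x) = j (c'.liftBaseChange T x)
    induction x using TensorProduct.induction_on with
    | zero => simp
    | tmul t d => simp [h1]
    | add x y hx hy => simp only [map_add, hx, hy]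
  · change q (c.liftBaseChange T x) = c''.liftBaseChange T (p.lTensor T x)
    induction x using TensorProduct.induction_on with
    | zero => simp
    | tmul t d => simp [h2]
    | add x y hx hy => simp only [map_add, hx, hy]

section

variable {R T : Type u} [CommRing R] [CommRing T] {σ : R →+* T} {D E : Type u} [AddCommGroup D]
  [Module R D] [AddCommGroup E] [Module T E]

/-- In terms of generators, surjectivity passes easily to D/rD and to rD. -/
lemma linearisation_surjective_iff (f : D →ₛₗ[σ] E) :
    Function.Surjective (linearisation f) ↔ Submodule.span T (Set.range f) = ⊤ := by
  let := σ.toAlgebra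
  rw [← LinearMap.range_eq_top]
  suffices h : LinearMap.range (linearisation f) = Submodule.span T (Set.range f) by rw [h]
  apply le_antisymm
  · rintro _ ⟨x, rfl⟩
    induction x using TensorProduct.induction_on with
    | zero => simp
    | tmul t d =>
      exact Submodule.smul_mem _ t (Submodule.subset_span ⟨d, rfl⟩)
    | add x y hx hy => rw [map_add]; exact add_mem hx hy
  · rw [Submodule.span_le]
    rintro _ ⟨d, rfl⟩
    exact ⟨1 ⊗ₜ d, by rw [linearisation_tmul, one_smul]⟩

lemma linearisation_bijective_of_surjective {f : D →ₛₗ[σ] E}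
    (hf : Function.Surjective (linearisation f)) (h1 : Module.Finite R D)
    (h2 : Module.Projective R D) (h3 : Module.Finite T E) (h4 : Module.Projective T E) {n : ℕ}
    (h5 : ∀ p : PrimeSpectrum R, Module.rankAtStalk (R := R) D p = n)
    (h6 : ∀ p : PrimeSpectrum T, Module.rankAtStalk (R := T) E p = n) :
    Function.Bijective (linearisation f) := by
  let := σ.toAlgebra
  exact Module.bijective_of_surjective_of_rankAtStalk_eq hf fun m _ => by
    rw [h6, Module.rankAtStalk_baseChange, h5]

lemma linearisation_bijective_of_exact {D' D'' E' E'' : Type u} [AddCommGroup D'] [Module R D']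
    [AddCommGroup D''] [Module R D''] [AddCommGroup E'] [Module T E'] [AddCommGroup E'']
    [Module T E''] {f' : D' →ₛₗ[σ] E'} {f : D →ₛₗ[σ] E} {f'' : D'' →ₛₗ[σ] E''}
    {i : D' →ₗ[R] D} {p : D →ₗ[R] D''} {j : E' →ₗ[T] E} {q : E →ₗ[T] E''}
    (hp : Function.Surjective p) (hip : Function.Exact i p) (hj : Function.Injective j)
    (hjq : Function.Exact j q) (h1 : ∀ x, f (i x) = j (f' x)) (h2 : ∀ x, q (f x) = f'' (p x))
    (hf' : Function.Bijective (linearisation f')) (hf'' : Function.Bijective (linearisation f'')) :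
    Function.Bijective (linearisation f) := by
  let := σ.toAlgebra
  let := Module.compHom E σ
  let := Module.compHom E' σ
  let := Module.compHom E'' σ
  have : IsScalarTower R T E := ⟨fun a t e => mul_smul (σ a) t e⟩
  have : IsScalarTower R T E' := ⟨fun a t e => mul_smul (σ a) t e⟩
  have : IsScalarTower R T E'' := ⟨fun a t e => mul_smul (σ a) t e⟩
  exact liftBaseChange_bijective_of_exact
    (c := { toFun := f, map_add' := f.map_add, map_smul' := f.map_smulₛₗ })
    (c' := { toFun := f', map_add' := f'.map_add, map_smul' := f'.map_smulₛₗ })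
    (c'' := { toFun := f'', map_add' := f''.map_add, map_smul' := f''.map_smulₛₗ })
    hp hip hj hjq h1 h2 hf' hf''

lemma linearisation_map_bijective {D' E' : Type u} [AddCommGroup D'] [Module R D']
    [AddCommGroup E'] [Module T E'] {f : D →ₛₗ[σ] E} {f' : D' →ₛₗ[σ] E'}
    (hf : Function.Bijective (linearisation f)) (hf' : Function.Bijective (linearisation f')) :
    Function.Bijective (linearisation (TensorProduct.map f f')) := by
  let := σ.toAlgebra
  let e := (AlgebraTensorModule.distribBaseChange R T D D').trans
    (TensorProduct.congr (LinearEquiv.ofBijective (linearisation f) hf)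
      (LinearEquiv.ofBijective (linearisation f') hf'))
  have h : ∀ x, linearisation (TensorProduct.map f f') x = e x := by
    intro x
    induction x using TensorProduct.induction_on with
    | zero => simp
    | tmul t y =>
      induction y using TensorProduct.induction_on with
      | zero => simp
      | tmul d d' =>
        rw [linearisation_tmul, TensorProduct.map_tmul]
        change _ = linearisation f (t ⊗ₜ d) ⊗ₜ[T] linearisation f' (1 ⊗ₜ d')
        rw [linearisation_tmul, linearisation_tmul, one_smul, TensorProduct.smul_tmul']
      | add x y hx hy => simp only [TensorProduct.tmul_add, map_add, hx, hy]
    | add x y hx hy => simp only [map_add, hx, hy]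
  have : ⇑(linearisation (TensorProduct.map f f')) = e := funext h
  rw [this]
  exact e.bijective

lemma linearisation_self_bijective (f : R →ₛₗ[σ] T) (hf : f 1 = 1) :
    Function.Bijective (linearisation f) := by
  let := σ.toAlgebra
  have : ⇑(linearisation f) = TensorProduct.rid R T := by
    funext x
    induction x using TensorProduct.induction_on with
    | zero => simp
    | tmul t a =>
      rw [linearisation_tmul, TensorProduct.rid_tmul]
      have h : f a = σ a := by
        have := f.map_smulₛₗ a 1
        rwa [hf, smul_eq_mul, mul_one, smul_eq_mul, mul_one] at this
      rw [h, smul_eq_mul, mul_comm]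
      rfl
    | add x y hx hy => simp only [map_add, hx, hy]
  rw [this]
  exact (TensorProduct.rid R T).bijective

end

/-- If base changes of `G` and `G'` along `A → R` and `A' → R'` are compatible with semilinear maps
`f : G → G'` and `F : Y → Y'`, and `F` has bijective linearisation, then the linearisation of `f`
becomes bijective over `R'`. -/
lemma lTensor_linearisation_bijective {A A' R R' : Type u} [CommRing A] [CommRing A'] [CommRing R]
    [CommRing R'] [Algebra A R] [Algebra A' R'] {σ : A →+* A'} {φ : R →+* R'}
    (hσφ : ∀ a, φ (algebraMap A R a) = algebraMap A' R' (σ a))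
    {G G' Y Y' : Type u} [AddCommGroup G] [Module A G] [AddCommGroup G'] [Module A' G']
    [AddCommGroup Y] [Module R Y] [Module A Y] [IsScalarTower A R Y]
    [AddCommGroup Y'] [Module R' Y'] [Module A' Y'] [IsScalarTower A' R' Y']
    {f : G →ₛₗ[σ] G'} {F : Y →ₛₗ[φ] Y'} {c : G →ₗ[A] Y} {c' : G' →ₗ[A'] Y'}
    (h : ∀ g, F (c g) = c' (f g)) (hc : Function.Bijective (c.liftBaseChange R))
    (hc' : Function.Bijective (c'.liftBaseChange R'))
    (hF : Function.Bijective (linearisation F)) :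
    letI := σ.toAlgebra
    Function.Bijective ((linearisation f).lTensor R') := by
  let := σ.toAlgebra
  let := φ.toAlgebra
  let := ((algebraMap A' R').comp σ).toAlgebra
  have : IsScalarTower A A' R' := .of_algebraMap_eq fun a => rfl
  have : IsScalarTower A R R' := .of_algebraMap_eq fun a => (hσφ a).symm
  -- The chain is R' ⊗ (A' ⊗ G) = R' ⊗ G = R' ⊗ (R ⊗ G) ≅ R' ⊗ Y ≅ Y', over A', A, A and R in turn
  -- for the outer products in the middle.
  let e1 := AlgebraTensorModule.cancelBaseChange A A' R' R' G
  let e2 := (AlgebraTensorModule.cancelBaseChange A R R' R' G).symm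
  let e3 := AlgebraTensorModule.congr (LinearEquiv.refl R' R') (LinearEquiv.ofBijective _ hc)
  let e := e1.trans (e2.trans (e3.trans (LinearEquiv.ofBijective _ hF)))
  have key : ∀ x, c'.liftBaseChange R' ((linearisation f).lTensor R' x) = e x := by
    intro x
    induction x using TensorProduct.induction_on with
    | zero => simp
    | tmul b y =>
      induction y using TensorProduct.induction_on with
      | zero => simp
      | tmul a g =>
        rw [LinearMap.lTensor_tmul, linearisation_tmul]
        change b • c' (a • f g) = (a • b) • F ((1 : R) • c g)
        rw [map_smul, one_smul, h, ← smul_comm, smul_assoc]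
      | add x y hx hy => simp only [TensorProduct.tmul_add, map_add, hx, hy]
    | add x y hx hy => simp only [map_add, hx, hy]
  have : ⇑(c'.liftBaseChange R') ∘ ((linearisation f).lTensor R') = e := funext key
  exact (Function.Bijective.of_comp_iff' hc' _).1 (this ▸ e.bijective)

/-- T ⊗ P is projective, hence separated, and D is finite and torsion-free, so bijectivity modulo r
is enough. The factor v allows T to be an algebra through φ_s, where r goes only to a multiple of r;
for the comparison morphism, v = 1. -/
lemma liftBaseChange_bijective_of_modulo {A T : Type*} [CommRing A] [CommRing T] [Algebra A T]
    {s : A} {r v : T} (hs : algebraMap A T s = r * v) [IsAdicComplete (Ideal.span {r}) T]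
    {P G D Y : Type*} [AddCommGroup P] [Module A P] [AddCommGroup G] [Module A G] [AddCommGroup D]
    [Module T D] [Module A D] [IsScalarTower A T D] [AddCommGroup Y] [Module T Y] [Module A Y]
    [IsScalarTower A T Y] [Module.Projective A P] [Module.Finite T D]
    (hD : ∀ y : D, r • y = 0 → y = 0) (hY : ∀ y : Y, r • y = 0) {c : P →ₗ[A] D} {c' : G →ₗ[A] Y}
    {g : P →ₗ[A] G} {π : D →ₗ[T] Y} (hg : Function.Surjective g)
    (hker : ∀ x, g x = 0 → ∃ w, x = s • w) (hπ : ∀ y, π y = 0 → ∃ w, y = r • w)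
    (h : ∀ x, π (c x) = c' (g x)) (hc' : Function.Bijective (c'.liftBaseChange T)) :
    Function.Bijective (c.liftBaseChange T) := by
  have key : ∀ z, π (c.liftBaseChange T z) = c'.liftBaseChange T (g.lTensor T z) := by
    intro z
    induction z using TensorProduct.induction_on with
    | zero => simp
    | tmul t d => simp [h]
    | add x y hx hy => simp only [map_add, hx, hy]
  constructor
  · refine injective_of_injective_modulo (isAdicSeparated_of_projective (r := r) _) hD
      fun x z hx => ?_
    obtain ⟨w, hw⟩ := exists_eq_smul_of_lTensor_eq_zero (R := T) hg hker (x := x) <| hc'.1 <| by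
      rw [← key, hx, map_smul, hY, map_zero]
    exact ⟨v • w, by rw [hw, ← algebraMap_smul T s w, hs, mul_smul]⟩
  · refine surjective_of_surjective_modulo (r := r) fun y => ?_
    obtain ⟨z, hz⟩ := hc'.2 (π y)
    obtain ⟨z, rfl⟩ := LinearMap.lTensor_surjective T hg z
    obtain ⟨w, hw⟩ := hπ (y - c.liftBaseChange T z) (by rw [map_sub, key, hz, sub_self])
    exact ⟨z, w, by rw [← hw]; abel⟩

lemma linearisation_bijective_of_modulo {A T : Type u} [CommRing A] [CommRing T] {σ : A →+* T}
    {s : A} {r v : T} (hs : σ s = r * v) [IsAdicComplete (Ideal.span {r}) T]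
    {P G D Y : Type u} [AddCommGroup P] [Module A P] [AddCommGroup G] [Module A G] [AddCommGroup D]
    [Module T D] [AddCommGroup Y] [Module T Y] [Module.Projective A P] [Module.Finite T D]
    (hD : ∀ y : D, r • y = 0 → y = 0) (hY : ∀ y : Y, r • y = 0) {c : P →ₛₗ[σ] D} {c' : G →ₛₗ[σ] Y}
    {g : P →ₗ[A] G} {π : D →ₗ[T] Y} (hg : Function.Surjective g)
    (hker : ∀ x, g x = 0 → ∃ w, x = s • w) (hπ : ∀ y, π y = 0 → ∃ w, y = r • w)
    (h : ∀ x, π (c x) = c' (g x)) (hc' : Function.Bijective (linearisation c')) :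
    Function.Bijective (linearisation c) := by
  let := σ.toAlgebra
  let := Module.compHom D σ
  let := Module.compHom Y σ
  have : IsScalarTower A T D := ⟨fun a t e => mul_smul (σ a) t e⟩
  have : IsScalarTower A T Y := ⟨fun a t e => mul_smul (σ a) t e⟩
  exact liftBaseChange_bijective_of_modulo
    (c := { toFun := c, map_add' := c.map_add, map_smul' := c.map_smulₛₗ })
    (c' := { toFun := c', map_add' := c'.map_add, map_smul' := c'.map_smulₛₗ })
    hs hD hY hg hker hπ h hc'

end Linearisation

/-! ### The `S / S'`-ring of invariants -/

lemma isAdicComplete_of_hasAdicLimits {R : Type u} [CommRing R] {r : R} {M : Type*}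
    [AddCommGroup M] [Module R M] (h1 : IsAdicSeparated r M) (h2 : HasAdicLimits r M) :
    IsAdicComplete (Ideal.span {r}) M where
  haus' x hx := h1 x fun n => by
    have := hx n
    rwa [SModEq.zero, Ideal.span_singleton_pow, mem_span_singleton_smul_top] at this
  prec' f hf := by
    obtain ⟨L, hL⟩ := h2 f fun n => by
      have := (hf (Nat.le_succ n)).symm
      rw [SModEq.sub_mem, Ideal.span_singleton_pow, mem_span_singleton_smul_top] at this
      obtain ⟨z, hz⟩ := this
      exact ⟨z, by rw [← hz]; abel⟩
    refine ⟨L, fun n => ?_⟩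
    obtain ⟨c, rfl⟩ := hL n
    rw [SModEq.comm, SModEq.sub_mem, add_sub_cancel_left, Ideal.span_singleton_pow,
      mem_span_singleton_smul_top]
    exact ⟨c, rfl⟩

section InvRing

variable {S : Type w} [Monoid S] {S' : Submonoid S} {R : Type u} [CommRing R]
  [MulSemiringAction S R] (r : InvRing S' R)

variable (S) in
lemma IsDevissageSetup.eq_zero_of_pow_mul (r : R) [h : IsDevissageSetup S r] (n : ℕ) {a : R}
    (ha : r ^ n * a = 0) : a = 0 := by
  induction n with
  | zero => simpa using ha
  | succ n ih => exact ih (h.torsionFree _ (by rwa [← mul_assoc, ← pow_succ']))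

lemma smul_pow_mul {s : S} (hs : s ∈ S') (n : ℕ) (a : R) :
    s • ((r : R) ^ n * a) = (r : R) ^ n * s • a := by
  rw [smul_mul', smul_pow', (mem_invRing S').1 r.2 s hs]

variable [IsDevissageSetup S (r : R)]

/-- By torsion-freeness, r ^ n R ∩ R^{S'} = r ^ n R^{S'}: the r-adic topology of R^{S'} is induced
by that of R. -/
lemma mem_invRing_of_pow_mul_mem (n : ℕ) {a : R} (ha : (r : R) ^ n * a ∈ InvRing S' R) :
    a ∈ InvRing S' R := by
  rw [mem_invRing] at ha ⊢
  intro s hs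
  have := ha s hs
  rw [smul_pow_mul r hs, ← sub_eq_zero, ← mul_sub] at this
  exact sub_eq_zero.1 (IsDevissageSetup.eq_zero_of_pow_mul S (r : R) n this)

lemma isAdicComplete_invRing : IsAdicComplete (Ideal.span {r}) (InvRing S' R) := by
  have := IsDevissageSetup.complete (S := S) (r := (r : R))
  have hs : IsAdicSeparated (r : R) R := isAdicSeparated_self
  refine isAdicComplete_of_hasAdicLimits (fun x hx => Subtype.ext (hs _ fun n => ?_))
    fun x hx => ?_
  · obtain ⟨y, rfl⟩ := hx n
    exact ⟨y, rfl⟩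
  · obtain ⟨L, hL⟩ := hasAdicLimits_self (r := (r : R)) (fun n => (x n : R)) fun n => by
      obtain ⟨z, hz⟩ := hx n
      exact ⟨z, by rw [hz]; rfl⟩
    choose c hc using hL
    -- For s in S', the element s • L − L is divisible by every power of r, since s fixes r and all
    -- terms of the sequence.
    have hLm : L ∈ InvRing S' R := by
      rw [mem_invRing]
      intro s hs'
      refine sub_eq_zero.1 (hs _ fun n => ⟨s • c n - c n, ?_⟩)
      have hx : s • (x n : R) = x n := (mem_invRing S').1 (x n).2 s hs'
      rw [hc n, smul_add, hx, smul_eq_mul, smul_pow_mul r hs', smul_eq_mul, mul_sub]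
      ring
    refine ⟨⟨L, hLm⟩, fun n => ⟨⟨c n, mem_invRing_of_pow_mul_mem r n ?_⟩, Subtype.ext (hc n)⟩⟩
    rw [← smul_eq_mul, ← sub_eq_iff_eq_add'.2 (hc n)]
    exact sub_mem hLm (x n).2

variable [IsNormalSubmonoid S']

lemma isDevissageSetup_invRing : IsDevissageSetup (QuotMonoid S') r where
  torsionFree a ha := Subtype.ext (IsDevissageSetup.torsionFree S (r := (r : R)) a
    (congrArg Subtype.val ha))
  complete := isAdicComplete_invRing r
  span_smul q := by
    induction q using Con.induction_on with
    | H s =>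
    have hs := IsDevissageSetup.span_smul (r := (r : R)) s
    have h1 : (r : R) ∣ s • (r : R) := by
      rw [← Ideal.mem_span_singleton, ← hs]
      exact Ideal.mem_span_singleton_self _
    have h2 : s • (r : R) ∣ r := by
      rw [← Ideal.mem_span_singleton, hs]
      exact Ideal.mem_span_singleton_self _
    obtain ⟨u, hu⟩ := h1
    obtain ⟨v, hv⟩ := h2
    have hum : u ∈ InvRing S' R := mem_invRing_of_pow_mul_mem r 1 (by
      rw [pow_one, ← hu]
      exact smul_mem_invRing S' s r.2)
    -- The ideals generated by r and s • r must agree inside R^{S'}. The factor u is invariant by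
    -- saturation, and v is invariant because it is the inverse of u.
    have huv : u * v = 1 := by
      refine sub_eq_zero.1 (IsDevissageSetup.torsionFree S (r := (r : R)) _ ?_)
      rw [mul_sub, ← mul_assoc, ← hu, ← hv, mul_one, sub_self]
    have hvm : v ∈ InvRing S' R := by
      rw [mem_invRing] at hum ⊢
      intro t ht
      have h3 : u * t • v = 1 := by
        nth_rewrite 1 [← hum t ht]
        rw [← smul_mul', huv, smul_one]
      calc t • v = (u * v) * t • v := by rw [huv, one_mul]
        _ = v * (u * t • v) := by ring
        _ = v := by rw [h3, mul_one]
    apply le_antisymm <;> rw [Ideal.span_singleton_le_iff_mem, Ideal.mem_span_singleton]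
    · exact ⟨⟨u, hum⟩, Subtype.ext hu⟩
    · exact ⟨⟨v, hvm⟩, Subtype.ext hv⟩

end InvRing

/-! ### Vanishing of first cohomology -/

section Cohomology

/-- Every `1`-cocycle is a `1`-coboundary, for the action `τ` of `G` on `M`. -/
def H1Vanishes {G : Type*} [Monoid G] {M : Type*} [AddCommGroup M] (τ : G →* AddMonoid.End M) :
    Prop :=
  ∀ f : G → M, (∀ s t, f (s * t) = f s + τ s (f t)) → ∃ a, ∀ s, f s = τ s a - a

variable {G : Type*} [Monoid G] {M M' M'' : Type*} [AddCommGroup M] [AddCommGroup M']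
  [AddCommGroup M''] {τ : G →* AddMonoid.End M} {τ' : G →* AddMonoid.End M'}
  {τ'' : G →* AddMonoid.End M''}

lemma isCocycle_sub_coboundary {f : G → M} (hf : ∀ s t, f (s * t) = f s + τ s (f t)) (a : M)
    (s t : G) : f (s * t) - (τ (s * t) a - a) =
      f s - (τ s a - a) + τ s (f t - (τ t a - a)) := by
  have : τ (s * t) a = τ s (τ t a) := by rw [map_mul]; rfl
  rw [hf, this, map_sub, map_sub]
  abel

lemma H1Vanishes.of_exact {i : M' →+ M} {p : M →+ M''} (hi : Function.Injective i)
    (hp : Function.Surjective p) (hip : ∀ x, p x = 0 → ∃ y, i y = x)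
    (hi' : ∀ s x, i (τ' s x) = τ s (i x)) (hp' : ∀ s x, p (τ s x) = τ'' s (p x))
    (h' : H1Vanishes τ') (h'' : H1Vanishes τ'') : H1Vanishes τ := by
  intro f hf
  obtain ⟨a'', ha''⟩ := h'' (fun s => p (f s)) fun s t => by rw [hf, map_add, hp']
  obtain ⟨a, rfl⟩ := hp a''
  have h1 : ∀ s, ∃ y, i y = f s - (τ s a - a) := fun s => hip _ (by
    rw [map_sub, ha'', map_sub, hp', sub_self])
  choose g hg using h1
  obtain ⟨b, hb⟩ := h' g fun s t => hi (by
    rw [map_add, hi', hg, hg, hg, isCocycle_sub_coboundary hf])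
  refine ⟨a + i b, fun s => ?_⟩
  have := hg s
  rw [hb, map_sub, hi', eq_sub_iff_add_eq] at this
  rw [← this, map_add]
  abel

lemma H1Vanishes.of_equiv (e : M ≃+ M') (he : ∀ s x, e (τ s x) = τ' s (e x))
    (h : H1Vanishes τ) : H1Vanishes τ' := by
  intro f hf
  obtain ⟨a, ha⟩ := h (fun s => e.symm (f s)) fun s t => e.injective (by
    rw [e.apply_symm_apply, map_add, he, e.apply_symm_apply, e.apply_symm_apply, hf])
  exact ⟨e a, fun s => by rw [← he, ← map_sub, ← ha, e.apply_symm_apply]⟩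

/-- Vanishing of `H¹` passes from `M / r M` to a separated and complete `r`-torsion-free `M`. -/
lemma H1Vanishes.of_modulo {R : Type*} [CommRing R] {r : R} [Module R M]
    (hM : ∀ x : M, r • x = 0 → x = 0) (hs : IsAdicSeparated r M) (hl : HasAdicLimits r M)
    (hr : ∀ s x, τ s (r • x) = r • τ s x)
    (h : ∀ f : G → M, (∀ s t, f (s * t) = f s + τ s (f t)) →
      ∃ a, ∀ s, ∃ y, f s = τ s a - a + r • y) : H1Vanishes τ := by
  have hrn : ∀ (n : ℕ) s x, τ s (r ^ n • x) = r ^ n • τ s x := by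
    intro n s x
    induction n with
    | zero => simp
    | succ n ih => rw [pow_succ', mul_smul, hr, ih, mul_smul]
  let Z := {f : G → M // ∀ s t, f (s * t) = f s + τ s (f t)}
  -- A cocycle is a coboundary plus r times a cochain; the cochain is again a cocycle because M is
  -- torsion-free, so the procedure can be repeated.
  have step : ∀ f : Z, ∃ (a : M) (g : Z), ∀ s, f.1 s = τ s a - a + r • g.1 s := by
    rintro ⟨f, hf⟩
    obtain ⟨a, ha⟩ := h f hf
    choose g hg using ha
    have hg' : ∀ s, r • g s = f s - (τ s a - a) := fun s => by rw [hg, add_sub_cancel_left]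
    refine ⟨a, ⟨g, fun s t => sub_eq_zero.1 (hM _ ?_)⟩, hg⟩
    rw [smul_sub, smul_add, ← hr, hg', hg', hg', isCocycle_sub_coboundary hf, sub_self]
  choose a g hag using step
  intro f hf
  let F : ℕ → Z := fun n => g^[n] ⟨f, hf⟩
  have hF : ∀ n, F (n + 1) = g (F n) := fun n => Function.iterate_succ_apply' g n _
  -- The successive primitives add up to an r-adically convergent series, whose sum is a primitive
  -- of the original cocycle by separatedness.
  let x : ℕ → M := fun n => ∑ i ∈ Finset.range n, r ^ i • a (F i)
  have hx : ∀ n s, f s = τ s (x n) - x n + r ^ n • (F n).1 s := by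
    intro n s
    induction n with
    | zero => simp [x, F]
    | succ n ih =>
      have : x (n + 1) = x n + r ^ n • a (F n) := Finset.sum_range_succ _ _
      rw [ih, this, map_add, hrn, hag (F n) s, hF, pow_succ, mul_smul, smul_add, smul_sub]
      abel
  obtain ⟨L, hL⟩ := hl x fun n => ⟨a (F n), Finset.sum_range_succ _ _⟩
  refine ⟨L, fun s => sub_eq_zero.1 (hs _ fun n => ?_)⟩
  obtain ⟨c, rfl⟩ := hL n
  refine ⟨(F n).1 s - (τ s c - c), ?_⟩
  rw [hx n s, map_add, hrn, smul_sub, smul_sub]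
  abel

end Cohomology

/-! ### Modules of the form `R ⊗ X` -/

section Induced

variable {S : Type w} [Monoid S] {S' : Submonoid S} {R : Type u} [CommRing R]
  [MulSemiringAction S R]

variable (R) in
/-- The endomorphism `φ_s` of `R`, as an `R^{S'}`-linear map, for `s ∈ S'`. -/
def smulInvLinear (s : S') : R →ₗ[InvRing S' R] R where
  toFun a := s • a
  map_add' := smul_add s
  map_smul' c a := by
    change (s : S) • ((c : R) * a) = (c : R) * (s : S) • a
    rw [smul_mul', (mem_invRing S').1 c.2 s s.2]

/-- The action of `S'` on `R ⊗ X` through `R`. -/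
noncomputable def inducedAct (X : Type u) [AddCommGroup X] [Module (InvRing S' R) X] :
    S' →* AddMonoid.End (R ⊗[InvRing S' R] X) where
  toFun s := ((smulInvLinear R s).rTensor X).toAddMonoidHom
  map_one' := by
    ext x
    change (smulInvLinear R (1 : S')).rTensor X x = x
    have : smulInvLinear R (1 : S') = LinearMap.id := LinearMap.ext fun a => one_smul S' a
    rw [this, LinearMap.rTensor_id, LinearMap.id_apply]
  map_mul' s t := by
    ext x
    change (smulInvLinear R (s * t)).rTensor X x =
      (smulInvLinear R s).rTensor X ((smulInvLinear R t).rTensor X x)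
    have : smulInvLinear R (s * t) = smulInvLinear R s ∘ₗ smulInvLinear R t :=
      LinearMap.ext fun a => mul_smul s t a
    rw [this, LinearMap.rTensor_comp, LinearMap.comp_apply]

variable {X Y : Type u} [AddCommGroup X] [Module (InvRing S' R) X] [AddCommGroup Y]
  [Module (InvRing S' R) Y]

lemma inducedAct_tmul (s : S') (a : R) (x : X) :
    inducedAct X s (a ⊗ₜ x) = ((s : S) • a) ⊗ₜ x := rfl

lemma lTensor_inducedAct (f : X →ₗ[InvRing S' R] Y) (s : S') (z : R ⊗[InvRing S' R] X) :
    f.lTensor R (inducedAct X s z) = inducedAct Y s (f.lTensor R z) := by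
  induction z using TensorProduct.induction_on with
  | zero => simp
  | tmul => rfl
  | add x y hx hy => simp only [map_add, hx, hy]

variable (S' R) in
/-- `X` is the module of invariants of `R ⊗ X`. -/
def IsInvariantsOfInduced (X : Type u) [AddCommGroup X] [Module (InvRing S' R) X] : Prop :=
  (∀ x : X, (1 : R) ⊗ₜ[InvRing S' R] x = 0 → x = 0) ∧
    ∀ y : R ⊗[InvRing S' R] X, (∀ s, inducedAct X s y = y) → ∃ x : X, y = (1 : R) ⊗ₜ x

lemma IsInvariantsOfInduced.of_retract {i : X →ₗ[InvRing S' R] Y} {p : Y →ₗ[InvRing S' R] X}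
    (hip : ∀ x, p (i x) = x) (h : IsInvariantsOfInduced S' R Y) : IsInvariantsOfInduced S' R X := by
  refine ⟨fun x hx => ?_, fun y hy => ?_⟩
  · have : i x = 0 := h.1 _ (by rw [← LinearMap.lTensor_tmul, hx, map_zero])
    rw [← hip x, this, map_zero]
  · obtain ⟨x, hx⟩ := h.2 (i.lTensor R y) fun s => by rw [← lTensor_inducedAct, hy]
    refine ⟨p x, ?_⟩
    rw [← LinearMap.lTensor_tmul, ← hx, ← LinearMap.comp_apply, ← LinearMap.lTensor_comp,
      show p ∘ₗ i = LinearMap.id from LinearMap.ext hip, LinearMap.lTensor_id, LinearMap.id_apply]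

lemma H1Vanishes.induced_of_retract {i : X →ₗ[InvRing S' R] Y} {p : Y →ₗ[InvRing S' R] X}
    (hip : ∀ x, p (i x) = x) (h : H1Vanishes (inducedAct (S' := S') (R := R) Y)) :
    H1Vanishes (inducedAct (S' := S') (R := R) X) := by
  intro f hf
  obtain ⟨a, ha⟩ := h (fun s => i.lTensor R (f s)) fun s t => by
    rw [hf, map_add, lTensor_inducedAct]
  have hpi : ∀ z : R ⊗[InvRing S' R] X, p.lTensor R (i.lTensor R z) = z := fun z => by
    rw [← LinearMap.comp_apply, ← LinearMap.lTensor_comp,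
      show p ∘ₗ i = LinearMap.id from LinearMap.ext hip, LinearMap.lTensor_id, LinearMap.id_apply]
  exact ⟨p.lTensor R a, fun s => by
    rw [← lTensor_inducedAct, ← map_sub, ← ha, hpi]⟩

section

variable {ι : Type} [Fintype ι] {X : ι → Type u} [∀ i, AddCommGroup (X i)]
  [∀ i, Module (InvRing S' R) (X i)]

lemma exists_induced_pi (y : ∀ i, R ⊗[InvRing S' R] X i) :
    ∃ z : R ⊗[InvRing S' R] (∀ i, X i), ∀ i, (LinearMap.proj i).lTensor R z = y i := by
  classical
  refine ⟨(TensorProduct.piRight (InvRing S' R) (InvRing S' R) R X).symm y, fun i => ?_⟩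
  obtain ⟨z, rfl⟩ := (TensorProduct.piRight (InvRing S' R) (InvRing S' R) R X).surjective y
  rw [LinearEquiv.symm_apply_apply]
  induction z using TensorProduct.induction_on with
  | zero => simp
  | tmul => rfl
  | add x y hx hy => rw [map_add, map_add, hx, hy]; rfl

lemma induced_pi_ext {y z : R ⊗[InvRing S' R] (∀ i, X i)}
    (h : ∀ i, (LinearMap.proj i).lTensor R y = (LinearMap.proj i).lTensor R z) : y = z := by
  classical
  have key : ∀ (z : R ⊗[InvRing S' R] (∀ i, X i)) i,
      TensorProduct.piRight (InvRing S' R) (InvRing S' R) R X z i =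
        (LinearMap.proj i).lTensor R z := by
    intro z i
    induction z using TensorProduct.induction_on with
    | zero => simp
    | tmul => rfl
    | add x y hx hy => rw [map_add, map_add, ← hx, ← hy]; rfl
  apply (TensorProduct.piRight (InvRing S' R) (InvRing S' R) R X).injective
  funext i
  rw [key, key, h]

lemma IsInvariantsOfInduced.pi (h : ∀ i, IsInvariantsOfInduced S' R (X i)) :
    IsInvariantsOfInduced S' R (∀ i, X i) := by
  refine ⟨fun x hx => funext fun i => (h i).1 _ ?_, fun y hy => ?_⟩
  · have := congrArg ((LinearMap.proj (R := InvRing S' R) (φ := X) i).lTensor R) hx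
    simpa using this
  · choose x hx using fun i => (h i).2 ((LinearMap.proj i).lTensor R y) fun s => by
      rw [← lTensor_inducedAct, hy]
    exact ⟨x, induced_pi_ext hx⟩

lemma H1Vanishes.induced_pi (h : ∀ i, H1Vanishes (inducedAct (S' := S') (R := R) (X i))) :
    H1Vanishes (inducedAct (S' := S') (R := R) (∀ i, X i)) := by
  intro f hf
  choose a ha using fun i => h i (fun s => (LinearMap.proj i).lTensor R (f s)) fun s t => by
    rw [hf, map_add, lTensor_inducedAct]
  obtain ⟨b, hb⟩ := exists_induced_pi a
  refine ⟨b, fun s => induced_pi_ext fun i => ?_⟩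
  rw [ha, map_sub, lTensor_inducedAct, hb]

end

end Induced

/-! ### Direct summands of free modules over A/c -/

section

variable {A : Type u} [CommRing A]

lemma ModSMul.map_mem {P Q : Type u} [AddCommGroup P] [Module A P] [AddCommGroup Q] [Module A Q]
    (c : A) (f : P →ₗ[A] Q) :
    LinearMap.range (LinearMap.lsmul A P c) ≤
      (LinearMap.range (LinearMap.lsmul A Q c)).comap f := by
  rintro _ ⟨x, rfl⟩
  exact ⟨f x, by simp⟩

/-- `P / c P` is a direct summand of a finite free `A / c`-module, for `P` finite projective. -/
lemma exists_retract_modSMul (P : Type u) [AddCommGroup P] [Module A P] [Module.Finite A P]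
    [Module.Projective A P] (c : A) :
    ∃ (n : ℕ) (i : ModSMul c P →ₗ[A] (Fin n → ModSMul c A))
      (p : (Fin n → ModSMul c A) →ₗ[A] ModSMul c P), ∀ x, p (i x) = x := by
  obtain ⟨n, p, hp⟩ := Module.Finite.exists_fin' A P
  obtain ⟨i, hi⟩ := Module.projective_lifting_property p LinearMap.id hp
  have hi' : ∀ y, p (i y) = y := fun y => LinearMap.congr_fun hi y
  let i' : ModSMul c P →ₗ[A] (Fin n → ModSMul c A) :=
    LinearMap.pi fun j => Submodule.mapQ _ _ (LinearMap.proj j ∘ₗ i) (ModSMul.map_mem c _)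
  let p' : (Fin n → ModSMul c A) →ₗ[A] ModSMul c P :=
    LinearMap.lsum A (fun _ => ModSMul c A) A fun j =>
      Submodule.mapQ _ _ (p ∘ₗ LinearMap.single A (fun _ => A) j) (ModSMul.map_mem c _)
  refine ⟨n, i', p', fun x => ?_⟩
  obtain ⟨x, rfl⟩ := Submodule.mkQ_surjective _ x
  have h : p' (i' (Submodule.Quotient.mk x)) =
      ∑ j, Submodule.Quotient.mk (p (Pi.single j (i x j))) := by
    simp only [p', LinearMap.lsum_apply, LinearMap.sum_apply]
    rfl
  rw [Submodule.mkQ_apply, h, ← Submodule.mkQ_apply]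
  change ∑ j, Submodule.mkQ _ (p (Pi.single j (i x j))) = _
  rw [← map_sum, ← map_sum, Finset.univ_sum_single, hi']

/-- A module killed by `r` and projective modulo `r` is a direct summand of a finite free
`A / r`-module. -/
lemma exists_retract_of_isProjectiveModulo {r : A} {G : Type u} [AddCommGroup G] [Module A G]
    (hG : ∀ x : G, r • x = 0) (h : IsProjectiveModulo r G) :
    ∃ (n : ℕ) (i : G →ₗ[A] (Fin n → A ⧸ Ideal.span {r}))
      (p : (Fin n → A ⧸ Ideal.span {r}) →ₗ[A] G), ∀ x, p (i x) = x := by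
  let := moduleOfSMulEqZero hG
  have := isScalarTower_moduleOfSMulEqZero hG
  obtain ⟨h1, h2, -⟩ := isProjectiveModulo_iff_of_quotient.1 h
  obtain ⟨n, p, hp⟩ := Module.Finite.exists_fin' (A ⧸ Ideal.span {r}) G
  obtain ⟨i, hi⟩ := Module.projective_lifting_property p LinearMap.id hp
  exact ⟨n, i.restrictScalars A, p.restrictScalars A, fun x => LinearMap.congr_fun hi x⟩

end

/-! ### Invariants and H¹ of R ⊗ X for X a sum of elementary quotients -/

section Induced

variable {S : Type w} [Monoid S] {S' : Submonoid S} {R : Type u} [CommRing R]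
  [MulSemiringAction S R]

/-- With `tmul_mk_eq_zero_iff`, this identifies R ⊗ R^{S'}/c with R/cR element by element, so that
cochains can be handled through representatives in R. -/
lemma tmul_mk_eq (c : InvRing S' R) (y : R ⊗[InvRing S' R] ModSMul c (InvRing S' R)) :
    ∃ a : R, y = a ⊗ₜ Submodule.Quotient.mk 1 := by
  induction y using TensorProduct.induction_on with
  | zero => exact ⟨0, by simp⟩
  | tmul a x =>
    obtain ⟨b, rfl⟩ := Submodule.mkQ_surjective _ x
    refine ⟨b • a, ?_⟩
    rw [TensorProduct.smul_tmul, ← Submodule.Quotient.mk_smul, smul_eq_mul, mul_one]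
    rfl
  | add x y hx hy =>
    obtain ⟨a, rfl⟩ := hx
    obtain ⟨b, rfl⟩ := hy
    exact ⟨a + b, by rw [TensorProduct.add_tmul]⟩

lemma tmul_mk_eq_zero_iff {c : InvRing S' R} {a : R} :
    a ⊗ₜ[InvRing S' R] (Submodule.Quotient.mk 1 : ModSMul c (InvRing S' R)) = 0 ↔
      ∃ b, a = c * b := by
  constructor
  · intro h
    obtain ⟨w, hw⟩ := exists_eq_smul_of_lTensor_eq_zero (R := R)
      (π := Submodule.mkQ (LinearMap.range (LinearMap.lsmul (InvRing S' R) (InvRing S' R) c)))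
      (Submodule.mkQ_surjective _) (r := c) (fun x hx => ModSMul.mk_eq_zero.1 hx)
      (x := a ⊗ₜ 1) h
    have := congrArg (TensorProduct.rid (InvRing S' R) R) hw
    rw [TensorProduct.rid_tmul, one_smul, map_smul] at this
    exact ⟨_, this⟩
  · rintro ⟨b, rfl⟩
    change (c • b) ⊗ₜ _ = _
    have h : c • (Submodule.Quotient.mk 1 : ModSMul c (InvRing S' R)) = 0 :=
      ModSMul.mk_eq_zero.2 ⟨1, rfl⟩
    rw [TensorProduct.smul_tmul, h, TensorProduct.tmul_zero]

variable {r : InvRing S' R} [IsDevissageSetup S (r : R)]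

lemma exists_of_cocycle_quotient
    (hH1 : Subsingleton (MonoidH1 S' (R ⧸ Ideal.span {(r : R)})))
    {f : S' → R ⧸ Ideal.span {(r : R)}} (hf : ∀ s t, f (s * t) = f s + s • f t) :
    ∃ a, ∀ s, f s = s • a - a := by
  have h : QuotientAddGroup.mk (⟨f, hf⟩ : oneCocycles S' (R ⧸ Ideal.span {(r : R)})) =
    (0 : MonoidH1 S' (R ⧸ Ideal.span {(r : R)})) := Subsingleton.elim _ _
  exact (QuotientAddGroup.eq_zero_iff _).1 h

lemma exists_of_cocycle_modulo
    (hH1 : Subsingleton (MonoidH1 S' (R ⧸ Ideal.span {(r : R)})))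
    {f : S' → R} (hf : ∀ s t, ∃ y, f (s * t) = f s + (s : S) • f t + r * y) :
    ∃ a, ∀ s, ∃ y, f s = (s : S) • a - a + r * y := by
  obtain ⟨a, ha⟩ := exists_of_cocycle_quotient hH1
    (f := fun s => Ideal.Quotient.mk (Ideal.span {(r : R)}) (f s)) fun s t => by
      obtain ⟨y, hy⟩ := hf s t
      change _ = Ideal.Quotient.mk _ (f s) + Ideal.Quotient.mk _ ((s : S) • f t)
      rw [← map_add, Ideal.Quotient.mk_eq_mk_iff_sub_mem, Ideal.mem_span_singleton]
      exact ⟨y, by rw [hy]; ring⟩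
  obtain ⟨a, rfl⟩ := Ideal.Quotient.mk_surjective a
  refine ⟨a, fun s => ?_⟩
  have := ha s
  change _ = Ideal.Quotient.mk _ ((s : S) • a) - Ideal.Quotient.mk _ a at this
  rw [← map_sub, Ideal.Quotient.mk_eq_mk_iff_sub_mem, Ideal.mem_span_singleton] at this
  obtain ⟨y, hy⟩ := this
  exact ⟨y, by rw [← hy]; ring⟩

/-- H¹(S', R) = 0, deduced from H¹(S', R/r) = 0 by completeness. -/
lemma exists_of_cocycle (hH1 : Subsingleton (MonoidH1 S' (R ⧸ Ideal.span {(r : R)})))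
    {f : S' → R} (hf : ∀ s t, f (s * t) = f s + (s : S) • f t) :
    ∃ a, ∀ s : S', f s = (s : S) • a - a := by
  have hc := IsDevissageSetup.complete (S := S) (r := (r : R))
  exact H1Vanishes.of_modulo (τ := DistribMulAction.toAddMonoidEnd S' R) (r := (r : R))
    (IsDevissageSetup.torsionFree S) isAdicSeparated_self hasAdicLimits_self
    (fun s x => by
      have := smul_pow_mul r s.2 1 x
      rw [pow_one] at this
      exact this)
    (fun f hf => exists_of_cocycle_modulo hH1 fun s t => ⟨0, by
      rw [mul_zero, add_zero]; exact hf s t⟩) f hf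

lemma H1Vanishes.induced_quotient (hH1 : Subsingleton (MonoidH1 S' (R ⧸ Ideal.span {(r : R)}))) :
    H1Vanishes (inducedAct (S' := S') (R := R) (InvRing S' R ⧸ Ideal.span {r})) := by
  have hr : (Ideal.span {r} : Submodule (InvRing S' R) (InvRing S' R)) =
      LinearMap.range (LinearMap.lsmul (InvRing S' R) (InvRing S' R) r) := by
    ext x
    rw [Ideal.mem_span_singleton']
    exact ⟨fun ⟨a, h⟩ => ⟨a, by rw [← h, mul_comm]; rfl⟩, fun ⟨a, h⟩ => ⟨a, by
      rw [← h, mul_comm]; rfl⟩⟩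
  suffices h : H1Vanishes (inducedAct (S' := S') (R := R) (ModSMul r (InvRing S' R))) from
    h.induced_of_retract (i := (Submodule.quotEquivOfEq _ _ hr).toLinearMap)
      (p := (Submodule.quotEquivOfEq _ _ hr).symm.toLinearMap)
      fun x => LinearEquiv.symm_apply_apply _ x
  intro f hf
  choose g hg using fun s => tmul_mk_eq r (f s)
  obtain ⟨a, ha⟩ := exists_of_cocycle_modulo hH1 (f := g) fun s t => by
    have h : (g (s * t) - (g s + (s : S) • g t)) ⊗ₜ[InvRing S' R]
        (Submodule.Quotient.mk 1 : ModSMul r (InvRing S' R)) = 0 := by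
      rw [TensorProduct.sub_tmul, TensorProduct.add_tmul, ← inducedAct_tmul, ← hg, ← hg, ← hg, hf,
        sub_self]
    obtain ⟨y, hy⟩ := tmul_mk_eq_zero_iff.1 h
    exact ⟨y, by rw [← hy]; ring⟩
  refine ⟨a ⊗ₜ Submodule.Quotient.mk 1, fun s => ?_⟩
  obtain ⟨y, hy⟩ := ha s
  rw [hg, hy, TensorProduct.add_tmul, tmul_mk_eq_zero_iff.2 ⟨y, rfl⟩, add_zero,
    TensorProduct.sub_tmul, inducedAct_tmul]

lemma H1Vanishes.induced_of_isProjectiveModulo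
    (hH1 : Subsingleton (MonoidH1 S' (R ⧸ Ideal.span {(r : R)})))
    {G : Type u} [AddCommGroup G] [Module (InvRing S' R) G] (hG : ∀ x : G, r • x = 0)
    (h : IsProjectiveModulo r G) : H1Vanishes (inducedAct (S' := S') (R := R) G) := by
  obtain ⟨n, i, p, hip⟩ := exists_retract_of_isProjectiveModulo hG h
  exact (H1Vanishes.induced_pi fun _ => .induced_quotient hH1).induced_of_retract hip

/-- This is (R/c)^{S'} = R^{S'}/c. Injectivity is the saturation of R^{S'} in R. For surjectivity
with c = r ^ (m+1), if a is invariant modulo c then (s • a − a)/c is a cocycle in R, hence the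
coboundary of some b, and a − c b is an invariant representative. -/
lemma IsInvariantsOfInduced.modSMul_self
    (hH1 : Subsingleton (MonoidH1 S' (R ⧸ Ideal.span {(r : R)})))
    {c : InvRing S' R} (hc : c = 0 ∨ ∃ m : ℕ, c = r ^ (m + 1)) :
    IsInvariantsOfInduced S' R (ModSMul c (InvRing S' R)) := by
  have hc1 : ∀ a : R, ((c : R) * a) ∈ InvRing S' R → ∃ b : InvRing S' R, (c : R) * a = c * b := by
    intro a ha
    rcases hc with rfl | ⟨m, rfl⟩
    · exact ⟨0, by simp⟩
    · exact ⟨⟨a, mem_invRing_of_pow_mul_mem r (m + 1) ha⟩, rfl⟩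
  have hc2 : ∀ a : R, (∀ s : S', ∃ b, (s : S) • a - a = c * b) →
      ∃ (a₀ : InvRing S' R) (b : R), a = a₀ + c * b := by
    intro a ha
    rcases hc with rfl | ⟨m, rfl⟩
    · refine ⟨⟨a, (mem_invRing S').2 fun s hs => ?_⟩, 0, by simp⟩
      obtain ⟨b, hb⟩ := ha ⟨s, hs⟩
      rw [ZeroMemClass.coe_zero, zero_mul] at hb
      exact sub_eq_zero.1 hb
    · choose f hf using ha
      have hcoc : ∀ s t, f (s * t) = f s + (s : S) • f t := by
        intro s t
        refine sub_eq_zero.1 (IsDevissageSetup.eq_zero_of_pow_mul S (r : R) (m + 1) ?_)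
        have h1 := hf (s * t)
        have h2 := hf s
        have h3 := hf t
        rw [SubmonoidClass.coe_pow] at h1 h2 h3
        rw [mul_sub, mul_add, ← h1, ← smul_pow_mul r s.2, ← h2, ← h3, smul_sub, Submonoid.coe_mul,
          mul_smul]
        ring
      obtain ⟨b, hb⟩ := exists_of_cocycle hH1 hcoc
      refine ⟨⟨a - (r : R) ^ (m + 1) * b, (mem_invRing S').2 fun s hs => ?_⟩, b, by simp⟩
      have h1 := hf ⟨s, hs⟩
      rw [hb, SubmonoidClass.coe_pow] at h1
      rw [smul_sub, smul_pow_mul r hs]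
      linear_combination h1
  refine ⟨fun x hx => ?_, fun y hy => ?_⟩
  · obtain ⟨x, rfl⟩ := Submodule.mkQ_surjective _ x
    have h1 : (x : R) ⊗ₜ[InvRing S' R] (Submodule.Quotient.mk 1 : ModSMul c (InvRing S' R)) = 0 := by
      rw [← hx, show (x : R) = x • (1 : R) from (mul_one (x : R)).symm, TensorProduct.smul_tmul,
        ← Submodule.Quotient.mk_smul, smul_eq_mul, mul_one]
      rfl
    obtain ⟨b, hb⟩ := tmul_mk_eq_zero_iff.1 h1
    obtain ⟨b', hb'⟩ := hc1 b (hb ▸ x.2)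
    exact ModSMul.mk_eq_zero.2 ⟨b', Subtype.ext (hb.trans hb')⟩
  · obtain ⟨a, rfl⟩ := tmul_mk_eq c y
    obtain ⟨a₀, b, rfl⟩ := hc2 a fun s => by
      rw [← tmul_mk_eq_zero_iff (S' := S'), TensorProduct.sub_tmul, ← inducedAct_tmul, hy, sub_self]
    refine ⟨Submodule.Quotient.mk a₀, ?_⟩
    rw [TensorProduct.add_tmul, tmul_mk_eq_zero_iff.2 ⟨b, rfl⟩, add_zero,
      show (a₀ : R) = a₀ • (1 : R) from (mul_one (a₀ : R)).symm, TensorProduct.smul_tmul,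
      ← Submodule.Quotient.mk_smul, smul_eq_mul, mul_one]

lemma IsInvariantsOfInduced.modSMul
    (hH1 : Subsingleton (MonoidH1 S' (R ⧸ Ideal.span {(r : R)})))
    {P : Type u} [AddCommGroup P] [Module (InvRing S' R) P] {c : InvRing S' R}
    (h : IsElementaryPair r P c) : IsInvariantsOfInduced S' R (ModSMul c P) := by
  have := h.finite
  have := h.projective
  obtain ⟨n, i, p, hip⟩ := exists_retract_modSMul P c
  exact (IsInvariantsOfInduced.pi fun _ => .modSMul_self hH1 h.eq).of_retract hip

lemma IsInvariantsOfInduced.of_equiv {X Y : Type u} [AddCommGroup X] [Module (InvRing S' R) X]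
    [AddCommGroup Y] [Module (InvRing S' R) Y] (e : X ≃ₗ[InvRing S' R] Y)
    (h : IsInvariantsOfInduced S' R X) : IsInvariantsOfInduced S' R Y :=
  h.of_retract (i := e.symm.toLinearMap) (p := e.toLinearMap) e.apply_symm_apply

lemma IsInvariantsOfInduced.of_isElementary
    (hH1 : Subsingleton (MonoidH1 S' (R ⧸ Ideal.span {(r : R)})))
    {M : Type u} [AddCommGroup M] [Module (InvRing S' R) M]
    (hM : IsElementary r M) : IsInvariantsOfInduced S' R M := by
  obtain ⟨ι, _, P, c, hP, ⟨e⟩⟩ := hM.exists_equiv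
  exact (IsInvariantsOfInduced.pi fun i => .modSMul hH1 (hP i)).of_equiv e

lemma IsInvariantsOfInduced.tensorProduct
    (hH1 : Subsingleton (MonoidH1 S' (R ⧸ Ideal.span {(r : R)})))
    {M N : Type u} [AddCommGroup M] [Module (InvRing S' R) M] [AddCommGroup N]
    [Module (InvRing S' R) N] (hM : IsElementary r M) (hN : IsElementary r N) :
    IsInvariantsOfInduced S' R (M ⊗[InvRing S' R] N) :=
  IsElementary.tensorProduct_induction (fun M _ _ => IsInvariantsOfInduced S' R M)
    (fun _ _ _ _ _ _ e h => h.of_equiv e) (fun _ _ _ _ _ h => .pi h)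
    (fun _ _ _ _ h => .modSMul hH1 h) hM hN

end Induced

/-- Descent needs both sides of the linearisation to be killed by r. For A' ⊗ G this comes from r =
v σ(s), as σ(s) crosses the tensor sign and s kills G. -/
lemma linearisation_bijective_of_lTensor_bijective {A A' R : Type u} [CommRing A] [CommRing A']
    [CommRing R] [Algebra A' R] {σ : A →+* A'} {s : A} {r v : A'} {ρ : R} (hv : r = v * σ s)
    {f : (A' ⧸ Ideal.span {r}) →+* (R ⧸ Ideal.span {ρ})} (hff : f.FaithfullyFlat)
    (hf : ∀ a, f (Ideal.Quotient.mk _ a) = Ideal.Quotient.mk _ (algebraMap A' R a))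
    {G G' : Type u} [AddCommGroup G] [Module A G] [AddCommGroup G'] [Module A' G']
    (hG : ∀ x : G, s • x = 0) (hG' : ∀ x : G', r • x = 0) {l : G →ₛₗ[σ] G'}
    (h : letI := σ.toAlgebra
      Function.Bijective ((linearisation l).lTensor (R ⧸ Ideal.span {ρ}))) :
    Function.Bijective (linearisation l) := by
  let := σ.toAlgebra
  have hX : ∀ x : A' ⊗[A] G, r • x = 0 := by
    intro x
    induction x using TensorProduct.induction_on with
    | zero => exact smul_zero r
    | tmul a g =>
      have : r * a = s • (v * a) := by
        rw [Algebra.smul_def, hv]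
        change v * σ s * a = σ s * (v * a)
        ring
      rw [TensorProduct.smul_tmul', smul_eq_mul, this, TensorProduct.smul_tmul, hG,
        TensorProduct.tmul_zero]
    | add x y hx hy => rw [smul_add, hx, hy, add_zero]
  exact ⟨injective_of_lTensor_injective hff hf hX hG' _ h.1,
    surjective_of_lTensor_surjective hff hf hX hG' _ h.2⟩

section

variable {A R : Type u} [CommRing A] [CommRing R] [Algebra A R] {r : A} {ρ : R}
  {G Y : Type u} [AddCommGroup G] [Module A G] [AddCommGroup Y] [Module R Y] [Module A Y]
  [IsScalarTower A R Y] [Module (R ⧸ Ideal.span {ρ}) Y] [IsScalarTower R (R ⧸ Ideal.span {ρ}) Y]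

lemma liftBaseChange_quotient_bijective (hρ : algebraMap A R r = ρ) (hG : ∀ x : G, r • x = 0)
    {c : G →ₗ[A] Y} (hc : Function.Bijective (c.liftBaseChange R)) :
    haveI : IsScalarTower A (R ⧸ Ideal.span {ρ}) Y := .to₁₃₄ A R _ Y
    Function.Bijective (c.liftBaseChange (R ⧸ Ideal.span {ρ})) := by
  have : IsScalarTower A (R ⧸ Ideal.span {ρ}) Y := .to₁₃₄ A R _ Y
  refine (Function.Bijective.of_comp_iff _ (rTensor_mk_bijective hρ hG)).1 ?_
  convert hc using 1
  funext z
  change c.liftBaseChange (R ⧸ Ideal.span {ρ}) (AlgebraTensorModule.rTensor A G _ z) =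
    c.liftBaseChange R z
  induction z using TensorProduct.induction_on with
  | zero => simp
  | tmul a x =>
    rw [AlgebraTensorModule.rTensor_tmul, LinearMap.liftBaseChange_tmul,
      LinearMap.liftBaseChange_tmul]
    change ((Ideal.Quotient.mk _ a : R ⧸ Ideal.span {ρ})) • c x = _
    rw [← one_smul (R ⧸ Ideal.span {ρ}) (c x), ← smul_assoc a, one_smul, Algebra.smul_def, mul_one]
    rfl
  | add x y hx hy => simp only [map_add, hx, hy]

variable {f : (A ⧸ Ideal.span {r}) →+* (R ⧸ Ideal.span {ρ})}

lemma IsProjectiveModulo.of_liftBaseChange_bijective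
    (hff : f.FaithfullyFlat)
    (hf : ∀ a, f (Ideal.Quotient.mk _ a) = Ideal.Quotient.mk _ (algebraMap A R a))
    (hρ : algebraMap A R r = ρ) (hG : ∀ x : G, r • x = 0)
    {c : G →ₗ[A] Y} (hc : Function.Bijective (c.liftBaseChange R))
    (hY : IsFiniteProjectiveOfConstantRank (R ⧸ Ideal.span {ρ}) Y) : IsProjectiveModulo r G := by
  have : IsScalarTower A (R ⧸ Ideal.span {ρ}) Y := .to₁₃₄ A R _ Y
  exact .of_tensorProduct hff hf hG
    (hY.of_equiv (LinearEquiv.ofBijective _ (liftBaseChange_quotient_bijective hρ hG hc)).symm)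

lemma linearisation_bijective_of_liftBaseChange_bijective
    (hff : f.FaithfullyFlat)
    (hf : ∀ a, f (Ideal.Quotient.mk _ a) = Ideal.Quotient.mk _ (algebraMap A R a))
    (hρ : algebraMap A R r = ρ) (hG : ∀ x : G, r • x = 0)
    {c : G →ₗ[A] Y} (hc : Function.Bijective (c.liftBaseChange R))
    {σ : A →+* A} {v : A} (hv : r = v * σ r) {φ : (R ⧸ Ideal.span {ρ}) →+* (R ⧸ Ideal.span {ρ})}
    (hφ : ∀ a, φ (algebraMap A _ a) = algebraMap A _ (σ a)) {l : G →ₛₗ[σ] G} {F : Y →ₛₗ[φ] Y}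
    (h : ∀ g, F (c g) = c (l g)) (hF : Function.Bijective (linearisation F)) :
    Function.Bijective (linearisation l) := by
  have : IsScalarTower A (R ⧸ Ideal.span {ρ}) Y := .to₁₃₄ A R _ Y
  have hk := liftBaseChange_quotient_bijective hρ hG hc
  exact linearisation_bijective_of_lTensor_bijective hv hff hf hG hG
    (lTensor_linearisation_bijective hφ h hk hk hF)

end

namespace SModule

/-! ### Reduction modulo `r` and the submodule `r D` -/

variable {S : Type w} [Monoid S] {R : Type u} [CommRing R] [MulSemiringAction S R]

section

variable {S' : Submonoid S}

/-- The action of `S'` on `D`. -/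
abbrev subAct (D : SModule.{w, u} S R) (S' : Submonoid S) : S' →* AddMonoid.End D :=
  D.φ.comp S'.subtype

lemma liftBaseChange_inducedAct {D : SModule.{w, u} S R} {X : Type u} [AddCommGroup X]
    [Module (InvRing S' R) X] {c : X →ₗ[InvRing S' R] D} (hc : ∀ x, c x ∈ D.invariants S')
    (s : S') (z : R ⊗[InvRing S' R] X) :
    c.liftBaseChange R (inducedAct X s z) = D.φ s (c.liftBaseChange R z) := by
  induction z using TensorProduct.induction_on with
  | zero => simp
  | tmul a x =>
    rw [inducedAct_tmul, LinearMap.liftBaseChange_tmul, LinearMap.liftBaseChange_tmul, D.φ_smul,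
      hc x s s.2]
  | add x y hx hy => simp only [map_add, hx, hy]

/-- To recognise D^{S'}, it suffices to find invariant elements, parametrised by X, with R ⊗ X ≅ D:
the isomorphism respects S', and X is all the invariants of R ⊗ X. This is used for D itself in the
torsion-free case and for tensor products. -/
lemma exists_equiv_invariants {D : SModule.{w, u} S R} {X : Type u} [AddCommGroup X]
    [Module (InvRing S' R) X] {c : X →ₗ[InvRing S' R] D} (hc : ∀ x, c x ∈ D.invariants S')
    (hb : Function.Bijective (c.liftBaseChange R)) (hX : IsInvariantsOfInduced S' R X) :
    ∃ e : X ≃ₗ[InvRing S' R] D.invariants S', ∀ x, (e x : D) = c x := by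
  have h1 : ∀ x, c.liftBaseChange R ((1 : R) ⊗ₜ x) = c x := fun x => by
    rw [LinearMap.liftBaseChange_tmul, one_smul]
  refine ⟨LinearEquiv.ofBijective (c.codRestrict _ hc) ⟨?_, fun d => ?_⟩, fun x => rfl⟩
  · rw [injective_iff_map_eq_zero]
    intro x hx
    refine hX.1 x (hb.1 ?_)
    rw [h1, map_zero]
    exact congrArg Subtype.val hx
  · obtain ⟨z, hz⟩ := hb.2 d
    obtain ⟨x, rfl⟩ := hX.2 z fun s => hb.1 <| by
      rw [liftBaseChange_inducedAct hc, hz, d.2 s s.2]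
    exact ⟨x, Subtype.ext ((h1 x).symm.trans hz)⟩

lemma comparison_bijective_of_equiv {D : SModule.{w, u} S R} {X : Type u} [AddCommGroup X]
    [Module (InvRing S' R) X] {c : X →ₗ[InvRing S' R] D}
    (hb : Function.Bijective (c.liftBaseChange R)) (e : X ≃ₗ[InvRing S' R] D.invariants S')
    (he : ∀ x, (e x : D) = c x) : Function.Bijective (D.comparison S') := by
  have : ∀ z, D.comparison S' (e.lTensor R z) = c.liftBaseChange R z := by
    intro z
    induction z using TensorProduct.induction_on with
    | zero => simp
    | tmul a x =>
      change a • ((e x : D.invariants S') : D) = a • c x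
      rw [he]
    | add x y hx hy => simp only [map_add, hx, hy]
  refine (Function.Bijective.of_comp_iff _ (e.lTensor R).bijective).1 ?_
  convert hb using 1
  exact funext this

end

section

variable (r : R) [IsDevissageSetup S r]

lemma exists_smul_eq (s : S) : ∃ u : R, s • r = r * u := by
  have : s • r ∈ Ideal.span {r} := by
    rw [← IsDevissageSetup.span_smul (r := r) s]
    exact Ideal.mem_span_singleton_self _
  obtain ⟨u, hu⟩ := Ideal.mem_span_singleton.1 this
  exact ⟨u, hu⟩

lemma exists_eq_mul_smul (s : S) : ∃ u : R, r = u * s • r := by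
  have : r ∈ Ideal.span {s • r} := by
    rw [IsDevissageSetup.span_smul (r := r) s]
    exact Ideal.mem_span_singleton_self _
  obtain ⟨u, hu⟩ := Ideal.mem_span_singleton.1 this
  exact ⟨u, hu.trans (mul_comm _ _)⟩

lemma exists_φ_smul (D : SModule.{w, u} S R) (s : S) :
    ∃ u : R, ∀ d : D, D.φ s (r • d) = r • u • D.φ s d := by
  obtain ⟨u, hu⟩ := exists_smul_eq r s
  exact ⟨u, fun d => by rw [D.φ_smul, hu, mul_smul]⟩

lemma φ_mem_powSubmodule_one (D : SModule.{w, u} S R) (s : S) {d : D}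
    (hd : d ∈ powSubmodule r D 1) : D.φ s d ∈ powSubmodule r D 1 := by
  obtain ⟨u, hu⟩ := exists_φ_smul r D s
  obtain ⟨y, rfl⟩ := mem_powSubmodule.1 hd
  exact mem_powSubmodule.2 ⟨u • D.φ s y, by rw [pow_one, hu]⟩

/-- The `S`-submodule `r D`. -/
abbrev powObj (D : SModule.{w, u} S R) : SModule.{w, u} S R where
  carrier := powSubmodule r D 1
  φ :=
    { toFun := fun s =>
        { toFun := fun d => ⟨D.φ s d, φ_mem_powSubmodule_one r D s d.2⟩
          map_zero' := Subtype.ext (map_zero (D.φ s))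
          map_add' := fun d e => Subtype.ext (map_add (D.φ s) (d : D) (e : D)) }
      map_one' := by ext d; exact D.φ_one_apply d
      map_mul' := fun s t => by ext d; exact D.φ_mul_apply s t d }
  φ_smul s a d := Subtype.ext (D.φ_smul s a (d : D))

/-- With r = u φ_s(r), one has r φ_s(y) = u φ_s(r y), so generators of D of the form φ_s(y) yield
such generators of rD. -/
lemma linearisation_powObj_surjective {D : SModule.{w, u} S R} {s : S}
    (h : Function.Surjective (linearisation (D.act s))) :
    Function.Surjective (linearisation ((D.powObj r).act s)) := by
  rw [linearisation_surjective_iff, eq_top_iff] at h ⊢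
  rintro ⟨_, d, rfl⟩ -
  obtain ⟨u, hu⟩ := exists_eq_mul_smul r s
  let l : D →ₗ[R] D.powObj r := (LinearMap.lsmul R D (r ^ 1)).rangeRestrict
  change l d ∈ _
  have hd : d ∈ Submodule.span R (Set.range (D.act s)) := h trivial
  induction hd using Submodule.span_induction with
  | mem x hx =>
    obtain ⟨y, rfl⟩ := hx
    have : l (D.act s y) = u • (D.powObj r).act s (l y) := Subtype.ext <| by
      change r ^ 1 • D.φ s y = u • D.φ s (r ^ 1 • y)
      rw [pow_one, D.φ_smul, ← mul_smul, ← hu]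
    rw [this]
    exact Submodule.smul_mem _ _ (Submodule.subset_span ⟨_, rfl⟩)
  | zero => rw [map_zero]; exact zero_mem _
  | add x y _ _ hx hy => rw [map_add]; exact add_mem hx hy
  | smul a x _ hx => rw [map_smul]; exact Submodule.smul_mem _ _ hx

lemma smul_top_le_comap (D : SModule.{w, u} S R) (s : S) :
    (Ideal.span {r} • ⊤ : Submodule R D) ≤ (Ideal.span {r} • ⊤ : Submodule R D).comap (D.act s) := by
  intro d hd
  obtain ⟨y, rfl⟩ := (mem_span_singleton_smul_top r).1 hd
  obtain ⟨u, hu⟩ := exists_φ_smul r D s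
  exact (mem_span_singleton_smul_top r).2 ⟨_, hu y⟩

/-- The `S`-module `D / r D` over `R / r`. -/
abbrev redObj (D : SModule.{w, u} S R) : SModule.{w, u} S (R ⧸ Ideal.span {r}) where
  carrier := D ⧸ (Ideal.span {r} • ⊤ : Submodule R D)
  φ :=
    { toFun := fun s => (Submodule.mapQ _ _ (D.act s) (smul_top_le_comap r D s)).toAddMonoidHom
      map_one' := by
        ext d
        obtain ⟨d, rfl⟩ := Submodule.Quotient.mk_surjective _ d
        exact congrArg Submodule.Quotient.mk (D.φ_one_apply d)
      map_mul' := fun s t => by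
        ext d
        obtain ⟨d, rfl⟩ := Submodule.Quotient.mk_surjective _ d
        exact congrArg Submodule.Quotient.mk (D.φ_mul_apply s t d) }
  φ_smul s a d := by
    obtain ⟨d, rfl⟩ := Submodule.Quotient.mk_surjective _ d
    obtain ⟨a, rfl⟩ := Ideal.Quotient.mk_surjective a
    exact congrArg Submodule.Quotient.mk (D.φ_smul s a d)

/-- The linearisation of D/rD is a surjection between projective modules of the same constant rank,
hence bijective. So a surjective linearisation on D is enough. -/
lemma isEtaleProj_redObj {D : SModule.{w, u} S R} (h : IsProjectiveModulo r D)
    (hD : ∀ s, Function.Surjective (linearisation (D.act s))) : (D.redObj r).IsEtaleProj := by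
  have h' := h
  obtain ⟨h1, h2, n, hn⟩ := h'
  refine ⟨⟨Module.finitePresentation_of_projective _ _, fun s => ?_⟩, h⟩
  refine linearisation_bijective_of_surjective ?_ h1 h2 h1 h2 hn hn
  have hs := hD s
  rw [linearisation_surjective_iff, eq_top_iff] at hs ⊢
  rintro d -
  obtain ⟨d, rfl⟩ := Submodule.Quotient.mk_surjective _ d
  have hd : d ∈ Submodule.span R (Set.range (D.act s)) := hs trivial
  induction hd using Submodule.span_induction with
  | mem x hx =>
    obtain ⟨y, rfl⟩ := hx
    exact Submodule.subset_span ⟨Submodule.Quotient.mk y, rfl⟩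
  | zero => exact zero_mem _
  | add x y _ _ hx hy => exact add_mem hx hy
  | smul a x _ hx => exact Submodule.smul_mem _ (Ideal.Quotient.mk _ a) hx

/-- `D / r D` as an `S`-module over `R`. -/
abbrev quotObj (D : SModule.{w, u} S R) : SModule.{w, u} S R :=
  (D.redObj r).restrictScalars (quotientHom S r)

/-- The projection `D → D / r D`. -/
def quotMk (D : SModule.{w, u} S R) : D ⟶ D.quotObj r where
  lin :=
    { toFun := fun d => (Submodule.Quotient.mk d : D ⧸ (Ideal.span {r} • ⊤ : Submodule R D))
      map_add' := fun _ _ => rfl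
      map_smul' := fun _ _ => rfl }
  comm _ _ := rfl

lemma quotMk_surjective (D : SModule.{w, u} S R) : Function.Surjective (D.quotMk r).lin :=
  Submodule.Quotient.mk_surjective _

lemma quotMk_eq_zero {D : SModule.{w, u} S R} {d : D} :
    (D.quotMk r).lin d = 0 ↔ ∃ y, d = r • y :=
  (Submodule.Quotient.mk_eq_zero _).trans (mem_span_singleton_smul_top r)

end

/-! ### Descent for modules killed by r -/

section

variable {S' : Submonoid S} [IsNormalSubmonoid S']

variable (S') in
/-- `D` satisfies descent along `S'`: the comparison morphism is an isomorphism, `H¹(S', D) = 0`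
and the linearisations of `D^{S'}` are isomorphisms. -/
structure SatisfiesDescent (D : SModule.{w, u} S R) : Prop where
  comparison : Function.Bijective (D.comparison S')
  h1 : H1Vanishes (D.subAct S')
  linearisation : ∀ q, Function.Bijective (linearisation ((D.invObj S').act q))

variable {r : InvRing S' R} [IsDevissageSetup S (r : R)]

/-- By comparison, Y is the base change of Y^{S'} along A/r → R/r, so projectivity and bijectivity
of linearisations descend, and H¹ vanishes for a direct summand of a finite free module. The maps F
are the φ_s read over R/r: it is the linearisation over R/r that is assumed bijective. -/
lemma satisfiesDescent_of_quotient (hff : (invQuotientMap S' r).FaithfullyFlat)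
    (hH1 : Subsingleton (MonoidH1 S' (R ⧸ Ideal.span {(r : R)})))
    {Y : SModule.{w, u} S R} [Module (R ⧸ Ideal.span {(r : R)}) Y]
    [IsScalarTower R (R ⧸ Ideal.span {(r : R)}) Y]
    (hY : IsFiniteProjectiveOfConstantRank (R ⧸ Ideal.span {(r : R)}) Y)
    (hlin : ∀ s, ∃ F : Y →ₛₗ[MulSemiringAction.toRingHom S (R ⧸ Ideal.span {(r : R)}) s] Y,
      (∀ y, F y = Y.φ s y) ∧ Function.Bijective (_root_.linearisation F))
    (hc : Function.Bijective (Y.comparison S')) :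
    Y.SatisfiesDescent S' ∧ IsProjectiveModulo r (Y.invariants S') := by
  have hr : ∀ g : Y.invariants S', r • g = 0 := fun g =>
    Subtype.ext (smul_eq_zero_of_quotient (r := (r : R)) (g : Y))
  have hG : IsProjectiveModulo r (Y.invariants S') :=
    .of_liftBaseChange_bijective hff (fun _ => rfl) rfl hr hc hY
  refine ⟨⟨hc, ?_, fun q => ?_⟩, hG⟩
  · refine (H1Vanishes.induced_of_isProjectiveModulo hH1 hr hG).of_equiv
      (LinearEquiv.ofBijective _ hc).toAddEquiv fun s x => ?_
    exact liftBaseChange_inducedAct (c := (Y.invariants S').subtype) (fun x => x.2) s x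
  · have hd : IsDevissageSetup (QuotMonoid S') r := isDevissageSetup_invRing r
    obtain ⟨v, hv⟩ := exists_eq_mul_smul r q
    induction q using Con.induction_on with
    | H s =>
      obtain ⟨F, hF, hb⟩ := hlin s
      exact linearisation_bijective_of_liftBaseChange_bijective hff (fun _ => rfl) rfl hr hc hv
        (fun _ => rfl) (fun g => hF g) hb

lemma satisfiesDescent_restrictScalars (hff : (invQuotientMap S' r).FaithfullyFlat)
    (hH1 : Subsingleton (MonoidH1 S' (R ⧸ Ideal.span {(r : R)})))
    {Z : SModule.{w, u} S (R ⧸ Ideal.span {(r : R)})} (hZ : Z.IsEtaleProj)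
    (hc : Function.Bijective ((Z.restrictScalars (quotientHom S (r : R))).comparison S')) :
    (Z.restrictScalars (quotientHom S (r : R))).SatisfiesDescent S' ∧
      IsProjectiveModulo r ((Z.restrictScalars (quotientHom S (r : R))).invariants S') := by
  let : Module (R ⧸ Ideal.span {(r : R)}) (Z.restrictScalars (quotientHom S (r : R))) :=
    Z.isModule
  have : IsScalarTower R (R ⧸ Ideal.span {(r : R)}) (Z.restrictScalars (quotientHom S (r : R))) :=
    ⟨fun a b y => mul_smul (Ideal.Quotient.mk _ a) b (y : Z)⟩
  exact satisfiesDescent_of_quotient hff hH1 hZ.2 (fun s => ⟨Z.act s, fun _ => rfl, hZ.1.2 s⟩) hc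

end

end SModule

lemma IsProjectiveModulo.finitePresentation {A : Type u} [CommRing A] {r : A} {G : Type u}
    [AddCommGroup G] [Module A G] (hG : ∀ x : G, r • x = 0) (h : IsProjectiveModulo r G) :
    Module.FinitePresentation A G := by
  let := moduleOfSMulEqZero hG
  have := isScalarTower_moduleOfSMulEqZero hG
  obtain ⟨_, _, -⟩ := isProjectiveModulo_iff_of_quotient.1 h
  have : Module.FinitePresentation (A ⧸ Ideal.span {r}) G :=
    Module.finitePresentation_of_projective _ _
  have : Module.FinitePresentation A (A ⧸ Ideal.span {r}) :=
    Module.finitePresentation_of_surjective (Submodule.mkQ (Ideal.span {r}))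
      (Submodule.mkQ_surjective _) (by rw [Submodule.ker_mkQ]; exact ⟨{r}, by simp⟩)
  exact .trans (R := A) G (A ⧸ Ideal.span {r})

lemma HasDevissageOfLength.of_equiv {A : Type u} [CommRing A] {r : A} {N : ℕ} {M M' : Type u}
    [AddCommGroup M] [Module A M] [AddCommGroup M'] [Module A M'] (e : M ≃ₗ[A] M')
    (h : HasDevissageOfLength r N M) : HasDevissageOfLength r N M' := by
  have := h.finite
  induction N generalizing M M' with
  | zero =>
    exact ⟨.equiv e, h.2.1.of_equiv e, fun y hy => e.symm.injective <| by
      rw [map_zero]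
      exact h.2.2 _ (by rw [← map_smul, hy, map_zero])⟩
  | succ N ih =>
    exact ⟨.equiv e, h.2.1.of_equiv e, ih (powSubmoduleCongr e 1) h.2.2 h.2.2.finite⟩

lemma surjective_of_lTensor_surjective_of_algebra {A R : Type u} [CommRing A] [CommRing R]
    [Algebra A R] {r : A} {ρ : R} {f : (A ⧸ Ideal.span {r}) →+* (R ⧸ Ideal.span {ρ})}
    (hff : f.FaithfullyFlat)
    (hf : ∀ a, f (Ideal.Quotient.mk _ a) = Ideal.Quotient.mk _ (algebraMap A R a))
    {X Y : Type u} [AddCommGroup X] [Module A X]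
    [AddCommGroup Y] [Module A Y] (hX : ∀ x : X, r • x = 0) (hY : ∀ y : Y, r • y = 0)
    (h : X →ₗ[A] Y) (H : Function.Surjective (h.lTensor R)) : Function.Surjective h := by
  refine surjective_of_lTensor_surjective hff hf hX hY h fun y => ?_
  let q : R →ₗ[A] R ⧸ Ideal.span {ρ} := (Ideal.Quotient.mkₐ A _).toLinearMap
  obtain ⟨y, rfl⟩ := LinearMap.rTensor_surjective Y (g := q) Ideal.Quotient.mk_surjective y
  obtain ⟨x, rfl⟩ := H y
  refine ⟨q.rTensor X x, ?_⟩
  rw [← LinearMap.comp_apply, ← LinearMap.comp_apply, LinearMap.lTensor_comp_rTensor,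
    LinearMap.rTensor_comp_lTensor]

/-! ### The sequence rD → D → D/rD and its invariants -/

namespace SModule

section

variable {S : Type w} [Monoid S] {R : Type u} [CommRing R] [MulSemiringAction S R] (r : R)
  [IsDevissageSetup S r]

/-- Multiplication by `r`, from `D / r D` to `r D / r² D`. -/
def quotMul (D : SModule.{w, u} S R) :
    D.quotObj r →ₗ[R] (D.powObj r).quotObj r :=
  Submodule.liftQ (Ideal.span {r} • ⊤ : Submodule R D)
    (((D.powObj r).quotMk r).lin ∘ₗ (LinearMap.lsmul R D (r ^ 1)).rangeRestrict) <| by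
    intro x hx
    obtain ⟨y, rfl⟩ := (mem_span_singleton_smul_top r).1 hx
    rw [LinearMap.mem_ker, map_smul]
    exact (quotMk_eq_zero r).2 ⟨_, rfl⟩

end

variable {S : Type w} [Monoid S] {S' : Submonoid S} {R : Type u} [CommRing R]
  [MulSemiringAction S R]

section

variable {r : InvRing S' R}

lemma φ_smul_of_mem (D : SModule.{w, u} S R) {s : S} (hs : s ∈ S') (a : InvRing S' R) (d : D) :
    D.φ s ((a : R) • d) = (a : R) • D.φ s d := by
  rw [D.φ_smul, (mem_invRing S').1 a.2 s hs]

lemma mem_invariants_of_smul_mem {D : SModule.{w, u} S R}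
    (hD : ∀ y : D, (r : R) • y = 0 → y = 0) {y : D} (hy : (r : R) • y ∈ D.invariants S') :
    y ∈ D.invariants S' := fun s hs => by
  rw [← sub_eq_zero]
  refine hD _ ?_
  rw [smul_sub, ← φ_smul_of_mem D hs, hy s hs, sub_self]

variable [IsDevissageSetup S (r : R)]

lemma smul_quotObj (D : SModule.{w, u} S R) (y : D.quotObj (r : R)) : (r : R) • y = 0 := by
  obtain ⟨y, rfl⟩ := quotMk_surjective (r : R) D y
  rw [← map_smul, quotMk_eq_zero]
  exact ⟨y, rfl⟩

lemma smul_invariants_quotObj (D : SModule.{w, u} S R)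
    (y : (D.quotObj (r : R)).invariants S') : r • y = 0 :=
  Subtype.ext (smul_quotObj (r := r) D (y : D.quotObj (r : R)))

/-- Multiplication by `r`, from `(D / r D)^{S'}` to `(r D / r² D)^{S'}`. -/
def invMul (D : SModule.{w, u} S R) :
    (D.quotObj (r : R)).invariants S' →ₗ[InvRing S' R]
      ((D.powObj (r : R)).quotObj (r : R)).invariants S' :=
  ((D.quotMul (r : R)).restrictScalars (InvRing S' R)).restrict fun y hy s hs => by
    obtain ⟨d, rfl⟩ := quotMk_surjective (r : R) D y
    have h : (⟨D.φ s ((r : R) ^ 1 • d), φ_mem_powSubmodule_one _ D s ⟨d, rfl⟩⟩ :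
        powSubmodule (r : R) D 1) = (LinearMap.lsmul R D ((r : R) ^ 1)).rangeRestrict (D.φ s d) :=
      Subtype.ext <| by
        change D.φ s ((r : R) ^ 1 • d) = (r : R) ^ 1 • D.φ s d
        rw [pow_one, φ_smul_of_mem D hs]
    refine (congrArg ((D.powObj (r : R)).quotMk (r : R)).lin h).trans ?_
    change D.quotMul (r : R) ((D.quotMk (r : R)).lin (D.φ s d)) = _
    rw [(D.quotMk (r : R)).comm, hy s hs]
    rfl

/-- Through the comparison isomorphisms the base change to R is the surjection D/rD → rD/r²D, and
surjectivity descends modulo r. -/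
lemma invMul_surjective (hff : (invQuotientMap S' r).FaithfullyFlat) {D : SModule.{w, u} S R}
    (hY : Function.Bijective ((D.quotObj (r : R)).comparison S'))
    (hY' : Function.Bijective (((D.powObj (r : R)).quotObj (r : R)).comparison S')) :
    Function.Surjective (D.invMul (r := r)) := by
  refine surjective_of_lTensor_surjective_of_algebra hff (fun _ => rfl)
    (smul_invariants_quotObj D) (smul_invariants_quotObj (D.powObj (r : R))) _ fun y => ?_
  have key : ∀ z, ((D.powObj (r : R)).quotObj (r : R)).comparison S'
      ((D.invMul (r := r)).lTensor R z) =
        D.quotMul (r : R) ((D.quotObj (r : R)).comparison S' z) := by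
    intro z
    induction z using TensorProduct.induction_on with
    | zero => simp
    | tmul a x => exact ((D.quotMul (r : R)).map_smul a (x : D.quotObj (r : R))).symm
    | add x y hx hy => simp only [map_add, hx, hy]
  obtain ⟨d, hd⟩ := quotMk_surjective (r : R) (D.powObj (r : R))
    (((D.powObj (r : R)).quotObj (r : R)).comparison S' y)
  obtain ⟨d, rfl⟩ := LinearMap.surjective_rangeRestrict _ d
  obtain ⟨z, hz⟩ := hY.2 ((D.quotMk (r : R)).lin d)
  exact ⟨z, hY'.1 <| by rw [key, hz, ← hd]; rfl⟩

/-- Multiplication by r is an isomorphism D → rD that commutes with S', as S' fixes r. -/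
lemma H1Vanishes_powObj {D : SModule.{w, u} S R} (hD : ∀ y : D, (r : R) • y = 0 → y = 0)
    (h : H1Vanishes (D.subAct S')) : H1Vanishes ((D.powObj (r : R)).subAct S') := by
  refine h.of_equiv (AddEquiv.ofBijective
    (LinearMap.lsmul R D ((r : R) ^ 1)).rangeRestrict.toAddMonoidHom ⟨?_, ?_⟩) fun s x => ?_
  · rw [injective_iff_map_eq_zero]
    intro x hx
    have := congrArg Subtype.val hx
    change (r : R) ^ 1 • x = 0 at this
    rw [pow_one] at this
    exact hD x this
  · exact LinearMap.surjective_rangeRestrict _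
  · refine Subtype.ext ?_
    change (r : R) ^ 1 • D.φ s x = D.φ s ((r : R) ^ 1 • x)
    rw [pow_one, φ_smul_of_mem D s.2]

lemma H1Vanishes_of_projective {D : SModule.{w, u} S R} [Module.Finite R D] [Module.Projective R D]
    (h : H1Vanishes ((D.quotObj (r : R)).subAct S')) : H1Vanishes (D.subAct S') := by
  have := IsDevissageSetup.complete (S := S) (r := (r : R))
  refine .of_modulo (r := (r : R))
    (eq_zero_of_smul_eq_zero_of_projective (IsDevissageSetup.torsionFree S) D)
    (isAdicSeparated_of_projective D) (hasAdicLimits_of_finite D)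
    (fun s x => φ_smul_of_mem D s.2 r x) fun f hf => ?_
  obtain ⟨a, ha⟩ := h (fun s => (D.quotMk (r : R)).lin (f s)) fun s t => by
    rw [hf, map_add]
    exact congrArg _ ((D.quotMk (r : R)).comm s (f t))
  obtain ⟨a, rfl⟩ := quotMk_surjective (r : R) D a
  refine ⟨a, fun s => ?_⟩
  obtain ⟨y, hy⟩ := (quotMk_eq_zero (r : R) (d := f s - (D.φ s a - a))).1 <| by
    rw [map_sub, ha, map_sub, (D.quotMk (r : R)).comm]
    exact sub_self _
  exact ⟨y, by rw [← hy]; exact (add_sub_cancel _ _).symm⟩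

/-- An invariant element of `D / r D` lifts to an invariant element of `D` if `H¹(S', r D) = 0`. -/
lemma exists_invariant_lift {D : SModule.{w, u} S R}
    (h : H1Vanishes ((D.powObj (r : R)).subAct S')) {y : D.quotObj (r : R)}
    (hy : y ∈ (D.quotObj (r : R)).invariants S') :
    ∃ x ∈ D.invariants S', (D.quotMk (r : R)).lin x = y := by
  obtain ⟨x, rfl⟩ := quotMk_surjective (r : R) D y
  have hx : ∀ s : S', D.φ s x - x ∈ powSubmodule (r : R) D 1 := fun s => by
    rw [mem_powSubmodule, pow_one, ← quotMk_eq_zero, map_sub, (D.quotMk (r : R)).comm, hy s s.2,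
      sub_self]
  -- For any lift x, the map s ↦ φ_s x − x is a cocycle with values in rD; subtracting a primitive
  -- makes x invariant without changing its class.
  obtain ⟨b, hb⟩ := h (fun s => (⟨D.φ s x - x, hx s⟩ : powSubmodule (r : R) D 1)) fun s t =>
    Subtype.ext <| by
      change D.φ (s * t : S) x - x = D.φ s x - x + D.φ s (D.φ t x - x)
      rw [φ_mul_apply, map_sub]
      abel
  refine ⟨x - b, fun s hs => ?_, ?_⟩
  · have := congrArg Subtype.val (hb ⟨s, hs⟩)
    change D.φ s x - x = D.φ s b - b at this
    rw [map_sub, sub_eq_sub_iff_sub_eq_sub, this]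
  · have h0 : (D.quotMk (r : R)).lin (b : D) = 0 := by
      rw [quotMk_eq_zero]
      obtain ⟨y, hy⟩ := mem_powSubmodule.1 b.2
      exact ⟨y, by rw [hy, pow_one]⟩
    rw [map_sub, h0, sub_zero]

end

/-! ### Descent by induction on the length of the dévissage -/

section

variable [IsNormalSubmonoid S'] (r : InvRing S' R) [IsDevissageSetup S (r : R)]

/-- The projection `D^{S'} → (D / r D)^{S'}`. -/
abbrev invMk (D : SModule.{w, u} S R) :
    D.invariants S' →ₗ[InvRing S' R] (D.quotObj (r : R)).invariants S' :=
  ((invFunctor S').map (D.quotMk (r : R))).lin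

variable {r}

lemma invMk_eq_zero {D : SModule.{w, u} S R} {x : D.invariants S'} :
    D.invMk r x = 0 ↔ ∃ y : D, (x : D) = (r : R) • y :=
  Subtype.ext_iff.trans (quotMk_eq_zero (r : R))

/-- `(D / r D)^{S'}` is `D^{S'} / r D^{S'}`. -/
lemma isBijectiveModulo_invMk {D : SModule.{w, u} S R}
    (h1 : H1Vanishes ((D.powObj (r : R)).subAct S'))
    (h2 : ∀ x ∈ D.invariants S', (∃ y, x = (r : R) • y) → ∃ y ∈ D.invariants S', x = (r : R) • y) :
    Function.Surjective (D.invMk r) ∧ (∀ x, D.invMk r x = 0 → ∃ w, x = r • w) ∧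
      IsBijectiveModulo r (D.invMk r) := by
  have h3 : Function.Surjective (D.invMk r) := fun y => by
    obtain ⟨x, hx, hxy⟩ := exists_invariant_lift h1 y.2
    exact ⟨⟨x, hx⟩, Subtype.ext hxy⟩
  have h4 : ∀ x, D.invMk r x = 0 → ∃ w, x = r • w := fun x hx => by
    obtain ⟨y, hy, hxy⟩ := h2 x x.2 (invMk_eq_zero.1 hx)
    exact ⟨⟨y, hy⟩, Subtype.ext hxy⟩
  refine ⟨h3, h4, .mk_of_surjective h3 fun x z hx => h4 x ?_⟩
  rw [hx, smul_invariants_quotObj]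

variable (S' r) in
/-- The conclusions of descent for modules with dévissage of length `N`. -/
structure SatisfiesDevissageDescent (N : ℕ) (D : SModule.{w, u} S R) : Prop
    extends SatisfiesDescent S' D where
  finitePresentation : Module.FinitePresentation (InvRing S' R) (D.invariants S')
  hasDevissage : HasDevissageOfLength r N (D.invariants S')
  exists_smul : ∀ x ∈ D.invariants S', (∃ y, x = (r : R) • y) →
    ∃ y ∈ D.invariants S', x = (r : R) • y

/-- Finiteness of D^{S'} is not known beforehand. It is obtained by constructing a finite projective
candidate P from (D/rD)^{S'} and proving D^{S'} ≅ P. -/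
lemma satisfiesDevissageDescent_of_torsionFree
    (hH1 : Subsingleton (MonoidH1 S' (R ⧸ Ideal.span {(r : R)})))
    {D : SModule.{w, u} S R} (hD : HasDevissageOfLength (r : R) 0 D)
    (hY : (D.quotObj (r : R)).SatisfiesDescent S')
    (hG : IsProjectiveModulo r ((D.quotObj (r : R)).invariants S')) :
    D.SatisfiesDevissageDescent S' r 0 := by
  have hc := IsDevissageSetup.complete (S := S) (r := (r : R))
  have hcA := isAdicComplete_invRing r
  have hd : IsDevissageSetup (QuotMonoid S') r := isDevissageSetup_invRing r
  obtain ⟨hfin, hmod, htf⟩ := hD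
  have hproj := hmod.projective htf
  have h1 : H1Vanishes (D.subAct S') := H1Vanishes_of_projective hY.h1
  have hsm : ∀ x ∈ D.invariants S', (∃ y, x = (r : R) • y) →
      ∃ y ∈ D.invariants S', x = (r : R) • y := by
    rintro _ hx ⟨y, rfl⟩
    exact ⟨y, mem_invariants_of_smul_mem htf hx, rfl⟩
  obtain ⟨hp, hker, -⟩ := isBijectiveModulo_invMk (H1Vanishes_powObj htf h1) hsm
  -- P lifts (D/rD)^{S'} to R^{S'}, and its map to (D/rD)^{S'} factors through D^{S'} because
  -- invariants lift.
  obtain ⟨P, _, _, g, hP, hP', hg⟩ := hG.exists_lift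
  obtain ⟨c₀, hc₀⟩ := Module.projective_lifting_property (D.invMk r) g hp
  have hgs : Function.Surjective g := fun y => by
    obtain ⟨x, z, h⟩ := hg.surj y
    exact ⟨x, by rw [h, smul_invariants_quotObj, add_zero]⟩
  have hb : Function.Bijective (((D.invariants S').subtype ∘ₗ c₀).liftBaseChange R) :=
    liftBaseChange_bijective_of_modulo (s := r)
      (c' := ((D.quotObj (r : R)).invariants S').subtype) (mul_one (r : R)).symm htf (smul_quotObj D) hgs
      (fun x hx => hg.inj x 0 (by rw [hx, smul_zero]))
      (fun y hy => (quotMk_eq_zero (r : R)).1 hy)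
      (fun x => congrArg Subtype.val (LinearMap.congr_fun hc₀ x)) hY.comparison
  have hPtf := eq_zero_of_smul_eq_zero_of_projective (IsDevissageSetup.torsionFree (QuotMonoid S')
    (r := r)) P
  have hPm : IsProjectiveModulo r P := hg.isProjectiveModulo_iff.2 hG
  obtain ⟨e, he⟩ := exists_equiv_invariants (D := D) (fun x => (c₀ x).2) hb
    (.of_isElementary hH1 (.of_torsionFree hP hPm hPtf))
  have hfin' : Module.Finite (InvRing S' R) (D.invariants S') := .equiv e
  have hproj' : Module.Projective (InvRing S' R) (D.invariants S') := .of_equiv e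
  refine ⟨⟨comparison_bijective_of_equiv hb e he, h1, fun q => ?_⟩,
    Module.finitePresentation_of_projective _ _,
    HasDevissageOfLength.of_equiv (N := 0) e ⟨hP, hPm, hPtf⟩, hsm⟩
  -- Now that D^{S'} is known to be finite projective, its linearisations can be checked modulo r.
  obtain ⟨v, hv⟩ := exists_smul_eq r q
  exact linearisation_bijective_of_modulo (s := r)
    (c' := ((D.quotObj (r : R)).invObj S').act q) hv
    (fun y hy => Subtype.ext (htf y (congrArg Subtype.val hy))) (smul_invariants_quotObj D) hp
    hker hker (((invFunctor S').map (D.quotMk (r : R))).comm q) (hY.linearisation q)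

/-- The class of x in (rD/r²D)^{S'} is r times a class in (D/rD)^{S'}, by `invMul_surjective`, and
the latter lifts to an invariant y of D because H¹(S', rD) = 0. Then x − r y is an invariant of rD
lying in r(rD), to which the hypothesis on rD applies. -/
lemma exists_smul_of_powObj (hff : (invQuotientMap S' r).FaithfullyFlat) {D : SModule.{w, u} S R}
    (hY : Function.Bijective ((D.quotObj (r : R)).comparison S'))
    (hY' : Function.Bijective (((D.powObj (r : R)).quotObj (r : R)).comparison S'))
    (h1 : H1Vanishes ((D.powObj (r : R)).subAct S'))
    (h : ∀ x ∈ (D.powObj (r : R)).invariants S', (∃ y, x = (r : R) • y) →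
      ∃ y ∈ (D.powObj (r : R)).invariants S', x = (r : R) • y) {x : D}
    (hx : x ∈ D.invariants S') (hxy : ∃ y, x = (r : R) • y) :
    ∃ y ∈ D.invariants S', x = (r : R) • y := by
  have hxr : x ∈ powSubmodule (r : R) D 1 := by rwa [mem_powSubmodule, pow_one]
  let x' : (D.powObj (r : R)).invariants S' := ⟨⟨x, hxr⟩, fun s hs => Subtype.ext (hx s hs)⟩
  obtain ⟨g, hg⟩ := invMul_surjective hff hY hY' ((D.powObj (r : R)).invMk r x')
  obtain ⟨y, hy, hyg⟩ := exists_invariant_lift h1 g.2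
  let y' : D.powObj (r : R) := (LinearMap.lsmul R D ((r : R) ^ 1)).rangeRestrict y
  have hy' : y' ∈ (D.powObj (r : R)).invariants S' := fun s hs => Subtype.ext <| by
    change D.φ s ((r : R) ^ 1 • y) = (r : R) ^ 1 • y
    rw [pow_one, φ_smul_of_mem D hs, hy s hs]
  obtain ⟨z, hz, hxz⟩ := h (x'.1 - y') (sub_mem x'.2 hy') <| (quotMk_eq_zero (r : R)).1 <| by
    rw [map_sub, sub_eq_zero]
    refine (congrArg Subtype.val hg).symm.trans ?_
    change D.quotMul (r : R) (g : D.quotObj (r : R)) = D.quotMul (r : R) ((D.quotMk (r : R)).lin y)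
    rw [hyg]
  refine ⟨y + z, add_mem hy fun s hs => congrArg Subtype.val (hz s hs), ?_⟩
  have := congrArg Subtype.val hxz
  change x - (r : R) ^ 1 • y = (r : R) • (z : D) at this
  rw [pow_one] at this
  rw [smul_add, ← this, add_sub_cancel]

/-- Taking invariants of rD → D → D/rD gives a short exact sequence since H¹(S', rD) = 0. Each
conclusion for D is then an extension argument, or the five lemma, between rD and D/rD. -/
lemma SatisfiesDevissageDescent.of_powObj (hff : (invQuotientMap S' r).FaithfullyFlat)
    {D : SModule.{w, u} S R} {N : ℕ}
    (h : (D.powObj (r : R)).SatisfiesDevissageDescent S' r N)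
    (hY : (D.quotObj (r : R)).SatisfiesDescent S')
    (hY' : Function.Bijective (((D.powObj (r : R)).quotObj (r : R)).comparison S'))
    (hG : IsProjectiveModulo r ((D.quotObj (r : R)).invariants S')) :
    D.SatisfiesDevissageDescent S' r (N + 1) := by
  have hsm : ∀ x ∈ D.invariants S', (∃ y, x = (r : R) • y) →
      ∃ y ∈ D.invariants S', x = (r : R) • y := fun x hx hxy =>
    exists_smul_of_powObj hff hY.comparison hY' h.h1 h.exists_smul hx hxy
  obtain ⟨hp, hker, hbij⟩ := isBijectiveModulo_invMk h.h1 hsm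
  let i : D.powObj (r : R) ⟶ D := ⟨(powSubmodule (r : R) D 1).subtype, fun _ _ => rfl⟩
  let i₀ := ((invFunctor S').map i).lin
  have hi : Function.Injective i.lin := Subtype.val_injective
  have hi₀ : Function.Injective i₀ := fun x y hxy =>
    Subtype.ext (hi (congrArg (fun z : D.invariants S' => (z : D)) hxy))
  have hex : Function.Exact i.lin (D.quotMk (r : R)).lin := fun x => by
    rw [quotMk_eq_zero]
    constructor
    · rintro ⟨y, hy⟩
      exact ⟨⟨x, mem_powSubmodule.2 ⟨y, by rw [pow_one, hy]⟩⟩, rfl⟩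
    · rintro ⟨y, rfl⟩
      obtain ⟨z, hz⟩ := mem_powSubmodule.1 y.2
      exact ⟨z, hz.trans (by rw [pow_one])⟩
  have hex₀ : Function.Exact i₀ (D.invMk r) := fun x => by
    constructor
    · intro hx
      obtain ⟨y, hy⟩ := (hex x).1 (congrArg Subtype.val hx)
      exact ⟨⟨y, fun s hs => hi <| by rw [i.comm, hy, x.2 s hs]⟩, Subtype.ext hy⟩
    · rintro ⟨y, rfl⟩
      exact Subtype.ext ((hex _).2 ⟨_, rfl⟩)
  have hfp : Module.FinitePresentation (InvRing S' R) (D.invariants S') := by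
    have := hG.finitePresentation (smul_invariants_quotObj D)
    have := h.finitePresentation
    have : Module.FinitePresentation (InvRing S' R) (LinearMap.ker (D.invMk r)) :=
      .of_equiv ((LinearEquiv.ofInjective i₀ hi₀).trans
        (LinearEquiv.ofEq _ _ hex₀.linearMap_ker_eq.symm))
    exact Module.finitePresentation_of_ker (D.invMk r) hp
  refine ⟨⟨?_, ?_, fun q => ?_⟩, hfp, ⟨inferInstance, ?_, ?_⟩, hsm⟩
  · exact liftBaseChange_bijective_of_exact (i := i₀) (p := D.invMk r)
      (j := i.lin) (q := (D.quotMk (r : R)).lin)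
      (c' := ((D.powObj (r : R)).invariants S').subtype)
      (c'' := ((D.quotObj (r : R)).invariants S').subtype) hp hex₀ hi hex
      (fun _ => rfl) (fun _ => rfl) h.comparison hY.comparison
  · exact .of_exact (i := i.lin.toAddMonoidHom) (p := (D.quotMk (r : R)).lin.toAddMonoidHom) hi
      (quotMk_surjective _ D) (fun x hx => (hex x).1 hx) (fun _ _ => rfl) (fun _ _ => rfl)
      h.h1 hY.h1
  · exact linearisation_bijective_of_exact (i := i₀) (p := D.invMk r)
      (j := i₀) (q := D.invMk r)
      (f' := ((D.powObj (r : R)).invObj S').act q) (f'' := ((D.quotObj (r : R)).invObj S').act q)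
      hp hex₀ hi₀ hex₀ (fun x => (((invFunctor S').map i).comm q x).symm)
      (fun x => ((invFunctor S').map (D.quotMk (r : R))).comm q x)
      (h.linearisation q) (hY.linearisation q)
  · exact hbij.isProjectiveModulo_iff.2 hG
  -- Both (rD)^{S'} and r D^{S'} are the kernel of D^{S'} → (D/rD)^{S'}; for the second this is the
  -- equality rD ∩ D^{S'} = r D^{S'}.
  · refine h.hasDevissage.of_equiv ((LinearEquiv.ofInjective i₀ hi₀).trans
      (LinearEquiv.ofEq _ _ ?_))
    rw [← hex₀.linearMap_ker_eq]
    ext x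
    rw [mem_powSubmodule, pow_one]
    refine ⟨hker x, ?_⟩
    rintro ⟨w, rfl⟩
    exact invMk_eq_zero.2 ⟨w, rfl⟩

theorem satisfiesDevissageDescent (hff : (invQuotientMap S' r).FaithfullyFlat)
    (hH1 : Subsingleton (MonoidH1 S' (R ⧸ Ideal.span {(r : R)})))
    (hcomp : ∀ D : SModule.{w, u} S (R ⧸ Ideal.span {(r : R)}), SModule.IsEtaleProj D →
      Function.Bijective ((D.restrictScalars (quotientHom S (r : R))).comparison S'))
    {N : ℕ} {D : SModule.{w, u} S R} (hD : HasDevissageOfLength (r : R) N D)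
    (hs : ∀ s, Function.Surjective (_root_.linearisation (D.act s))) :
    D.SatisfiesDevissageDescent S' r N := by
  -- Stated for every module before the induction, since the step needs it for D and for rD.
  have key : ∀ {D : SModule.{w, u} S R}, IsProjectiveModulo (r : R) D →
      (∀ s, Function.Surjective (_root_.linearisation (D.act s))) →
      (D.quotObj (r : R)).SatisfiesDescent S' ∧
        IsProjectiveModulo r ((D.quotObj (r : R)).invariants S') := fun h hs =>
    satisfiesDescent_restrictScalars hff hH1 (isEtaleProj_redObj _ h hs)
      (hcomp _ (isEtaleProj_redObj _ h hs))
  induction N generalizing D with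
  | zero =>
    obtain ⟨h1, h2⟩ := key hD.isProjectiveModulo hs
    exact satisfiesDevissageDescent_of_torsionFree hH1 hD h1 h2
  | succ N ih =>
    obtain ⟨h1, h2⟩ := key hD.isProjectiveModulo hs
    have hs' := fun s => linearisation_powObj_surjective (r : R) (hs s)
    have hD' : HasDevissageOfLength (r : R) N (D.powObj (r : R)) := hD.2.2
    exact (ih hD' hs').of_powObj hff h1 (key hD'.isProjectiveModulo hs').1.comparison h2

end

end SModule

lemma Module.FinitePresentation.tensorProduct (R M N : Type*) [CommRing R] [AddCommGroup M]
    [Module R M] [AddCommGroup N] [Module R N] [Module.FinitePresentation R M]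
    [Module.FinitePresentation R N] : Module.FinitePresentation R (M ⊗[R] N) := by
  obtain ⟨n, m, f, g, hf, hg⟩ := Module.FinitePresentation.exists_fin' R N
  have : Module.FinitePresentation R (M ⊗[R] (Fin n → R)) :=
    .of_equiv (TensorProduct.piScalarRight R R M (Fin n)).symm
  refine Module.finitePresentation_of_surjective (f.lTensor M)
    (LinearMap.lTensor_surjective M hf) ?_
  rw [(lTensor_exact M hg hf).linearMap_ker_eq, LinearMap.range_eq_map]
  exact Module.Finite.fg_top.map _

/-! ### Étale modules with dévissage form a monoidal subcategory -/

namespace SModule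

section

variable {S : Type w} [Monoid S] {R : Type u} [CommRing R] [MulSemiringAction S R]

lemma isIso_of_bijective {D E : SModule.{w, u} S R} (f : D ⟶ E) (h : Function.Bijective f.lin) :
    IsIso f :=
  (mkIso (LinearEquiv.ofBijective f.lin h) f.comm).isIso_hom

lemma IsEtaleDv.exists_hasDevissage {r : R} {D : SModule.{w, u} S R} (h : D.IsEtaleDv r) :
    ∃ N, HasDevissageOfLength r N D := by
  obtain ⟨⟨_, -⟩, h2, N, hN⟩ := h
  exact ⟨N, hasDevissageOfLength_iff.2 ⟨inferInstance, h2, hN⟩⟩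

lemma isEtaleDv_unit (r : R) [IsDevissageSetup S r] : (unit.{w, u} S R).IsEtaleDv r := by
  refine ⟨⟨inferInstanceAs (Module.FinitePresentation R R),
    fun s => linearisation_self_bijective _ (smul_one s)⟩, ?_⟩
  have h : IsProjectiveModulo r R := by
    have h' : IsBijectiveModulo r (Submodule.mkQ (Ideal.span {r} : Submodule R R)) :=
      .mkQ fun x hx => by
        obtain ⟨w, hw⟩ := Ideal.mem_span_singleton.1 hx
        exact ⟨w, hw⟩
    refine h'.isProjectiveModulo_iff.2 (isProjectiveModulo_iff_of_quotient.2
      ⟨inferInstance, inferInstance, 1, fun p => ?_⟩)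
    have := p.nontrivial
    simp
  have hD : HasDevissageOfLength r 0 R :=
    ⟨inferInstance, h, fun a ha => IsDevissageSetup.torsionFree S a ha⟩
  obtain ⟨-, h1, h2⟩ := hasDevissageOfLength_iff.1 hD
  exact ⟨h1, 0, h2⟩

lemma IsEtaleDv.tensor {r : R} [IsDevissageSetup S r] {D E : SModule.{w, u} S R}
    (hD : D.IsEtaleDv r) (hE : E.IsEtaleDv r) : (D.tensor E).IsEtaleDv r := by
  have := IsDevissageSetup.complete (S := S) (r := r)
  obtain ⟨N, hN⟩ := hD.exists_hasDevissage
  obtain ⟨M, hM⟩ := hE.exists_hasDevissage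
  have := hD.1.1
  have := hE.1.1
  exact ⟨⟨Module.FinitePresentation.tensorProduct R D E, fun s =>
    linearisation_map_bijective (hD.1.2 s) (hE.1.2 s)⟩,
    hN.isElementary.tensorProduct_devissage (IsDevissageSetup.torsionFree S) hM.isElementary⟩

lemma isMonoidal_isEtaleDv (r : R) [IsDevissageSetup S r] :
    (IsEtaleDv (S := S) r : ObjectProperty (SModule.{w, u} S R)).IsMonoidal where
  prop_unit := isEtaleDv_unit r
  prop_tensor _ _ hD hE := hD.tensor hE

end

/-! ### Inv is strong monoidal and closed -/

section

variable {S : Type w} [Monoid S] {S' : Submonoid S} {R : Type u} [CommRing R]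
  [MulSemiringAction S R]

variable [IsNormalSubmonoid S']

lemma invTensor_liftBaseChange_bijective {D E : SModule.{w, u} S R}
    (hD : Function.Bijective (D.comparison S')) (hE : Function.Bijective (E.comparison S')) :
    Function.Bijective (((((D.tensor E).invariants S').subtype) ∘ₗ
      (invTensor S' D E).lin).liftBaseChange R) := by
  let e := (AlgebraTensorModule.distribBaseChange (InvRing S' R) R (D.invariants S')
    (E.invariants S')).trans (TensorProduct.congr (LinearEquiv.ofBijective _ hD)
      (LinearEquiv.ofBijective _ hE))
  convert e.bijective using 1
  funext x
  induction x using TensorProduct.induction_on with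
  | zero => simp
  | tmul t y =>
    induction y using TensorProduct.induction_on with
    | zero => simp
    | tmul d d' =>
      change t • ((d : D) ⊗ₜ[R] (d' : E)) = (t • (d : D)) ⊗ₜ[R] ((1 : R) • (d' : E))
      rw [one_smul, TensorProduct.smul_tmul']
    | add x y hx hy => simp only [TensorProduct.tmul_add, map_add, hx, hy]
  | add x y hx hy => simp only [map_add, hx, hy]

/-- R ⊗ (D^{S'} ⊗ E^{S'}) is D ⊗ E by comparison. That its invariants are no larger than D^{S'} ⊗
E^{S'} is where the structure theorem enters, as R need not be flat over R^{S'}. -/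
lemma invTensor_bijective {r : InvRing S' R} [IsDevissageSetup S (r : R)]
    (hH1 : Subsingleton (MonoidH1 S' (R ⧸ Ideal.span {(r : R)}))) {D E : SModule.{w, u} S R}
    (hD : Function.Bijective (D.comparison S')) (hE : Function.Bijective (E.comparison S'))
    (hD' : IsElementary r (D.invariants S')) (hE' : IsElementary r (E.invariants S')) :
    Function.Bijective (invTensor S' D E).lin := by
  obtain ⟨e, he⟩ := exists_equiv_invariants (fun x => ((invTensor S' D E).lin x).2)
    (invTensor_liftBaseChange_bijective hD hE) (.tensorProduct hH1 hD' hE')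
  convert e.bijective using 1
  exact funext fun x => Subtype.ext (he x).symm

lemma invUnit_bijective : Function.Bijective (invUnit (R := R) S').lin :=
  ⟨fun _ _ h => Subtype.ext (congrArg (fun x : (unit S R).invariants S' => (x : R)) h), fun a =>
    ⟨⟨a, (mem_invRing S').2 a.2⟩, rfl⟩⟩

/-- Injectivity: D^{S'} generates D over R. Surjectivity: an R^{S'}-linear map D^{S'} → E^{S'}
extends R-linearly to R ⊗ D^{S'} ≅ D, and the extension is fixed by S' because it is equivariant on
the products a • x. -/
lemma invIhom_bijective {D : SModule.{w, u} S R} (hD : D.IsEtale)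
    (hD' : ((invFunctor S').obj D).IsEtale) (E : SModule.{w, u} S R)
    (hc : Function.Bijective (D.comparison S')) :
    Function.Bijective (invIhom S' hD hD' E).lin := by
  constructor
  · intro f g h
    refine Subtype.ext (LinearMap.ext fun d => ?_)
    obtain ⟨z, rfl⟩ := hc.2 d
    induction z using TensorProduct.induction_on with
    | zero => simp
    | tmul a x =>
      have hx : (f : D →ₗ[R] E) (x : D) = (g : D →ₗ[R] E) (x : D) :=
        congrArg Subtype.val (LinearMap.congr_fun h x)
      change (f : D →ₗ[R] E) (a • (x : D)) = (g : D →ₗ[R] E) (a • (x : D))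
      rw [map_smul, map_smul, hx]
    | add x y hx hy => rw [map_add, map_add, map_add, hx, hy]
  · intro h
    let h' : D.invariants S' →ₗ[InvRing S' R] E.invariants S' := h
    let f : D →ₗ[R] E := ((E.invariants S').subtype ∘ₗ h').liftBaseChange R ∘ₗ
      (LinearEquiv.ofBijective _ hc).symm.toLinearMap
    have hf : ∀ (a : R) (x : D.invariants S'), f (a • (x : D)) = a • (h' x : E) := fun a x => by
      have : (LinearEquiv.ofBijective _ hc).symm (a • (x : D)) = a ⊗ₜ x := by
        rw [LinearEquiv.symm_apply_eq]
        rfl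
      change ((E.invariants S').subtype ∘ₗ h').liftBaseChange R
        ((LinearEquiv.ofBijective _ hc).symm (a • (x : D))) = _
      rw [this]
      rfl
    have hfs : f ∈ (ihom hD E).invariants S' := fun s hs => ihomAct_unique hD fun d => by
      obtain ⟨z, rfl⟩ := hc.2 d
      induction z using TensorProduct.induction_on with
      | zero => simp
      | tmul a x =>
        change f (D.φ s (a • (x : D))) = E.φ s (f (a • (x : D)))
        rw [D.φ_smul, x.2 s hs, hf, hf, E.φ_smul, (h' x).2 s hs]
      | add x y hx hy => simp only [map_add, hx, hy]
    refine ⟨⟨f, hfs⟩, LinearMap.ext fun x => Subtype.ext ?_⟩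
    change f (x : D) = (h' x : E)
    rw [← one_smul R (x : D), hf, one_smul]

/-- If the unit and tensor morphisms of `Inv` are isomorphisms on `P`, then the restriction of
`Inv` to `P` is strong symmetric monoidal. -/
lemma exists_braided_invRestrict {P : ObjectProperty (SModule.{w, u} S R)}
    {Q : ObjectProperty (SModule.{w, u} (QuotMonoid S') (InvRing S' R))} [P.IsMonoidal]
    [Q.IsMonoidal] (h : ∀ D, P D → Q ((invFunctor S').obj D))
    (hμ : ∀ D E, P D → P E → Function.Bijective (invTensor S' D E).lin) :
    ∃ _ : (invRestrict S' h).Braided,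
      (Functor.LaxMonoidal.ε (invRestrict S' h)).hom =
        Functor.LaxMonoidal.ε (invFunctor (R := R) S') ∧
      ∀ D E : P.FullSubcategory, (Functor.LaxMonoidal.μ (invRestrict S' h) D E).hom =
        Functor.LaxMonoidal.μ (invFunctor S') D.obj E.obj := by
  let εIso : 𝟙_ Q.FullSubcategory ≅ (invRestrict S' h).obj (𝟙_ P.FullSubcategory) :=
    Q.isoMk (@asIso _ _ _ _ (invUnit (R := R) S') (isIso_of_bijective _ invUnit_bijective))
  let μIso : ∀ D E : P.FullSubcategory,
      (invRestrict S' h).obj D ⊗ (invRestrict S' h).obj E ≅ (invRestrict S' h).obj (D ⊗ E) :=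
    fun D E => Q.isoMk (@asIso _ _ _ _ (invTensor S' D.obj E.obj)
      (isIso_of_bijective _ (hμ _ _ D.property E.property)))
  let c : (invRestrict S' h).CoreMonoidal :=
    { εIso := εIso
      μIso := μIso
      μIso_hom_natural_left := fun f E => by
        ext1
        exact Functor.LaxMonoidal.μ_natural_left (invFunctor S') f.hom E.obj
      μIso_hom_natural_right := fun E f => by
        ext1
        exact Functor.LaxMonoidal.μ_natural_right (invFunctor S') E.obj f.hom
      associativity := fun D E F => by
        ext1
        exact Functor.LaxMonoidal.associativity (invFunctor S') D.obj E.obj F.obj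
      left_unitality := fun D => by
        ext1
        exact Functor.LaxMonoidal.left_unitality (invFunctor S') D.obj
      right_unitality := fun D => by
        ext1
        exact Functor.LaxMonoidal.right_unitality (invFunctor S') D.obj }
  exact ⟨{ c.toMonoidal with
    braided := fun D E => by
      ext1
      exact Functor.LaxBraided.braided (F := invFunctor S') D.obj E.obj }, rfl, fun _ _ => rfl⟩

end

end SModule

theorem theorem4p12 {S : Type w} [Monoid S] (S' : Submonoid S) [IsNormalSubmonoid S']
    {R : Type u} [CommRing R] [MulSemiringAction S R]
    (r : InvRing S' R) [IsDevissageSetup S (r : R)]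
    (hff : (invQuotientMap S' r).FaithfullyFlat)
    (hH1 : Subsingleton (MonoidH1 S' (R ⧸ Ideal.span {(r : R)})))
    (hcomp : ∀ D : SModule.{w, u} S (R ⧸ Ideal.span {(r : R)}), SModule.IsEtaleProj D →
      Function.Bijective ((D.restrictScalars (quotientHom S (r : R))).comparison S')) :
    (∀ D : SModule.{w, u} S R, SModule.IsEtaleDv (r : R) D →
      Function.Bijective (D.comparison S')) ∧
    ∃ hInv : ∀ D : SModule.{w, u} S R, SModule.IsEtaleDv (r : R) D →
        SModule.IsEtaleDv r ((SModule.invFunctor S').obj D),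
      (∃ (_ : (SModule.IsEtaleDv (S := S) (r : R)).IsMonoidal)
          (_ : (SModule.IsEtaleDv (S := QuotMonoid S') r).IsMonoidal)
          (_ : (SModule.invRestrict S' hInv).Braided),
        (Functor.LaxMonoidal.ε (SModule.invRestrict S' hInv)).hom =
          Functor.LaxMonoidal.ε (SModule.invFunctor (R := R) S') ∧
        ∀ D E : (SModule.IsEtaleDv (S := S) (r : R)).FullSubcategory,
          (Functor.LaxMonoidal.μ (SModule.invRestrict S' hInv) D E).hom =
            Functor.LaxMonoidal.μ (SModule.invFunctor S') D.obj E.obj) ∧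
      ∀ (D E : SModule.{w, u} S R) (hD : SModule.IsEtaleDv (r : R) D),
        SModule.IsEtaleDv (r : R) E →
          IsIso (SModule.invIhom S' hD.1 (hInv D hD).1 E) := by
  have hd : IsDevissageSetup (QuotMonoid S') r := isDevissageSetup_invRing r
  have hc := isAdicComplete_invRing r
  have key : ∀ D : SModule.{w, u} S R, SModule.IsEtaleDv (r : R) D →
      ∃ N, D.SatisfiesDevissageDescent S' r N := fun D hD => by
    obtain ⟨N, hN⟩ := hD.exists_hasDevissage
    exact ⟨N, SModule.satisfiesDevissageDescent hff hH1 hcomp hN fun s => (hD.1.2 s).2⟩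
  have hcmp : ∀ D : SModule.{w, u} S R, SModule.IsEtaleDv (r : R) D →
      Function.Bijective (D.comparison S') := fun D hD => (key D hD).choose_spec.comparison
  have hel : ∀ D : SModule.{w, u} S R, SModule.IsEtaleDv (r : R) D →
      IsElementary r (D.invariants S') := fun D hD =>
    (key D hD).choose_spec.hasDevissage.isElementary
  have hInv : ∀ D : SModule.{w, u} S R, SModule.IsEtaleDv (r : R) D →
      SModule.IsEtaleDv r ((SModule.invFunctor S').obj D) := fun D hD => by
    obtain ⟨N, hN⟩ := key D hD
    obtain ⟨-, h1, h2⟩ := hasDevissageOfLength_iff.1 hN.hasDevissage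
    exact ⟨⟨hN.finitePresentation, hN.linearisation⟩, h1, N, h2⟩
  have hP := SModule.isMonoidal_isEtaleDv (S := S) (r : R)
  have hQ := SModule.isMonoidal_isEtaleDv (S := QuotMonoid S') r
  exact ⟨hcmp, hInv, ⟨hP, hQ, SModule.exists_braided_invRestrict hInv fun D E hD hE =>
    SModule.invTensor_bijective hH1 (hcmp D hD) (hcmp E hE) (hel D hD) (hel E hE)⟩,
    fun D E hD _ => SModule.isIso_of_bijective _
      (SModule.invIhom_bijective hD.1 (hInv D hD).1 E (hcmp D hD))⟩
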